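/- **Notation.** Let $\mathbb T=[-\pi,\pi]$ (periodic), $\langle u\rangle=\frac1{2\pi}\int_{\mathbb T}u\,dx$, $\hat u(k)=\frac1{2\pi}\int_{\mathbb T}u(x)e^{-ikx}dx$. For zero-mean $u$ put $\|u\|_{\dot A^s}=\sum_k|k|^s|\hat u(k)|$ and $\|u\|_{\dot H^s}^2=\sum_k|k|^{2s}|\hat u(k)|^2$, let $\dot A^s,\dot H^s$ be the spaces of zero-mean functions (in $L^1(\mathbb T)$, resp. $L^2(\mathbb T)$) with finite norm, and set $$\mathcal E_s(u,v)=\|u\|_{\dot A^s}+\|v\|_{\dot A^s},\qquad E_s(u,v)=\|u\|_{\dot H^s}^2+\|v\|_{\dot H^s}^2 .$$ Let $\rho_\pm,\mu_\pm>0$ be the densities and viscosities of two fluids (the lower one indexed by $-$, the upper one by $+$) and $b=\rho_+$, $b_\mu=\frac{\mu_-}{\mu_+}b$, $b_\rho=\frac{\rho_-}{\rho_+}b$. Given initial data $f_0,g_0$ on $\mathbb T$ let $\bar f_0=f_0-\langle f_0\rangle$, $\bar g_0=g_0-\langle g_0\rangle$, and consider the gravity-driven thin film Muskat system (no surface tension)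 $$\partial_t\bar f=\partial_x\big[(\bar f+\langle f_0\rangle)(b_\rho\partial_x\bar f+b\,\partial_x\bar g)\big],\qquad \partial_t\bar g=\partial_x\big[(\bar g+\langle g_0\rangle)(b_\mu\partial_x\bar f+b_\mu\partial_x\bar g)\big].$$ A weak solution on $[0,T)$ with initial datum $(\bar f_0,\bar g_0)$ is a pair of zero-mean functions $(\bar f,\bar g)\in (L^1(0,T;W^{1,1}(\mathbb T)))^2$ such that, for all $\phi,\psi\in C^1_c([0,T)\times\mathbb T)$ (all integrals converging absolutely), $$-\int_{\mathbb T}\bar f_0\phi(0)\,dx-\int_0^T\!\!\int_{\mathbb T}\bar f\,\partial_t\phi\,dx\,dt=-\int_0^T\!\!\int_{\mathbb T}(\bar f+\langle f_0\rangle)(b_\rho\partial_x\bar f+b\,\partial_x\bar g)\,\partial_x\phi\,dx\,dt,$$ $$-\int_{\mathbb T}\bar g_0\psi(0)\,dx-\int_0^T\!\!\int_{\mathbb T}\bar g\,\partial_t\psi\,dx\,dt=-\int_0^T\!\!\int_{\mathbb T}(\bar g+\langle g_0\rangle)(b_\mu\partial_x\bar f+b_\mu\partial_x\bar g)\,\partial_x\psi\,dx\,dt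 .$$ **Theorem.** Let $\bar f_0,\bar g_0\in\dot H^1(\mathbb T)$ and write $\mathcal E_0=\mathcal E_0(\bar f_0,\bar g_0)$. Assume $\mathcal E_0<\min\{\langle f_0\rangle,\langle g_0\rangle\}$, $$\langle f_0\rangle b_\rho-\langle g_0\rangle b_\mu-\mathcal E_0\,(2b_\rho+2b+4b_\mu)>0,\qquad \langle g_0\rangle b_\mu-\langle f_0\rangle b-\mathcal E_0\,(2b_\rho+2b+4b_\mu)>0,$$ and in addition $$\langle f_0\rangle b_\rho-\tfrac12\big(\langle g_0\rangle b_\mu+\langle f_0\rangle b\big)-\big(b_\rho+b_\mu+\tfrac{5b_\mu}2+\tfrac{5b}2\big)\mathcal E_0>0,$$ $$\langle g_0\rangle b_\mu-\tfrac12\big(\langle g_0\rangle b_\mu+\langle f_0\rangle b\big)-\big(b_\rho+b_\mu+\tfrac{5b_\mu}2+\tfrac{5b}2\big)\mathcal E_0>0.$$ Then there are positive constants $\delta,c_1,c_2,c_3$ and, for each $s\in[0,1)$, $c=c(s)>0$, depending only on the initial data and on $\rho_\pm,\mu_\pm$ (and $c$ on $s$) but not on $T$, and there is a global weak solution $(\bar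 f,\bar g)$ of the system with initial datum $(\bar f_0,\bar g_0)$ such that for every $T>0$: * both components lie in $L^\infty([0,T]\times\mathbb T)\cap L^2(0,T;W^{1,\infty}(\mathbb T))\cap L^1(0,T;C^{1+\alpha}(\mathbb T))\cap\mathcal M(0,T;W^{2,\infty}(\mathbb T))\cap L^2(0,T;\dot H^1(\mathbb T))$ for all $\alpha\in[0,\frac12)$, where $u\in\mathcal M(0,T;W^{2,\infty})$ means that $u$ and $\partial_x^2u$ are finite $L^\infty(\mathbb T)$-valued Radon measures on $(0,T)$ (bounded functionals on $C_0((0,T);L^1(\mathbb T))$), and $$\|\bar f(T)\|_{L^\infty}+\|\bar g(T)\|_{L^\infty}\le\mathcal E_0\,e^{-\delta T};$$ * moreover, $(\bar f,\bar g)\in\big(C([0,T];\dot H^1(\mathbb T))\cap L^2(0,T;\dot H^2(\mathbb T))\big)^2$, with i) $E_1(\bar f(T),\bar g(T))+c_1\int_0^TE_2(\bar f(s),\bar g(s))\,ds\le c_2$; ii) $E_s(\bar f(T),\bar g(T))\le c_3e^{-cT}$ for all $0\le s<1$. -/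

import Mathlib

open Real MeasureTheory Set Filter Topology
open scoped NNReal ENNReal ContDiff

noncomputable section

namespace Muskat

/-- Lebesgue measure on the torus `𝕋 = [-π, π]`.  A function on `𝕋` is represented by a function
`ℝ → ℝ`, of which only the values almost everywhere on `(-π, π]` matter. -/
def torus : Measure ℝ := volume.restrict (Ioc (-π) π)

/-- The measure `dt dx` on the space-time cylinder `(0, T) × 𝕋`. -/
def cylinder (T : ℝ) : Measure (ℝ × ℝ) := (volume.restrict (Ioo 0 T)).prod torus

/-- The mean `⟨u⟩ = (1 / 2π) ∫_𝕋 u`. -/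
def mean (u : ℝ → ℝ) : ℝ := (1 / (2 * π)) * ∫ x in (-π)..π, u x

/-- The zero-mean part `u - ⟨u⟩`. -/
def centered (u : ℝ → ℝ) : ℝ → ℝ := fun x => u x - mean u

/-- The Fourier coefficient `û(k) = (1 / 2π) ∫_𝕋 u(x) e^{-ikx} dx`. -/
def coeff (u : ℝ → ℝ) (k : ℤ) : ℂ :=
  fourierCoeffOn (neg_lt_self Real.pi_pos) (fun x => (u x : ℂ)) k

/-- The norm `∑ |k|^s |û(k)|` of the zero-mean Wiener space `Ȧ^s(𝕋)`; it is `∞` off the space. -/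
def wienerNorm (s : ℝ) (u : ℝ → ℝ) : ℝ≥0∞ :=
  ⨅ _ : Integrable u torus ∧ mean u = 0,
    ∑' k : ℤ, ENNReal.ofReal (|(k : ℝ)| ^ s) * ‖coeff u k‖ₑ

/-- The norm `(∑ |k|^{2s} |û(k)|²)^{1/2}` of the zero-mean Sobolev space `Ḣ^s(𝕋)`; it is `∞` off
the space. -/
def hdotNorm (s : ℝ) (u : ℝ → ℝ) : ℝ≥0∞ :=
  ⨅ _ : MemLp u 2 torus ∧ mean u = 0,
    (∑' k : ℤ, ENNReal.ofReal (|(k : ℝ)| ^ (2 * s)) * ‖coeff u k‖ₑ ^ 2) ^ (1 / 2 : ℝ)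

/-- `𝓔_s(u, v) = ‖u‖_{Ȧ^s} + ‖v‖_{Ȧ^s}`. -/
def wienerEnergy (s : ℝ) (u v : ℝ → ℝ) : ℝ≥0∞ := wienerNorm s u + wienerNorm s v

/-- `E_s(u, v) = ‖u‖²_{Ḣ^s} + ‖v‖²_{Ḣ^s}`. -/
def sobolevEnergy (s : ℝ) (u v : ℝ → ℝ) : ℝ≥0∞ := hdotNorm s u ^ 2 + hdotNorm s v ^ 2

/-- `v` is the weak derivative of order `n` of `u` on the torus. -/
def IsWeakDeriv (n : ℕ) (u v : ℝ → ℝ) : Prop :=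
  Integrable u torus ∧ Integrable v torus ∧
    ∀ φ : ℝ → ℝ, ContDiff ℝ ∞ φ → Function.Periodic φ (2 * π) →
      ∫ x in (-π)..π, u x * iteratedDeriv n φ x = (-1) ^ n * ∫ x in (-π)..π, v x * φ x

/-- The norm `‖u‖_{L^p} + ‖∂ₓⁿ u‖_{L^p}` of `W^{n,p}(𝕋)`; it is `∞` off the space.  (The weak
derivative is unique almost everywhere.) -/
def sobolevNorm (n : ℕ) (p : ℝ≥0∞) (u : ℝ → ℝ) : ℝ≥0∞ :=
  eLpNorm u p torus + ⨅ (v : ℝ → ℝ) (_ : IsWeakDeriv n u v), eLpNorm v p torus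

/-- The norm `sup |w| + sup |w'| + [w']_α` of `C^{1+α}(𝕋)`, where `w` is the periodic `C¹`
representative of `u`; it is `∞` off the space. -/
def holderNorm (α : ℝ≥0) (u : ℝ → ℝ) : ℝ≥0∞ :=
  ⨅ (w : ℝ → ℝ) (_ : ContDiff ℝ 1 w ∧ Function.Periodic w (2 * π) ∧ u =ᵐ[torus] w),
    (⨆ x, ‖w x‖ₑ) + (⨆ x, ‖deriv w x‖ₑ) + (eHolderNorm α (deriv w) : ℝ≥0∞)

/-- The Bochner space `L^p(0, T; X)`, where `X` is the space of functions on the torus with finite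
norm `N`: `t ↦ u(t)` is strongly measurable (almost everywhere the limit in `X` of simple functions
with values in `X`) and `∫₀ᵀ ‖u(t)‖_X^p dt < ∞`. -/
def InBochner (N : (ℝ → ℝ) → ℝ≥0∞) (p T : ℝ) (u : ℝ → ℝ → ℝ) : Prop :=
  (∃ s : ℕ → SimpleFunc ℝ (ℝ → ℝ), (∀ n t, N (s n t) < ⊤) ∧
    ∀ᵐ t ∂(volume.restrict (Ioo 0 T)), Tendsto (fun n => N (u t - s n t)) atTop (𝓝 0)) ∧
  ∫⁻ t in Ioo 0 T, N (u t) ^ p < ⊤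

/-- The space `C([0, T]; X)`, where `X` is the space of functions with finite norm `N`. -/
def InCont (N : (ℝ → ℝ) → ℝ≥0∞) (T : ℝ) (u : ℝ → ℝ → ℝ) : Prop :=
  (∀ t ∈ Icc 0 T, N (u t) < ⊤) ∧
    ∀ t₀ ∈ Icc 0 T, Tendsto (fun t => N (u t - u t₀)) (𝓝[Icc 0 T] t₀) (𝓝 0)

/-- `∂ₓⁿ u ∈ 𝓜(0, T; L^∞(𝕋))`, the finite `L^∞(𝕋)`-valued (weak-star) Radon measures on `(0, T)`,
i.e. the dual of `C₀((0, T); L¹(𝕋))`: the distribution `∂ₓⁿ u` satisfies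
`|⟨∂ₓⁿ u, φ⟩| ≤ C sup_t ‖φ(t)‖_{L¹}` for all smooth `φ` compactly supported in `(0, T) × 𝕋`. -/
def DerivIsMeasure (n : ℕ) (T : ℝ) (u : ℝ → ℝ → ℝ) : Prop :=
  Integrable (Function.uncurry u) (cylinder T) ∧
  ∃ C : ℝ, ∀ φ : ℝ → ℝ → ℝ, ContDiff ℝ ∞ (Function.uncurry φ) →
    (∀ t, Function.Periodic (φ t) (2 * π)) →
    (∃ a b : ℝ, 0 < a ∧ b < T ∧ ∀ t ∉ Icc a b, ∀ x, φ t x = 0) →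
    ∀ S : ℝ, (∀ t, ∫ x in (-π)..π, |φ t x| ≤ S) →
      |∫ t in (0)..T, ∫ x in (-π)..π, u t x * iteratedDeriv n (φ t) x| ≤ C * S

/-- `u ∈ 𝓜(0, T; W^{2,∞}(𝕋))`. -/
def InMeasureW2 (T : ℝ) (u : ℝ → ℝ → ℝ) : Prop :=
  DerivIsMeasure 0 T u ∧ DerivIsMeasure 2 T u

/-- The test functions `C¹_c([0, T) × 𝕋)`, extended to a `C¹` function on `ℝ × ℝ`,
periodic in space. -/
structure IsTest (T : ℝ) (φ : ℝ → ℝ → ℝ) : Prop where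
  contDiff : ContDiff ℝ 1 (Function.uncurry φ)
  periodic : ∀ t, Function.Periodic (φ t) (2 * π)
  support : ∃ T' < T, ∀ t, T' ≤ t → ∀ x, φ t x = 0

/-- `(f, g)` is a weak solution on `[0, T)`, with zero-mean initial datum `(f₀, g₀)`, of
`∂ₜ f = ∂ₓ[(f + m)(bρ ∂ₓ f + b ∂ₓ g)]`, `∂ₜ g = ∂ₓ[(g + n)(bμ ∂ₓ f + bμ ∂ₓ g)]`. -/
structure IsWeakSolution (b bρ bμ m n : ℝ) (f₀ g₀ : ℝ → ℝ) (T : ℝ) (f g : ℝ → ℝ → ℝ) :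
    Prop where
  mem_f : InBochner (sobolevNorm 1 1) 1 T f
  mem_g : InBochner (sobolevNorm 1 1) 1 T g
  mean_f : ∀ᵐ t ∂(volume.restrict (Ioo 0 T)), mean (f t) = 0
  mean_g : ∀ᵐ t ∂(volume.restrict (Ioo 0 T)), mean (g t) = 0
  integrable_f : Integrable (Function.uncurry f) (cylinder T)
  integrable_g : Integrable (Function.uncurry g) (cylinder T)
  /-- `fx`, `gx` are the weak derivatives `∂ₓ f`, `∂ₓ g`; all integrals below converge. -/
  weak : ∃ fx gx : ℝ → ℝ → ℝ,
    (∀ᵐ t ∂(volume.restrict (Ioo 0 T)), IsWeakDeriv 1 (f t) (fx t) ∧ IsWeakDeriv 1 (g t) (gx t)) ∧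
    Integrable (Function.uncurry fx) (cylinder T) ∧
    Integrable (Function.uncurry gx) (cylinder T) ∧
    Integrable (Function.uncurry fun t x => f t x * (bρ * fx t x + b * gx t x)) (cylinder T) ∧
    Integrable (Function.uncurry fun t x => g t x * (bμ * fx t x + bμ * gx t x)) (cylinder T) ∧
    (∀ φ, IsTest T φ →
      -(∫ x in (-π)..π, f₀ x * φ 0 x)
          - ∫ t in (0)..T, ∫ x in (-π)..π, f t x * deriv (fun r => φ r x) t =
        -(m * ∫ t in (0)..T, ∫ x in (-π)..π, (bρ * fx t x + b * gx t x) * deriv (φ t) x)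
          - ∫ t in (0)..T, ∫ x in (-π)..π,
              f t x * (bρ * fx t x + b * gx t x) * deriv (φ t) x) ∧
    (∀ ψ, IsTest T ψ →
      -(∫ x in (-π)..π, g₀ x * ψ 0 x)
          - ∫ t in (0)..T, ∫ x in (-π)..π, g t x * deriv (fun r => ψ r x) t =
        -(n * ∫ t in (0)..T, ∫ x in (-π)..π, (bμ * fx t x + bμ * gx t x) * deriv (ψ t) x)
          - ∫ t in (0)..T, ∫ x in (-π)..π,
              g t x * (bμ * fx t x + bμ * gx t x) * deriv (ψ t) x)

/-- The regularity, on `(0, T)`, of the weak solutions constructed in the Wiener algebra: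
`L^∞([0,T] × 𝕋) ∩ L²(0,T; W^{1,∞}) ∩ L¹(0,T; C^{1+α}) ∩ 𝓜(0,T; W^{2,∞}) ∩ L²(0,T; Ḣ¹)`
for all `α ∈ [0, 1/2)`. -/
structure WienerRegularity (T : ℝ) (u : ℝ → ℝ → ℝ) : Prop where
  bounded : MemLp (Function.uncurry u) ⊤ (cylinder T)
  lipschitz : InBochner (sobolevNorm 1 ⊤) 2 T u
  holder : ∀ α : ℝ≥0, α < 1 / 2 → InBochner (holderNorm α) 1 T u
  measure : InMeasureW2 T u
  hdot : InBochner (hdotNorm 1) 2 T u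

end Muskat

end

open Muskat

/-!
The solution is constructed on the Fourier side, as a pair of families `t ↦ (f_k(t))_k`,
`t ↦ (g_k(t))_k` of coefficients with
`f_k' = -m k² (α f_k + β g_k) - k ∑ⱼ f_{k-j} j (α f_j + β g_j)` and the same equation for `g` with
`n, α', β'`.

**Galerkin approximation.** The system truncated to `0 < |k| ≤ N`, with the unknowns on the right-hand
side retracted onto the `ℓ¹` ball of radius `E`, is an ordinary differential equation with a Lipschitz
and bounded vector field; it has a solution on `[0, N]` (`exists_galerkin_retracted`).

**Wiener algebra.** By Young's inequality and the interpolation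
`(∑ |k| |f_k|)² ≤ ∑ |f_k| ∑ k² |f_k|` the nonlinearity is bounded by a multiple of
`E ∑ k² (|f_k| + |g_k|)`.  The first pair of smallness conditions says that the diagonal diffusion
exceeds this and the linear coupling by a margin `σ > 0` (`IsGalerkin.wiener_estimate`).  Hence the
`ℓ¹` norm never exceeds its initial value `E`, the retraction is inactive, the `ℓ¹` norm decays like
`e^{-σt/2}`, and `∑ k² (|f_k| + |g_k|)` is integrable in time, uniformly in `N`.

**Energy.** In the same way the second pair of conditions leaves a margin `2κ` in the equation for the
squared `Ḣ¹` norm, up to a multiple of this norm whose factor is integrable in time by the previous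
step.  A Gronwall argument gives decay like `e^{-κt}` together with `κ ∫ ‖·‖²_{Ḣ²}`
(`IsGalerkin.sobolev_estimate`).  The same computation for each frequency bounds `∑ₖ supₜ k² |f_k(t)|²`
(`IsGalerkin.sum_sq_le`).

**Limit.** A limit along an ultrafilter exists for each coefficient and time.  The right-hand side is
continuous on the balls of `Ḣ¹`, which are compact in the topology of pointwise convergence
(`continuousOn_rhs`, `isCompact_sobolevBall`), so that the convergence is locally uniform in time, the
limit solves the system, and the bounds persist (`exists_fourierSolution`).

**Physical space.** The unknowns are the sums of their absolutely convergent Fourier series.  Each of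
the norms in question is bounded by a weighted `ℓ¹` or `ℓ²` norm of the coefficients; strong
measurability in time comes from the approximation of finitely many coefficients by simple functions
(`inBochner_synth`), and continuity in time with values in `Ḣ¹` from the summable bounds that are
uniform in time (`IsProfile.inCont`).  The weak formulation is Parseval's identity at almost every
time, with integration by parts in time for each frequency (`IsProfile.weak_formulation`).  As the
functions have zero mean, the `Ḣ^s` norm with `s ≤ 1` is at most the `Ḣ¹` norm, so that the rate `κ`
serves for all `s`.
-/

noncomputable section

namespace Muskat

open scoped ComplexConjugate

/-! ### Convolution estimates for Fourier coefficients -/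

/-- The coefficients of `f * (-i ∂ₓ h)`, in terms of the Fourier coefficients of `f` and `h`. -/
def conv (f h : ℤ → ℂ) (k : ℤ) : ℂ := ∑' j : ℤ, f (k - j) * (j * h j)

/-- The Fourier coefficients of `∂ₓ[(f + m) ∂ₓ(α f + β g)]`. -/
def rhs (m α β : ℝ) (f g : ℤ → ℂ) (k : ℤ) : ℂ :=
  -((m * k ^ 2 : ℝ) * (α * f k + β * g k)) - k * conv f (fun j => α * f j + β * g j) k

/-- The weighted sum `∑_{k ∈ S} |k|^i |f_k|`. -/
def wsum (S : Finset ℤ) (i : ℕ) (f : ℤ → ℂ) : ℝ := ∑ k ∈ S, |(k : ℝ)| ^ i * ‖f k‖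

/-- The weighted sum of squares `∑_{k ∈ S} |k|^{2i} |f_k|²`. -/
def qsum (S : Finset ℤ) (i : ℕ) (f : ℤ → ℂ) : ℝ := ∑ k ∈ S, (|(k : ℝ)| ^ i * ‖f k‖) ^ 2

lemma wsum_nonneg (S : Finset ℤ) (i : ℕ) (f : ℤ → ℂ) : 0 ≤ wsum S i f :=
  Finset.sum_nonneg fun _ _ => by positivity

lemma qsum_nonneg (S : Finset ℤ) (i : ℕ) (f : ℤ → ℂ) : 0 ≤ qsum S i f :=
  Finset.sum_nonneg fun _ _ => by positivity

lemma abs_int_pow_le {k : ℤ} {i j : ℕ} (hij : i ≤ j) (hi : 0 < i ∨ k ≠ 0) :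
    |(k : ℝ)| ^ i ≤ |(k : ℝ)| ^ j := by
  rcases eq_or_ne k 0 with rfl | hk
  · have hi : 0 < i := by simpa using hi
    simp [hi.ne', (hi.trans_le hij).ne']
  · refine pow_le_pow_right₀ ?_ hij
    exact_mod_cast Int.one_le_abs hk

lemma wsum_mono_exp {S : Finset ℤ} {i j : ℕ} (hij : i ≤ j) {f : ℤ → ℂ} (hf : f 0 = 0) :
    wsum S i f ≤ wsum S j f := by
  refine Finset.sum_le_sum fun k _ => ?_
  rcases eq_or_ne k 0 with rfl | hk
  · simp [hf]
  · exact mul_le_mul_of_nonneg_right (abs_int_pow_le hij (.inr hk)) (norm_nonneg _)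

lemma qsum_mono_exp {S : Finset ℤ} {i j : ℕ} (hij : i ≤ j) {f : ℤ → ℂ} (hf : f 0 = 0) :
    qsum S i f ≤ qsum S j f := by
  refine Finset.sum_le_sum fun k _ => ?_
  rcases eq_or_ne k 0 with rfl | hk
  · simp [hf]
  · have := abs_int_pow_le hij (.inr hk)
    gcongr

lemma sum_le_sum_of_support {S K : Finset ℤ} {a : ℤ → ℝ} (h0 : ∀ k, 0 ≤ a k)
    (ha : ∀ k ∉ S, a k = 0) : ∑ k ∈ K, a k ≤ ∑ k ∈ S, a k := by
  calc ∑ k ∈ K, a k ≤ ∑ k ∈ K ∪ S, a k :=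
        Finset.sum_le_sum_of_subset_of_nonneg Finset.subset_union_left fun k _ _ => h0 k
    _ = ∑ k ∈ S, a k :=
        (Finset.sum_subset Finset.subset_union_right fun k _ hk => ha k hk).symm

lemma sum_shift_left_le {S : Finset ℤ} {a : ℤ → ℝ} (h0 : ∀ k, 0 ≤ a k)
    (ha : ∀ k ∉ S, a k = 0) (k : ℤ) : ∑ j ∈ S, a (k - j) ≤ ∑ j ∈ S, a j := by
  have : ∑ j ∈ S, a (k - j) = ∑ i ∈ S.image (fun j => k - j), a i :=
    (Finset.sum_image fun x _ y _ h => by simpa using h).symm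
  rw [this]
  exact sum_le_sum_of_support h0 ha

lemma sum_shift_right_le {S : Finset ℤ} {a : ℤ → ℝ} (h0 : ∀ k, 0 ≤ a k)
    (ha : ∀ k ∉ S, a k = 0) (j : ℤ) : ∑ k ∈ S, a (k - j) ≤ ∑ k ∈ S, a k := by
  have : ∑ k ∈ S, a (k - j) = ∑ i ∈ S.image (fun k => k - j), a i :=
    (Finset.sum_image fun x _ y _ h => by simpa using h).symm
  rw [this]
  exact sum_le_sum_of_support h0 ha

/-- Young's inequality `ℓ¹ * ℓ¹ ⊆ ℓ¹` for finite sums. -/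
lemma sum_sum_conv_le {S : Finset ℤ} {a b : ℤ → ℝ} (h0 : ∀ k, 0 ≤ a k)
    (ha : ∀ k ∉ S, a k = 0) (hb : ∀ k, 0 ≤ b k) :
    ∑ k ∈ S, ∑ j ∈ S, a (k - j) * b j ≤ (∑ k ∈ S, a k) * ∑ j ∈ S, b j := by
  rw [Finset.sum_comm, Finset.mul_sum]
  refine Finset.sum_le_sum fun j _ => ?_
  rw [← Finset.sum_mul]
  exact mul_le_mul_of_nonneg_right (sum_shift_right_le h0 ha j) (hb j)

/-- Young's inequality `ℓ¹ * ℓ² ⊆ ℓ²`, in the dual form with a parameter `r`. -/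
lemma sum_sum_trilinear_le {S : Finset ℤ} {a b c : ℤ → ℝ} (h0 : ∀ k, 0 ≤ a k)
    (ha : ∀ k ∉ S, a k = 0) {r : ℝ} (hr : 0 < r) :
    ∑ k ∈ S, ∑ j ∈ S, c k * (a (k - j) * b j) ≤
      (∑ k ∈ S, a k) * (r / 2 * ∑ k ∈ S, c k ^ 2 + 1 / (2 * r) * ∑ k ∈ S, b k ^ 2) := by
  have key : ∀ k j, c k * (a (k - j) * b j) ≤
      r / 2 * (a (k - j) * c k ^ 2) + 1 / (2 * r) * (a (k - j) * b j ^ 2) := by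
    intro k j
    have h : c k * b j ≤ r / 2 * c k ^ 2 + 1 / (2 * r) * b j ^ 2 := by
      have : r / 2 * c k ^ 2 + 1 / (2 * r) * b j ^ 2 - c k * b j
          = (r * c k - b j) ^ 2 / (2 * r) := by field_simp; ring
      have h2 : 0 ≤ (r * c k - b j) ^ 2 / (2 * r) := by positivity
      linarith
    nlinarith [mul_le_mul_of_nonneg_left h (h0 (k - j))]
  calc ∑ k ∈ S, ∑ j ∈ S, c k * (a (k - j) * b j)
      ≤ ∑ k ∈ S, ∑ j ∈ S,
          (r / 2 * (a (k - j) * c k ^ 2) + 1 / (2 * r) * (a (k - j) * b j ^ 2)) :=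
        Finset.sum_le_sum fun k _ => Finset.sum_le_sum fun j _ => key k j
    _ = r / 2 * ∑ k ∈ S, (∑ j ∈ S, a (k - j)) * c k ^ 2
          + 1 / (2 * r) * ∑ j ∈ S, (∑ k ∈ S, a (k - j)) * b j ^ 2 := by
        simp_rw [Finset.sum_add_distrib, Finset.mul_sum, Finset.sum_mul, Finset.mul_sum]
        congr 1
        rw [Finset.sum_comm]
    _ ≤ r / 2 * ∑ k ∈ S, (∑ j ∈ S, a j) * c k ^ 2
          + 1 / (2 * r) * ∑ j ∈ S, (∑ k ∈ S, a k) * b j ^ 2 := by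
        refine add_le_add
          (mul_le_mul_of_nonneg_left (Finset.sum_le_sum fun k _ => ?_) (by positivity))
          (mul_le_mul_of_nonneg_left (Finset.sum_le_sum fun j _ => ?_) (by positivity))
        · exact mul_le_mul_of_nonneg_right (sum_shift_left_le h0 ha k) (sq_nonneg _)
        · exact mul_le_mul_of_nonneg_right (sum_shift_right_le h0 ha j) (sq_nonneg _)
    _ = _ := by simp_rw [← Finset.mul_sum]; ring

lemma abs_le_abs_sub_add (k j : ℤ) : |(k : ℝ)| ≤ |((k - j : ℤ) : ℝ)| + |(j : ℝ)| := by
  have := abs_add_le ((k - j : ℤ) : ℝ) (j : ℝ)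
  simpa using this

section Support

variable {S : Finset ℤ} {f g h : ℤ → ℂ}

lemma conv_eq_sum (hh : ∀ k ∉ S, h k = 0) (k : ℤ) :
    conv f h k = ∑ j ∈ S, f (k - j) * (j * h j) :=
  tsum_eq_sum fun j hj => by simp [hh j hj]

lemma norm_conv_le (hh : ∀ k ∉ S, h k = 0) (k : ℤ) :
    ‖conv f h k‖ ≤ ∑ j ∈ S, ‖f (k - j)‖ * (|(j : ℝ)| * ‖h j‖) := by
  rw [conv_eq_sum hh]
  refine (norm_sum_le _ _).trans (le_of_eq (Finset.sum_congr rfl fun j _ => ?_))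
  simp

/-- The derivative falls on either factor of `f ∂ₓh`. -/
lemma abs_mul_norm_conv_le (hh : ∀ k ∉ S, h k = 0) (k : ℤ) :
    |(k : ℝ)| * ‖conv f h k‖ ≤
      ∑ j ∈ S, (|((k - j : ℤ) : ℝ)| ^ 1 * ‖f (k - j)‖) * (|(j : ℝ)| ^ 1 * ‖h j‖)
        + ∑ j ∈ S, (|((k - j : ℤ) : ℝ)| ^ 0 * ‖f (k - j)‖) * (|(j : ℝ)| ^ 2 * ‖h j‖) := by
  refine (mul_le_mul_of_nonneg_left (norm_conv_le hh k) (abs_nonneg _)).trans ?_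
  rw [Finset.mul_sum, ← Finset.sum_add_distrib]
  refine Finset.sum_le_sum fun j _ => ?_
  have := mul_le_mul_of_nonneg_right (abs_le_abs_sub_add k j)
    (by positivity : 0 ≤ ‖f (k - j)‖ * (|(j : ℝ)| * ‖h j‖))
  linarith

lemma weight_support (hf : ∀ k ∉ S, f k = 0) (i : ℕ) :
    ∀ k ∉ S, |(k : ℝ)| ^ i * ‖f k‖ = 0 := fun k hk => by simp [hf k hk]

lemma wsum_one_mul_le (f h : ℤ → ℂ) : wsum S 1 f * wsum S 1 h ≤
    1 / 2 * (wsum S 0 f * wsum S 2 h + wsum S 2 f * wsum S 0 h) := by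
  simp only [wsum]
  rw [Finset.sum_mul_sum, Finset.sum_mul_sum, Finset.sum_mul_sum, ← Finset.sum_add_distrib,
    Finset.mul_sum]
  simp_rw [← Finset.sum_add_distrib, Finset.mul_sum]
  refine Finset.sum_le_sum fun i _ => Finset.sum_le_sum fun j _ => ?_
  have : 0 ≤ (|(i : ℝ)| - |(j : ℝ)|) ^ 2 * (‖f i‖ * ‖h j‖) := by positivity
  nlinarith

/-- The estimate of the nonlinearity `∂ₓ(f ∂ₓh)` in the Wiener algebra. -/
lemma sum_abs_mul_norm_conv_le (hf : ∀ k ∉ S, f k = 0) (hh : ∀ k ∉ S, h k = 0) :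
    ∑ k ∈ S, |(k : ℝ)| * ‖conv f h k‖ ≤
      3 / 2 * (wsum S 0 f * wsum S 2 h) + 1 / 2 * (wsum S 2 f * wsum S 0 h) := by
  have h1 := sum_sum_conv_le (S := S) (a := fun k => |(k : ℝ)| ^ 1 * ‖f k‖)
    (b := fun k => |(k : ℝ)| ^ 1 * ‖h k‖) (fun k => by positivity) (weight_support hf 1)
    (fun k => by positivity)
  have h2 := sum_sum_conv_le (S := S) (a := fun k => |(k : ℝ)| ^ 0 * ‖f k‖)
    (b := fun k => |(k : ℝ)| ^ 2 * ‖h k‖) (fun k => by positivity) (weight_support hf 0)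
    (fun k => by positivity)
  have h3 := Finset.sum_le_sum fun k (_ : k ∈ S) => abs_mul_norm_conv_le (f := f) hh k
  rw [Finset.sum_add_distrib] at h3
  have h4 := wsum_one_mul_le (S := S) f h
  simp only [wsum] at h4 ⊢
  linarith

/-- The estimate of the nonlinearity `∂ₓ(f ∂ₓh)` tested against `∂ₓ²f`. -/
lemma sum_pow_mul_norm_conv_le (hf : ∀ k ∉ S, f k = 0) (hh : ∀ k ∉ S, h k = 0) {r : ℝ}
    (hr : 0 < r) :
    ∑ k ∈ S, (|(k : ℝ)| ^ 2 * ‖f k‖) * (|(k : ℝ)| * ‖conv f h k‖) ≤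
      wsum S 0 f * (1 / 2 * qsum S 2 f + 1 / 2 * qsum S 2 h)
        + wsum S 1 f * (r / 2 * qsum S 2 f + 1 / (2 * r) * qsum S 1 h) := by
  have h1 := sum_sum_trilinear_le (S := S) (a := fun k => |(k : ℝ)| ^ 1 * ‖f k‖)
    (b := fun k => |(k : ℝ)| ^ 1 * ‖h k‖) (c := fun k => |(k : ℝ)| ^ 2 * ‖f k‖)
    (fun k => by positivity) (weight_support hf 1) hr
  have h2 := sum_sum_trilinear_le (S := S) (a := fun k => |(k : ℝ)| ^ 0 * ‖f k‖)
    (b := fun k => |(k : ℝ)| ^ 2 * ‖h k‖) (c := fun k => |(k : ℝ)| ^ 2 * ‖f k‖)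
    (fun k => by positivity) (weight_support hf 0) one_pos
  have h3 := Finset.sum_le_sum fun k (_ : k ∈ S) =>
    mul_le_mul_of_nonneg_left (abs_mul_norm_conv_le (f := f) hh k)
      (by positivity : 0 ≤ |(k : ℝ)| ^ 2 * ‖f k‖)
  simp only [mul_add, Finset.mul_sum, Finset.sum_add_distrib] at h3
  simp only [Finset.mul_sum] at h1 h2
  simp only [wsum, qsum, Finset.mul_sum, mul_add] at *
  norm_num at *
  linarith

lemma conv_combination (hg : ∀ k ∉ S, g k = 0) (hh : ∀ k ∉ S, h k = 0) (α β : ℝ) (k : ℤ) :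
    conv f (fun j => α * g j + β * h j) k = α * conv f g k + β * conv f h k := by
  rw [conv_eq_sum (S := S) (fun k hk => by simp [hg k hk, hh k hk]), conv_eq_sum hg,
    conv_eq_sum hh, Finset.mul_sum, Finset.mul_sum, ← Finset.sum_add_distrib]
  exact Finset.sum_congr rfl fun j _ => by ring

lemma norm_conv_combination_le (hg : ∀ k ∉ S, g k = 0) (hh : ∀ k ∉ S, h k = 0) {α β : ℝ}
    (hα : 0 ≤ α) (hβ : 0 ≤ β) (k : ℤ) :
    ‖conv f (fun j => α * g j + β * h j) k‖ ≤ α * ‖conv f g k‖ + β * ‖conv f h k‖ := by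
  rw [conv_combination hg hh]
  refine (norm_add_le _ _).trans (le_of_eq ?_)
  simp [abs_of_nonneg hα, abs_of_nonneg hβ]

end Support

/-! ### The Galerkin system -/

section Retraction

variable {E : Type*} [NormedAddCommGroup E]

/-- The factor for which `x ↦ retractScale R x • x` is the radial retraction onto the closed ball of
radius `R`.  (For `R = 0` the division by zero at `x = 0` is harmless: the retraction is `0`.) -/
def retractScale (R : ℝ) (x : E) : ℝ := R / max R ‖x‖

lemma retractScale_nonneg {R : ℝ} (hR : 0 ≤ R) (x : E) : 0 ≤ retractScale R x :=
  div_nonneg hR (hR.trans (le_max_left _ _))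

lemma retractScale_mul_norm_le {R : ℝ} (hR : 0 ≤ R) (x : E) : retractScale R x * ‖x‖ ≤ R := by
  have h : ‖x‖ / max R ‖x‖ ≤ 1 :=
    div_le_one_of_le₀ (le_max_right _ _) (hR.trans (le_max_left _ _))
  calc retractScale R x * ‖x‖ = R * (‖x‖ / max R ‖x‖) := by rw [retractScale]; ring
    _ ≤ R := mul_le_of_le_one_right hR h

lemma continuous_retractScale {R : ℝ} (hR : 0 ≤ R) :
    Continuous (retractScale R : E → ℝ) := by
  rcases hR.eq_or_lt with rfl | h
  · simpa [retractScale, Function.comp_def, funext_iff] using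
      (continuous_const : Continuous fun _ : E => (0 : ℝ)).congr fun x => by simp [retractScale]
  · unfold retractScale
    exact continuous_const.div (by fun_prop) fun x => (h.trans_le (le_max_left _ _)).ne'

variable [NormedSpace ℝ E]

lemma retractScale_smul_of_le {R : ℝ} {x : E} (hx : ‖x‖ ≤ R) :
    retractScale R x • x = x := by
  rcases ((norm_nonneg x).trans hx).eq_or_lt with h | h
  · have : x = 0 := norm_le_zero_iff.1 (by rwa [← h] at hx)
    simp [this]
  · rw [retractScale, max_eq_left hx, div_self h.ne', one_smul]

lemma retractScale_smul_mem {R : ℝ} (hR : 0 ≤ R) (x : E) :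
    retractScale R x • x ∈ Metric.closedBall (0 : E) R := by
  rw [mem_closedBall_zero_iff, norm_smul, Real.norm_of_nonneg (retractScale_nonneg hR x)]
  exact retractScale_mul_norm_le hR x

lemma lipschitzWith_retractScale_smul {R : ℝ} (hR : 0 ≤ R) :
    LipschitzWith 2 fun x : E => retractScale R x • x := by
  refine LipschitzWith.of_dist_le_mul fun x y => ?_
  rcases hR.eq_or_lt with rfl | h
  · simp [retractScale]
  set M := max R ‖x‖
  set M' := max R ‖y‖
  have hM : 0 < M := h.trans_le (le_max_left _ _)
  have hM' : 0 < M' := h.trans_le (le_max_left _ _)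
  have e : retractScale R x • x - retractScale R y • y
      = (R / M) • (x - y) + (R / M * ((M' - M) / M')) • y := by
    have : retractScale R y = R / M - R / M * ((M' - M) / M') := by
      rw [show retractScale R y = R / M' from rfl]; field_simp; ring
    rw [this, show retractScale R x = R / M from rfl]
    module
  have h1 : R / M ≤ 1 := div_le_one_of_le₀ (le_max_left _ _) hM.le
  have h1' : 0 ≤ R / M := by positivity
  have h2 : |M' - M| ≤ ‖x - y‖ := by
    have h3 := abs_max_sub_max_le_max R ‖y‖ R ‖x‖
    have h4 := abs_norm_sub_norm_le y x
    rw [norm_sub_rev] at h4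
    refine h3.trans (max_le ?_ h4)
    simp
  have h3 : ‖y‖ / M' ≤ 1 := div_le_one_of_le₀ (le_max_right _ _) hM'.le
  rw [dist_eq_norm, dist_eq_norm, e]
  refine (norm_add_le _ _).trans ?_
  rw [norm_smul, norm_smul, norm_mul, norm_div (M' - M), Real.norm_of_nonneg h1',
    Real.norm_of_nonneg hM'.le, Real.norm_eq_abs]
  have h5 : R / M * ‖x - y‖ ≤ ‖x - y‖ := mul_le_of_le_one_left (norm_nonneg _) h1
  have h6 : R / M * (|M' - M| / M') * ‖y‖ ≤ ‖x - y‖ := by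
    calc R / M * (|M' - M| / M') * ‖y‖ = (R / M) * (‖y‖ / M') * |M' - M| := by ring
      _ ≤ 1 * 1 * ‖x - y‖ := by gcongr
      _ = _ := by ring
  norm_num
  linarith

/-- A vector field truncated by the radial retraction has solutions on arbitrarily long time
intervals; they inherit every isometric symmetry of the vector field and of the initial value. -/
theorem exists_retracted_solution [CompleteSpace E] {V : E → E} {R : ℝ} (hR : 0 ≤ R) {K : ℝ≥0}
    (hV : LipschitzOnWith K V (Metric.closedBall 0 R)) (J : E ≃ₗᵢ[ℝ] E)
    (hJ : ∀ x, V (J x) = J (V x)) (x₀ : E) (hx₀ : J x₀ = x₀) {T : ℝ} (hT : 0 ≤ T) :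
    ∃ x : ℝ → E, x 0 = x₀ ∧
      (∀ t ∈ Icc 0 T, HasDerivWithinAt x (V (retractScale R (x t) • x t)) (Icc 0 T) t) ∧
      ∀ t ∈ Icc 0 T, J (x t) = x t := by
  set W : E → E := fun x => V (retractScale R x • x) with hW
  have hL : LipschitzWith (K * 2) W := by
    rw [← lipschitzOnWith_univ]
    exact hV.comp (lipschitzOnWith_univ.2 (lipschitzWith_retractScale_smul hR))
      fun x _ => retractScale_smul_mem hR x
  have hb : ∀ x, ‖W x‖ ≤ ‖V 0‖ + K * R := by
    intro x
    have h := hV.dist_le_mul _ (retractScale_smul_mem hR x) 0 (by simpa using hR)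
    rw [dist_eq_norm, dist_zero_right] at h
    have h1 : ‖retractScale R x • x‖ ≤ R := by simpa using retractScale_smul_mem hR x
    have h2 := norm_le_insert' (V (retractScale R x • x)) (V 0)
    have h3 : (K : ℝ) * ‖retractScale R x • x‖ ≤ K * R := by gcongr
    linarith
  set B : ℝ≥0 := ⟨‖V 0‖ + K * R, by positivity⟩
  have hPL : IsPicardLindelof (fun _ => W) (⟨0, left_mem_Icc.2 hT⟩ : Icc (0 : ℝ) T) x₀
      (B * ⟨T, hT⟩) 0 B (K * 2) :=
    .of_time_independent (fun x _ => hb x) hL.lipschitzOnWith (by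
      simp only [sub_zero, NNReal.coe_zero, sub_self]
      rw [max_eq_left hT]
      exact le_rfl)
  obtain ⟨x, hx0, hx⟩ := hPL.exists_eq_forall_mem_Icc_hasDerivWithinAt₀
  refine ⟨x, hx0, hx, ?_⟩
  have hc : ContinuousOn x (Icc 0 T) := fun t ht => (hx t ht).continuousWithinAt
  have hJW : ∀ x, W (J x) = J (W x) := fun x => by
    simp only [hW, retractScale, J.norm_map, ← hJ, map_smul]
  have hici : ∀ {y : ℝ → E} {y' : E} {t : ℝ}, t ∈ Ico 0 T → HasDerivWithinAt y y' (Icc 0 T) t →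
      HasDerivWithinAt y y' (Ici t) t := fun {y y' t} ht h =>
    (h.mono (Icc_subset_Icc_left ht.1)).mono_of_mem_nhdsWithin (Icc_mem_nhdsGE ht.2)
  have := ODE_solution_unique_of_mem_Icc_right (v := fun _ => W) (s := fun _ => univ)
    (f := fun t => J (x t)) (g := x) (a := 0) (b := T) (K := K * 2)
    (fun _ _ => hL.lipschitzOnWith) (J.continuous.comp_continuousOn hc)
    (fun t ht => hici ht (by
      have := J.toContinuousLinearEquiv.hasFDerivAt.comp_hasDerivWithinAt t
        (hx t (Ico_subset_Icc_self ht))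
      simp only [hJW]
      exact this))
    (fun _ _ => mem_univ _) hc (fun t ht => hici ht (hx t (Ico_subset_Icc_self ht)))
    (fun _ _ => mem_univ _) (by simp [hx0, hx₀])
  exact fun t ht => this ht

end Retraction

lemma conv_conj_neg (f h : ℤ → ℂ) (k : ℤ) :
    conv (fun j => conj (f (-j))) (fun j => conj (h (-j))) k = -conj (conv f h (-k)) := by
  unfold conv
  rw [← (Equiv.neg ℤ).tsum_eq, Complex.conj_tsum, ← tsum_neg]
  refine tsum_congr fun j => ?_
  simp [show -(k + j) = -k - j by ring]

/-- The system preserves the reality condition `f_{-k} = conj f_k`. -/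
lemma rhs_conj_neg (m α β : ℝ) (f g : ℤ → ℂ) (k : ℤ) :
    rhs m α β (fun j => conj (f (-j))) (fun j => conj (g (-j))) k = conj (rhs m α β f g (-k)) := by
  unfold rhs
  rw [show (fun j => (α : ℂ) * conj (f (-j)) + β * conj (g (-j)))
      = fun j => conj ((fun i => (α : ℂ) * f i + β * g i) (-j)) by ext; simp]
  rw [conv_conj_neg f (fun i => (α : ℂ) * f i + β * g i)]
  simp

section Galerkin

variable (S : Finset ℤ)

/-- The space of pairs of families indexed by `S`, with the `ℓ¹` norm. -/
abbrev GalerkinSpace : Type := PiLp 1 fun _ : S ⊕ S => ℂ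

variable {S}

/-- The first component of an element of the Galerkin space, extended by zero. -/
def GalerkinSpace.fst (x : GalerkinSpace S) (k : ℤ) : ℂ :=
  if h : k ∈ S then x (Sum.inl ⟨k, h⟩) else 0

/-- The second component of an element of the Galerkin space, extended by zero. -/
def GalerkinSpace.snd (x : GalerkinSpace S) (k : ℤ) : ℂ :=
  if h : k ∈ S then x (Sum.inr ⟨k, h⟩) else 0

variable (S) in
/-- The pair of families, restricted to `S`, as an element of the Galerkin space. -/
def GalerkinSpace.mk (f g : ℤ → ℂ) : GalerkinSpace S :=
  WithLp.toLp 1 (Sum.elim (fun k => f k) (fun k => g k))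

namespace GalerkinSpace

lemma fst_of_notMem (x : GalerkinSpace S) {k : ℤ} (hk : k ∉ S) : x.fst k = 0 := dif_neg hk

lemma snd_of_notMem (x : GalerkinSpace S) {k : ℤ} (hk : k ∉ S) : x.snd k = 0 := dif_neg hk

lemma fst_of_mem (x : GalerkinSpace S) {k : ℤ} (hk : k ∈ S) : x.fst k = x (Sum.inl ⟨k, hk⟩) :=
  dif_pos hk

lemma snd_of_mem (x : GalerkinSpace S) {k : ℤ} (hk : k ∈ S) : x.snd k = x (Sum.inr ⟨k, hk⟩) :=
  dif_pos hk

lemma fst_mk (f g : ℤ → ℂ) {k : ℤ} (hk : k ∈ S) : (mk S f g).fst k = f k := fst_of_mem _ hk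

lemma snd_mk (f g : ℤ → ℂ) {k : ℤ} (hk : k ∈ S) : (mk S f g).snd k = g k := snd_of_mem _ hk

lemma fst_smul (c : ℝ) (x : GalerkinSpace S) : (c • x).fst = c • x.fst := by
  ext k
  by_cases hk : k ∈ S <;> simp [fst, hk]

lemma snd_smul (c : ℝ) (x : GalerkinSpace S) : (c • x).snd = c • x.snd := by
  ext k
  by_cases hk : k ∈ S <;> simp [snd, hk]

lemma norm_eq (x : GalerkinSpace S) : ‖x‖ = wsum S 0 x.fst + wsum S 0 x.snd := by
  rw [PiLp.norm_eq_of_L1, Fintype.sum_sum_type, wsum, wsum, ← Finset.sum_coe_sort S,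
    ← Finset.sum_coe_sort S]
  simp [fst, snd]

lemma contDiff_fst (k : ℤ) : ContDiff ℝ 1 fun x : GalerkinSpace S => x.fst k := by
  by_cases hk : k ∈ S
  · simp only [fst, hk, dite_true]; fun_prop
  · simp only [fst, hk, dite_false]; fun_prop

lemma contDiff_snd (k : ℤ) : ContDiff ℝ 1 fun x : GalerkinSpace S => x.snd k := by
  by_cases hk : k ∈ S
  · simp only [snd, hk, dite_true]; fun_prop
  · simp only [snd, hk, dite_false]; fun_prop

/-- The involution `f_k ↦ conj f_{-k}` of the Galerkin space. -/
def reflect (hS : ∀ k, k ∈ S ↔ -k ∈ S) : GalerkinSpace S ≃ₗᵢ[ℝ] GalerkinSpace S :=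
  (LinearIsometryEquiv.piLpCongrLeft 1 ℝ ℂ
    (Equiv.sumCongr ((Equiv.neg ℤ).subtypeEquiv hS) ((Equiv.neg ℤ).subtypeEquiv hS))).trans
    (LinearIsometryEquiv.piLpCongrRight 1 fun _ => Complex.conjLIE)

lemma fst_reflect (hS : ∀ k, k ∈ S ↔ -k ∈ S) (x : GalerkinSpace S) :
    (reflect hS x).fst = fun k => conj (x.fst (-k)) := by
  ext k
  by_cases hk : k ∈ S
  · rw [fst_of_mem _ hk, fst_of_mem _ ((hS k).1 hk)]
    rfl
  · rw [fst_of_notMem _ hk, fst_of_notMem _ (fun h => hk ((hS k).2 h)), map_zero]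

lemma snd_reflect (hS : ∀ k, k ∈ S ↔ -k ∈ S) (x : GalerkinSpace S) :
    (reflect hS x).snd = fun k => conj (x.snd (-k)) := by
  ext k
  by_cases hk : k ∈ S
  · rw [snd_of_mem _ hk, snd_of_mem _ ((hS k).1 hk)]
    rfl
  · rw [snd_of_notMem _ hk, snd_of_notMem _ (fun h => hk ((hS k).2 h)), map_zero]

lemma ext_fst_snd {x y : GalerkinSpace S} (h1 : ∀ k ∈ S, x.fst k = y.fst k)
    (h2 : ∀ k ∈ S, x.snd k = y.snd k) : x = y := by
  ext i
  rcases i with ⟨k, hk⟩ | ⟨k, hk⟩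
  · simpa [fst_of_mem _ hk] using h1 k hk
  · simpa [snd_of_mem _ hk] using h2 k hk

end GalerkinSpace

/-- The vector field of the Galerkin system, which is the system truncated to the frequencies in
`S`. -/
def galerkinField (S : Finset ℤ) (m n α β α' β' : ℝ) (x : GalerkinSpace S) : GalerkinSpace S :=
  GalerkinSpace.mk S (rhs m α β x.fst x.snd) (rhs n α' β' x.snd x.fst)

lemma contDiff_rhs {m α β : ℝ} {F G : GalerkinSpace S → ℤ → ℂ}
    (hF : ∀ k, ContDiff ℝ 1 fun x => F x k) (hG : ∀ k, ContDiff ℝ 1 fun x => G x k)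
    (hF0 : ∀ x, ∀ k ∉ S, F x k = 0) (hG0 : ∀ x, ∀ k ∉ S, G x k = 0) (k : ℤ) :
    ContDiff ℝ 1 fun x => rhs m α β (F x) (G x) k := by
  have : ∀ x, conv (F x) (fun j => α * F x j + β * G x j) k
      = ∑ j ∈ S, F x (k - j) * (j * (α * F x j + β * G x j)) := fun x =>
    conv_eq_sum (fun j hj => by simp [hF0 x j hj, hG0 x j hj]) k
  simp only [rhs, this]
  fun_prop

lemma contDiff_galerkinField (m n α β α' β' : ℝ) :
    ContDiff ℝ 1 (galerkinField S m n α β α' β') := by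
  refine contDiff_piLp' 1 fun i => ?_
  rcases i with ⟨k, hk⟩ | ⟨k, hk⟩
  · exact contDiff_rhs GalerkinSpace.contDiff_fst GalerkinSpace.contDiff_snd
      (fun x _ => x.fst_of_notMem) (fun x _ => x.snd_of_notMem) k
  · exact contDiff_rhs GalerkinSpace.contDiff_snd GalerkinSpace.contDiff_fst
      (fun x _ => x.snd_of_notMem) (fun x _ => x.fst_of_notMem) k

/-- Solutions of the Galerkin system, in which the unknowns are multiplied by a factor
`θ ∈ [0, 1]` that keeps their `ℓ¹` norm below `R`, exist on every time interval. -/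
theorem exists_galerkin_retracted (hS : ∀ k, k ∈ S ↔ -k ∈ S) (m n α β α' β' : ℝ)
    {a c : ℤ → ℂ} (ha : ∀ k, a (-k) = conj (a k)) (hc : ∀ k, c (-k) = conj (c k))
    {R T : ℝ} (hR : 0 ≤ R) (hT : 0 ≤ T) :
    ∃ (f g : ℝ → ℤ → ℂ) (θ : ℝ → ℝ),
      (∀ t, ∀ k ∉ S, f t k = 0) ∧ (∀ t, ∀ k ∉ S, g t k = 0) ∧
      (∀ k ∈ S, f 0 k = a k) ∧ (∀ k ∈ S, g 0 k = c k) ∧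
      (∀ t ∈ Icc 0 T, ∀ k, f t (-k) = conj (f t k)) ∧
      (∀ t ∈ Icc 0 T, ∀ k, g t (-k) = conj (g t k)) ∧
      ContinuousOn θ (Icc 0 T) ∧ (∀ t, 0 ≤ θ t) ∧
      (∀ t, θ t * (wsum S 0 (f t) + wsum S 0 (g t)) ≤ R) ∧
      (∀ t, wsum S 0 (f t) + wsum S 0 (g t) ≤ R → θ t • f t = f t ∧ θ t • g t = g t) ∧
      (∀ t ∈ Icc 0 T, ∀ k ∈ S, HasDerivWithinAt (fun s => f s k)
        (rhs m α β (θ t • f t) (θ t • g t) k) (Icc 0 T) t) ∧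
      (∀ t ∈ Icc 0 T, ∀ k ∈ S, HasDerivWithinAt (fun s => g s k)
        (rhs n α' β' (θ t • g t) (θ t • f t) k) (Icc 0 T) t) := by
  -- the field is quadratic, hence Lipschitz only on balls, which is why the retraction is needed
  obtain ⟨K, hK⟩ := ((contDiff_galerkinField (S := S) m n α β α' β').locallyLipschitz
    (𝕂 := ℝ)).locallyLipschitzOn.exists_lipschitzOnWith_of_compact
      (isCompact_closedBall (0 : GalerkinSpace S) R)
  have hsymm : ∀ k ∈ S, -k ∈ S := fun k hk => (hS k).1 hk
  obtain ⟨x, hx0, hx, hJx⟩ := exists_retracted_solution hR hK (GalerkinSpace.reflect hS)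
    (fun x => GalerkinSpace.ext_fst_snd
      (fun k hk => by
        simp only [galerkinField, GalerkinSpace.fst_reflect, GalerkinSpace.snd_reflect,
          GalerkinSpace.fst_mk _ _ hk, rhs_conj_neg, GalerkinSpace.fst_mk _ _ (hsymm k hk)])
      (fun k hk => by
        simp only [galerkinField, GalerkinSpace.fst_reflect, GalerkinSpace.snd_reflect,
          GalerkinSpace.snd_mk _ _ hk, rhs_conj_neg, GalerkinSpace.snd_mk _ _ (hsymm k hk)]))
    (GalerkinSpace.mk S a c)
    (GalerkinSpace.ext_fst_snd
      (fun k hk => by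
        simp only [GalerkinSpace.fst_reflect, GalerkinSpace.fst_mk _ _ hk,
          GalerkinSpace.fst_mk _ _ (hsymm k hk), ha, Complex.conj_conj])
      (fun k hk => by
        simp only [GalerkinSpace.snd_reflect, GalerkinSpace.snd_mk _ _ hk,
          GalerkinSpace.snd_mk _ _ (hsymm k hk), hc, Complex.conj_conj])) hT
  refine ⟨fun t => (x t).fst, fun t => (x t).snd, fun t => retractScale R (x t),
    fun t k hk => (x t).fst_of_notMem hk, fun t k hk => (x t).snd_of_notMem hk,
    fun k hk => ?_, fun k hk => ?_, fun t ht k => ?_, fun t ht k => ?_, ?_,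
    fun t => retractScale_nonneg hR _, fun t => ?_, fun t h => ?_, fun t ht k hk => ?_,
    fun t ht k hk => ?_⟩
  · simp only [hx0, GalerkinSpace.fst_mk _ _ hk]
  · simp only [hx0, GalerkinSpace.snd_mk _ _ hk]
  · have h := congrFun (GalerkinSpace.fst_reflect hS (x t)) (-k)
    rwa [hJx t ht, neg_neg] at h
  · have h := congrFun (GalerkinSpace.snd_reflect hS (x t)) (-k)
    rwa [hJx t ht, neg_neg] at h
  · exact (continuous_retractScale hR).comp_continuousOn
      fun t ht => (hx t ht).continuousWithinAt
  · rw [← GalerkinSpace.norm_eq]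
    exact retractScale_mul_norm_le hR _
  · rw [← GalerkinSpace.norm_eq] at h
    rw [← GalerkinSpace.fst_smul, ← GalerkinSpace.snd_smul, retractScale_smul_of_le h]
    exact ⟨rfl, rfl⟩
  · have h := ((PiLp.proj 1 (𝕜 := ℝ) (fun _ : S ⊕ S => ℂ)
      (Sum.inl ⟨k, hk⟩)).hasFDerivAt).comp_hasDerivWithinAt t (hx t ht)
    rw [← GalerkinSpace.fst_smul, ← GalerkinSpace.snd_smul]
    simpa [GalerkinSpace.fst, hk, Function.comp_def, galerkinField, GalerkinSpace.mk] using h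
  · have h := ((PiLp.proj 1 (𝕜 := ℝ) (fun _ : S ⊕ S => ℂ)
      (Sum.inr ⟨k, hk⟩)).hasFDerivAt).comp_hasDerivWithinAt t (hx t ht)
    rw [← GalerkinSpace.fst_smul, ← GalerkinSpace.snd_smul]
    simpa [GalerkinSpace.snd, hk, Function.comp_def, galerkinField, GalerkinSpace.mk] using h

end Galerkin

/-! ### A priori estimates for the Galerkin system -/

/-- If `z' = -a z + r`, then `|z|' ≤ |r| - a |z|`, in integrated form. -/
lemma norm_le_add_integral {z r : ℝ → ℂ} {a : ℝ → ℝ} {T : ℝ}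
    (hz : ∀ t ∈ Icc 0 T, HasDerivWithinAt z (-(a t : ℂ) * z t + r t) (Icc 0 T) t)
    (ha : ContinuousOn a (Icc 0 T)) (hr : ContinuousOn r (Icc 0 T)) {t : ℝ} (ht : t ∈ Icc 0 T) :
    ‖z t‖ ≤ ‖z 0‖ + ∫ s in (0)..t, (‖r s‖ - a s * ‖z s‖) := by
  have hsub : Icc 0 t ⊆ Icc 0 T := Icc_subset_Icc_right ht.2
  have hzc : ContinuousOn z (Icc 0 t) := fun s hs => ((hz s (hsub hs)).continuousWithinAt).mono hsub
  replace ha := ha.mono hsub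
  replace hr := hr.mono hsub
  have hi1 : IntervalIntegrable (fun s => ‖r s‖ - a s * ‖z s‖) volume 0 t :=
    ContinuousOn.intervalIntegrable_of_Icc ht.1 (by fun_prop)
  have hi2 : IntervalIntegrable (fun s => |a s|) volume 0 t :=
    ContinuousOn.intervalIntegrable_of_Icc ht.1 (by fun_prop)
  -- `|z|` is replaced by the differentiable function `√(|z|² + ε²)`
  have key : ∀ ε > 0, ‖z t‖ ≤ ‖z 0‖ + (∫ s in (0)..t, (‖r s‖ - a s * ‖z s‖))
      + ε * (1 + ∫ s in (0)..t, |a s|) := by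
    intro ε hε
    set φ : ℝ → ℝ := fun s => √(‖z s‖ ^ 2 + ε ^ 2) with hφ
    have hpos : ∀ s, 0 < ‖z s‖ ^ 2 + ε ^ 2 := fun s => by positivity
    have hφ1 : ∀ s, ‖z s‖ ≤ φ s := fun s => Real.le_sqrt_of_sq_le (by nlinarith)
    have hφ2 : ∀ s, φ s ≤ ‖z s‖ + ε := fun s => by
      rw [hφ]
      refine Real.sqrt_le_iff.2 ⟨by positivity, by nlinarith [norm_nonneg (z s)]⟩
    have hd : ∀ s ∈ Ioo 0 t, HasDerivWithinAt φ
        (2 * inner ℝ (z s) (-(a s : ℂ) * z s + r s) / (2 * φ s)) (Ioi s) s := by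
      intro s hs
      have h1 := (hz s ⟨hs.1.le, hs.2.le.trans ht.2⟩).hasDerivAt
        (Icc_mem_nhds hs.1 (hs.2.trans_le ht.2))
      exact ((h1.norm_sq.add_const (ε ^ 2)).sqrt (hpos s).ne').hasDerivWithinAt
    have h := intervalIntegral.sub_le_integral_of_hasDeriv_right_of_le ht.1
      (g := φ) (φ := fun s => (‖r s‖ - a s * ‖z s‖) + ε * |a s|) (by fun_prop) hd
      (ContinuousOn.integrableOn_Icc (by fun_prop)) (fun s hs => by
        have h3 : inner ℝ (z s) (-(a s : ℂ) * z s + r s) ≤ -a s * ‖z s‖ ^ 2 + ‖z s‖ * ‖r s‖ := by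
          have e : -(a s : ℂ) * z s = (-a s) • z s := by simp
          rw [inner_add_right, e, real_inner_smul_right, real_inner_self_eq_norm_sq]
          linarith [real_inner_le_norm (z s) (r s)]
        have hp : 0 < φ s := Real.sqrt_pos.2 (hpos s)
        rw [mul_div_mul_left _ _ two_ne_zero, div_le_iff₀ hp]
        refine h3.trans ?_
        have h4 : a s * ‖z s‖ * (φ s - ‖z s‖) ≤ |a s| * φ s * ε := by
          have := hφ1 s
          have := hφ2 s
          calc a s * ‖z s‖ * (φ s - ‖z s‖) ≤ |a s| * ‖z s‖ * (φ s - ‖z s‖) :=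
                mul_le_mul_of_nonneg_right (mul_le_mul_of_nonneg_right (le_abs_self _)
                  (norm_nonneg _)) (by linarith)
            _ ≤ |a s| * φ s * ε := mul_le_mul (mul_le_mul_of_nonneg_left (hφ1 s) (abs_nonneg _))
                  (by linarith) (by linarith) (by positivity)
        nlinarith [mul_nonneg (norm_nonneg (r s)) (sub_nonneg.2 (hφ1 s))])
    rw [intervalIntegral.integral_add hi1 (hi2.const_mul _),
      intervalIntegral.integral_const_mul] at h
    linarith [hφ1 t, hφ2 0]
  have hA : 0 ≤ ∫ s in (0)..t, |a s| :=
    intervalIntegral.integral_nonneg ht.1 fun s _ => abs_nonneg _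
  refine le_of_forall_pos_le_add fun ε hε => ?_
  have := key (ε / (1 + ∫ s in (0)..t, |a s|)) (by positivity)
  rwa [div_mul_cancel₀ _ (by positivity)] at this

/-- A Gronwall inequality, for `Y' ≤ -2κ Z + p Y` with `Y ≤ Z`: one half of the dissipation gives
the exponential decay of `Y`, the other one the integrability of `Z`. -/
lemma gronwall_dissipation {Y Y' Z p : ℝ → ℝ} {T κ P : ℝ} (hκ : 0 ≤ κ)
    (hY : ∀ t ∈ Icc 0 T, HasDerivWithinAt Y (Y' t) (Icc 0 T) t)
    (hY' : ∀ t ∈ Icc 0 T, Y' t ≤ -2 * κ * Z t + p t * Y t)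
    (hZ : ContinuousOn Z (Icc 0 T)) (hp : ContinuousOn p (Icc 0 T))
    (hY0 : ∀ t ∈ Icc 0 T, 0 ≤ Y t)
    (hYZ : ∀ t ∈ Icc 0 T, Y t ≤ Z t) (hP : ∀ t ∈ Icc 0 T, ∫ s in (0)..t, p s ≤ P)
    {t : ℝ} (ht : t ∈ Icc 0 T) :
    Real.exp (κ * t) * Y t + κ * ∫ s in (0)..t, Z s ≤ Real.exp P * Y 0 := by
  have hsub : Icc 0 t ⊆ Icc 0 T := Icc_subset_Icc_right ht.2
  have hYc : ContinuousOn Y (Icc 0 t) := fun s hs => ((hY s (hsub hs)).continuousWithinAt).mono hsub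
  have hpi : IntervalIntegrable p volume 0 t :=
    ContinuousOn.intervalIntegrable_of_Icc ht.1 (hp.mono hsub)
  have hQc : ContinuousOn (fun s => ∫ r in (0)..s, p r) (Icc 0 t) := by
    have := intervalIntegral.continuousOn_primitive_interval' hpi (left_mem_uIcc)
    rwa [uIcc_of_le ht.1] at this
  have hZ' := hZ.mono hsub
  have hd : ∀ s ∈ Ioo 0 t, HasDerivWithinAt
      (fun s => Real.exp (κ * s - ∫ r in (0)..s, p r) * Y s)
      (Real.exp (κ * s - ∫ r in (0)..s, p r) * (κ * 1 - p s) * Y s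
        + Real.exp (κ * s - ∫ r in (0)..s, p r) * Y' s) (Ioi s) s := by
    intro s hs
    have hs' : s ∈ Ioo 0 T := ⟨hs.1, hs.2.trans_le ht.2⟩
    have h1 := (hY s (Ioo_subset_Icc_self hs')).hasDerivAt (Icc_mem_nhds hs'.1 hs'.2)
    have h2 : HasDerivAt (fun s => ∫ r in (0)..s, p r) (p s) s :=
      intervalIntegral.integral_hasDerivAt_right
        (hpi.mono_set (by rw [uIcc_of_le ht.1, uIcc_of_le hs.1.le]
                          exact Icc_subset_Icc_right hs.2.le))
        ((hp.mono Ioo_subset_Icc_self).stronglyMeasurableAtFilter isOpen_Ioo s hs')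
        (hp.continuousAt (Icc_mem_nhds hs'.1 hs'.2))
    exact ((((hasDerivAt_id s).const_mul κ).sub h2).exp.mul h1).hasDerivWithinAt
  have hPs : ∀ s ∈ Icc 0 t, Real.exp (κ * s) * Real.exp (-P)
      ≤ Real.exp (κ * s - ∫ r in (0)..s, p r) := fun s hs => by
    rw [← Real.exp_add]
    exact Real.exp_le_exp.2 (by linarith [hP s (hsub hs)])
  have h := intervalIntegral.sub_le_integral_of_hasDeriv_right_of_le ht.1
    (φ := fun s => -(κ * Real.exp (-P)) * Z s) (by fun_prop) hd
    (ContinuousOn.integrableOn_Icc (by fun_prop)) (fun s hs => by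
      have hs1 : s ∈ Icc 0 t := Ioo_subset_Icc_self hs
      have hs' := hsub hs1
      have hZ0 : 0 ≤ Z s := (hY0 s hs').trans (hYZ s hs')
      have h1 : Real.exp (-P) ≤ Real.exp (κ * s - ∫ r in (0)..s, p r) := by
        refine le_trans ?_ (hPs s hs1)
        exact le_mul_of_one_le_left (Real.exp_pos _).le
          (Real.one_le_exp (mul_nonneg hκ hs.1.le))
      have h2 : κ * Y s + (Y' s - p s * Y s) ≤ -(κ * Z s) := by
        nlinarith [hY' s hs', mul_le_mul_of_nonneg_left (hYZ s hs') hκ]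
      have h3 := mul_le_mul_of_nonneg_left h2
        (Real.exp_pos (κ * s - ∫ r in (0)..s, p r)).le
      have h4 := mul_le_mul_of_nonneg_right h1 (mul_nonneg hκ hZ0)
      nlinarith)
  rw [intervalIntegral.integral_const_mul] at h
  simp only [intervalIntegral.integral_same, mul_zero, sub_self, Real.exp_zero, one_mul] at h
  have h1 := mul_le_mul_of_nonneg_right (hPs t (right_mem_Icc.2 ht.1)) (hY0 t ht)
  have h2 : Real.exp (-P) * (Real.exp (κ * t) * Y t + κ * ∫ s in (0)..t, Z s) ≤ Y 0 := by linarith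
  have h3 := mul_le_mul_of_nonneg_left h2 (Real.exp_pos P).le
  rwa [← mul_assoc, ← Real.exp_add, add_neg_cancel, Real.exp_zero, one_mul] at h3

/-- The parameters of the system
`∂ₜ f = ∂ₓ[(f + m) ∂ₓ(α f + β g)]`, `∂ₜ g = ∂ₓ[(g + n) ∂ₓ(α' g + β' f)]`. -/
structure Coeffs where
  (m n α β α' β' : ℝ)

/-- The smallness conditions on data of size `E` in the Wiener algebra.  For each unknown, the
diagonal part `m α`, `n α'` of the diffusion dominates the linear coupling and the nonlinearity, with
the margin `σ` in the Wiener algebra and with the margin `2κ` in `Ḣ¹` (one `κ` of which is spent on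
the lower order terms). -/
structure Coeffs.Good (p : Coeffs) (E σ κ : ℝ) : Prop where
  m_nonneg : 0 ≤ p.m
  n_nonneg : 0 ≤ p.n
  α_nonneg : 0 ≤ p.α
  β_nonneg : 0 ≤ p.β
  α'_nonneg : 0 ≤ p.α'
  β'_nonneg : 0 ≤ p.β'
  E_nonneg : 0 ≤ E
  σ_pos : 0 < σ
  κ_pos : 0 < κ
  wiener_f : p.n * p.β' + E * (2 * p.α + 1 / 2 * p.β + 3 / 2 * p.β') + σ ≤ p.m * p.α
  wiener_g : p.m * p.β + E * (2 * p.α' + 1 / 2 * p.β' + 3 / 2 * p.β) + σ ≤ p.n * p.α'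
  sobolev_f : 1 / 2 * (p.m * p.β + p.n * p.β') + E * (p.α + 1 / 2 * p.β + 1 / 2 * p.β')
    + 2 * κ ≤ p.m * p.α
  sobolev_g : 1 / 2 * (p.m * p.β + p.n * p.β') + E * (p.α' + 1 / 2 * p.β + 1 / 2 * p.β')
    + 2 * κ ≤ p.n * p.α'

/-- The part of `rhs` other than the diagonal linear term. -/
def remainder (m α β : ℝ) (f g : ℤ → ℂ) (k : ℤ) : ℂ :=
  -((m * β * k ^ 2 : ℝ) * g k) - k * conv f (fun j => α * f j + β * g j) k

lemma rhs_eq (m α β : ℝ) (f g : ℤ → ℂ) (k : ℤ) :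
    rhs m α β f g k = -((m * α * k ^ 2 : ℝ) : ℂ) * f k + remainder m α β f g k := by
  simp only [rhs, remainder]
  push_cast
  ring

section Pointwise

variable {S : Finset ℤ} {f g : ℤ → ℂ} {m α β E : ℝ}

lemma norm_remainder_le (hf : ∀ k ∉ S, f k = 0) (hg : ∀ k ∉ S, g k = 0) (hm : 0 ≤ m)
    (hα : 0 ≤ α) (hβ : 0 ≤ β) (k : ℤ) :
    ‖remainder m α β f g k‖ ≤ m * β * (|(k : ℝ)| ^ 2 * ‖g k‖)
      + (α * (|(k : ℝ)| * ‖conv f f k‖) + β * (|(k : ℝ)| * ‖conv f g k‖)) := by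
  refine (norm_sub_le _ _).trans (add_le_add (le_of_eq ?_) ?_)
  · rw [norm_neg, norm_mul, Complex.norm_real, Real.norm_of_nonneg (by positivity), sq_abs]
    ring
  · rw [norm_mul, Complex.norm_intCast]
    have := mul_le_mul_of_nonneg_left (norm_conv_combination_le (f := f) hf hg hα hβ k)
      (abs_nonneg (k : ℝ))
    linarith

lemma sum_norm_remainder_le (hf : ∀ k ∉ S, f k = 0) (hg : ∀ k ∉ S, g k = 0) (hm : 0 ≤ m)
    (hα : 0 ≤ α) (hβ : 0 ≤ β) :
    ∑ k ∈ S, ‖remainder m α β f g k‖ ≤ m * β * wsum S 2 g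
      + α * (2 * (wsum S 0 f * wsum S 2 f))
      + β * (3 / 2 * (wsum S 0 f * wsum S 2 g) + 1 / 2 * (wsum S 2 f * wsum S 0 g)) := by
  have h := Finset.sum_le_sum fun k (_ : k ∈ S) => norm_remainder_le hf hg hm hα hβ k
  simp only [Finset.sum_add_distrib, ← Finset.mul_sum] at h
  have h1 := mul_le_mul_of_nonneg_left (sum_abs_mul_norm_conv_le hf hf) hα
  have h2 := mul_le_mul_of_nonneg_left (sum_abs_mul_norm_conv_le hf hg) hβ
  simp only [wsum] at *
  linarith

lemma wsum_one_sq_le (hf0 : f 0 = 0) (hE : wsum S 0 f + wsum S 0 g ≤ E) :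
    wsum S 1 f * (wsum S 1 f + wsum S 1 g + 1) ≤ (E + 1) * (wsum S 2 f + wsum S 2 g) := by
  have h1 := wsum_one_mul_le (S := S) f f
  have h2 := wsum_one_mul_le (S := S) f g
  have h3 := wsum_mono_exp (S := S) one_le_two hf0
  have := wsum_nonneg S 0 f
  have := wsum_nonneg S 0 g
  have a := wsum_nonneg S 2 f
  have b := wsum_nonneg S 2 g
  nlinarith [mul_le_mul_of_nonneg_right hE a, mul_le_mul_of_nonneg_right hE b]

/-- The remainder of `∂ₜf` tested against `∂ₓ²f`.  Apart from the terms `m β` and `E` times the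
dissipation there is `∑ |k| |f_k| · ‖∂ₓh‖ ‖∂ₓ²f‖`; with the parameter `ε` it is split into a small
part of the dissipation and a multiple of the `Ḣ¹` norm whose coefficient `wsum S 2 f + wsum S 2 g`
is integrable in time by the estimate in the Wiener algebra. -/
lemma sum_test_remainder_le (hf : ∀ k ∉ S, f k = 0) (hg : ∀ k ∉ S, g k = 0) (hf0 : f 0 = 0)
    (hm : 0 ≤ m) (hα : 0 ≤ α) (hβ : 0 ≤ β) (hE : wsum S 0 f + wsum S 0 g ≤ E) {ε : ℝ}
    (hε : 0 < ε) :
    ∑ k ∈ S, |(k : ℝ)| ^ 2 * ‖f k‖ * ‖remainder m α β f g k‖ ≤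
      (m * β + E * β) / 2 * (qsum S 2 f + qsum S 2 g) + (E * α + (α + β) * (ε / 2)) * qsum S 2 f
      + (α + β) * ((E + 1) / (2 * ε) * (wsum S 2 f + wsum S 2 g))
        * (qsum S 1 f + qsum S 1 g) := by
  have h := Finset.sum_le_sum fun k (_ : k ∈ S) =>
    mul_le_mul_of_nonneg_left (norm_remainder_le hf hg hm hα hβ k)
      (by positivity : 0 ≤ |(k : ℝ)| ^ 2 * ‖f k‖)
  refine h.trans ?_
  have hF0 := wsum_nonneg S 0 f
  have hG0 := wsum_nonneg S 0 g
  have hF1 := wsum_nonneg S 1 f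
  have hG1 := wsum_nonneg S 1 g
  have hX := qsum_nonneg S 2 f
  have hW := qsum_nonneg S 2 g
  have hYf := qsum_nonneg S 1 f
  have hYg := qsum_nonneg S 1 g
  set A := wsum S 1 f + wsum S 1 g + 1
  have hA : 0 < A := by positivity
  -- the weight for which `wsum S 1 f * r ≤ ε`, while `wsum S 1 f / r` is bounded by interpolation
  set r := ε / A with hr
  have hr0 : 0 < r := by positivity
  have h1 : wsum S 1 f * r ≤ ε := by
    rw [hr, mul_div_assoc', div_le_iff₀ hA]
    nlinarith
  have h2 : wsum S 1 f * (1 / (2 * r)) ≤ (E + 1) / (2 * ε) * (wsum S 2 f + wsum S 2 g) := by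
    have e : wsum S 1 f * (1 / (2 * r)) = wsum S 1 f * A / (2 * ε) := by rw [hr]; field_simp
    rw [e, div_mul_eq_mul_div]
    exact div_le_div_of_nonneg_right (wsum_one_sq_le hf0 hE) (by positivity)
  set M := (E + 1) / (2 * ε) * (wsum S 2 f + wsum S 2 g)
  have hM : 0 ≤ M := le_trans (by positivity) h2
  have bound : ∀ h : ℤ → ℂ, (∀ k ∉ S, h k = 0) →
      ∑ k ∈ S, (|(k : ℝ)| ^ 2 * ‖f k‖) * (|(k : ℝ)| * ‖conv f h k‖) ≤
        E / 2 * (qsum S 2 f + qsum S 2 h) + ε / 2 * qsum S 2 f + M * qsum S 1 h := by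
    intro h hh
    refine (sum_pow_mul_norm_conv_le hf hh hr0).trans ?_
    have i1 : wsum S 0 f * (1 / 2 * qsum S 2 f + 1 / 2 * qsum S 2 h)
        ≤ E * (1 / 2 * qsum S 2 f + 1 / 2 * qsum S 2 h) :=
      mul_le_mul_of_nonneg_right (by linarith) (by have := qsum_nonneg S 2 h; positivity)
    have i2 := mul_le_mul_of_nonneg_right h1 hX
    have i3 := mul_le_mul_of_nonneg_right h2 (qsum_nonneg S 1 h)
    linarith
  have b1 := mul_le_mul_of_nonneg_left (bound f hf) hα
  have b2 := mul_le_mul_of_nonneg_left (bound g hg) hβ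
  have b3 : ∑ k ∈ S, (|(k : ℝ)| ^ 2 * ‖f k‖) * (|(k : ℝ)| ^ 2 * ‖g k‖)
      ≤ 1 / 2 * (qsum S 2 f + qsum S 2 g) := by
    rw [qsum, qsum, ← Finset.sum_add_distrib, Finset.mul_sum]
    refine Finset.sum_le_sum fun k _ => ?_
    nlinarith [sq_nonneg (|(k : ℝ)| ^ 2 * ‖f k‖ - |(k : ℝ)| ^ 2 * ‖g k‖)]
  have b4 := mul_le_mul_of_nonneg_left b3 (mul_nonneg hm hβ)
  have e : ∑ k ∈ S, |(k : ℝ)| ^ 2 * ‖f k‖ * (m * β * (|(k : ℝ)| ^ 2 * ‖g k‖)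
      + (α * (|(k : ℝ)| * ‖conv f f k‖) + β * (|(k : ℝ)| * ‖conv f g k‖)))
      = m * β * ∑ k ∈ S, (|(k : ℝ)| ^ 2 * ‖f k‖) * (|(k : ℝ)| ^ 2 * ‖g k‖)
        + (α * ∑ k ∈ S, (|(k : ℝ)| ^ 2 * ‖f k‖) * (|(k : ℝ)| * ‖conv f f k‖)
          + β * ∑ k ∈ S, (|(k : ℝ)| ^ 2 * ‖f k‖) * (|(k : ℝ)| * ‖conv f g k‖)) := by
    simp only [Finset.mul_sum, ← Finset.sum_add_distrib]
    exact Finset.sum_congr rfl fun k _ => by ring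
  rw [e]
  have c1 : 0 ≤ α * M * qsum S 1 g := by positivity
  have c2 : 0 ≤ β * M * qsum S 1 f := by positivity
  linarith

end Pointwise

/-- A solution of the Galerkin system on `[0, T]` with frequencies in `S`, in which the unknowns
on the right-hand side are multiplied by `θ`. -/
structure IsGalerkin (p : Coeffs) (S : Finset ℤ) (T : ℝ) (θ : ℝ → ℝ) (f g : ℝ → ℤ → ℂ) :
    Prop where
  f_support : ∀ t, ∀ k ∉ S, f t k = 0
  g_support : ∀ t, ∀ k ∉ S, g t k = 0
  θ_continuous : ContinuousOn θ (Icc 0 T)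
  θ_nonneg : ∀ t, 0 ≤ θ t
  f_deriv : ∀ t ∈ Icc 0 T, ∀ k ∈ S, HasDerivWithinAt (fun s => f s k)
    (rhs p.m p.α p.β (θ t • f t) (θ t • g t) k) (Icc 0 T) t
  g_deriv : ∀ t ∈ Icc 0 T, ∀ k ∈ S, HasDerivWithinAt (fun s => g s k)
    (rhs p.n p.α' p.β' (θ t • g t) (θ t • f t) k) (Icc 0 T) t

/-- The system is symmetric under exchange of the two unknowns. -/
def Coeffs.swap (p : Coeffs) : Coeffs := ⟨p.n, p.m, p.α', p.β', p.α, p.β⟩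

lemma IsGalerkin.swap {p : Coeffs} {S : Finset ℤ} {T : ℝ} {θ : ℝ → ℝ} {f g : ℝ → ℤ → ℂ}
    (H : IsGalerkin p S T θ f g) : IsGalerkin p.swap S T θ g f :=
  ⟨H.g_support, H.f_support, H.θ_continuous, H.θ_nonneg, H.g_deriv, H.f_deriv⟩

lemma continuousOn_remainder {S : Finset ℤ} {I : Set ℝ} {m α β : ℝ} {F G : ℝ → ℤ → ℂ}
    (hF : ∀ k, ContinuousOn (fun t => F t k) I) (hG : ∀ k, ContinuousOn (fun t => G t k) I)
    (hF0 : ∀ t, ∀ k ∉ S, F t k = 0) (hG0 : ∀ t, ∀ k ∉ S, G t k = 0) (k : ℤ) :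
    ContinuousOn (fun t => remainder m α β (F t) (G t) k) I := by
  have : ∀ t, conv (F t) (fun j => α * F t j + β * G t j) k
      = ∑ j ∈ S, F t (k - j) * (j * (α * F t j + β * G t j)) := fun t =>
    conv_eq_sum (fun j hj => by simp [hF0 t j hj, hG0 t j hj]) k
  simp only [remainder, this]
  fun_prop

lemma continuousOn_wsum {S : Finset ℤ} {I : Set ℝ} {F : ℝ → ℤ → ℂ} {i : ℕ}
    (hF : ∀ k, ContinuousOn (fun t => F t k) I) : ContinuousOn (fun t => wsum S i (F t)) I := by
  simp only [wsum]
  fun_prop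

lemma continuousOn_qsum {S : Finset ℤ} {I : Set ℝ} {F : ℝ → ℤ → ℂ} {i : ℕ}
    (hF : ∀ k, ContinuousOn (fun t => F t k) I) : ContinuousOn (fun t => qsum S i (F t)) I := by
  simp only [qsum]
  fun_prop

lemma wsum_smul {S : Finset ℤ} {i : ℕ} {θ : ℝ} (hθ : 0 ≤ θ) (f : ℤ → ℂ) :
    wsum S i (θ • f) = θ * wsum S i f := by
  simp only [wsum, Finset.mul_sum, Pi.smul_apply, norm_smul, Real.norm_of_nonneg hθ]
  exact Finset.sum_congr rfl fun k _ => by ring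

namespace IsGalerkin

variable {p : Coeffs} {S : Finset ℤ} {T : ℝ} {θ : ℝ → ℝ} {f g : ℝ → ℤ → ℂ} {E σ κ : ℝ}

lemma f_continuousOn (H : IsGalerkin p S T θ f g) (k : ℤ) :
    ContinuousOn (fun t => f t k) (Icc 0 T) := by
  by_cases hk : k ∈ S
  · exact fun t ht => (H.f_deriv t ht k hk).continuousWithinAt
  · simp only [H.f_support _ k hk]
    exact continuousOn_const

lemma g_continuousOn (H : IsGalerkin p S T θ f g) (k : ℤ) :
    ContinuousOn (fun t => g t k) (Icc 0 T) := H.swap.f_continuousOn k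

/-- The diagonal linear term of the equation for `f` damps each coefficient at the rate
`m α k²`; summation over the frequencies yields the evolution of the `ℓ¹` norm with the weight
`e^{δt}`. -/
lemma sum_norm_le (H : IsGalerkin p S T θ f g) (δ : ℝ) {t : ℝ} (ht : t ∈ Icc 0 T) :
    Real.exp (δ * t) * wsum S 0 (f t) ≤ wsum S 0 (f 0) + ∫ s in (0)..t, Real.exp (δ * s) *
      (∑ k ∈ S, ‖remainder p.m p.α p.β (θ s • f s) (θ s • g s) k‖
        + δ * wsum S 0 (f s) - p.m * p.α * wsum S 2 (θ s • f s)) := by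
  have hf := H.f_continuousOn
  have hg := H.g_continuousOn
  have hθ := H.θ_continuous
  have hr : ∀ k, ContinuousOn
      (fun s => remainder p.m p.α p.β (θ s • f s) (θ s • g s) k) (Icc 0 T) := fun k =>
    continuousOn_remainder (S := S) (fun k => by simp only [Pi.smul_apply]; fun_prop)
      (fun k => by simp only [Pi.smul_apply]; fun_prop)
      (fun t k hk => by simp [H.f_support t k hk]) (fun t k hk => by simp [H.g_support t k hk]) k
  have hsub : Icc 0 t ⊆ Icc 0 T := Icc_subset_Icc_right ht.2
  have key : ∀ k ∈ S, Real.exp (δ * t) * ‖f t k‖ ≤ ‖f 0 k‖ + ∫ s in (0)..t,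
      Real.exp (δ * s) * (‖remainder p.m p.α p.β (θ s • f s) (θ s • g s) k‖
        + δ * ‖f s k‖ - p.m * p.α * k ^ 2 * (θ s * ‖f s k‖)) := by
    intro k hk
    have h := norm_le_add_integral (z := fun s => Real.exp (δ * s) * f s k)
      (a := fun s => θ s * (p.m * p.α * k ^ 2) - δ)
      (r := fun s => Real.exp (δ * s) * remainder p.m p.α p.β (θ s • f s) (θ s • g s) k)
      (fun s hs => by
        have h1 := H.f_deriv s hs k hk
        have h2 : HasDerivWithinAt (fun s : ℝ => ((Real.exp (δ * s) : ℝ) : ℂ))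
            ((Real.exp (δ * s) * (δ * 1) : ℝ) : ℂ) (Icc 0 T) s :=
          (((hasDerivAt_id s).const_mul δ).exp.ofReal_comp).hasDerivWithinAt
        refine (h2.mul h1).congr_deriv ?_
        rw [rhs_eq]
        simp only [Pi.smul_apply, Complex.real_smul]
        push_cast
        ring) (by fun_prop) (by have := hr k; fun_prop) ht
    simp only [norm_mul, Complex.norm_real, Real.norm_eq_abs, Real.abs_exp, mul_zero,
      Real.exp_zero, abs_one, one_mul] at h
    refine h.trans (le_of_eq ?_)
    congr 1
    refine intervalIntegral.integral_congr fun s _ => ?_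
    ring
  have hint : ∀ k ∈ S, IntervalIntegrable (fun s => Real.exp (δ * s) *
      (‖remainder p.m p.α p.β (θ s • f s) (θ s • g s) k‖
        + δ * ‖f s k‖ - p.m * p.α * k ^ 2 * (θ s * ‖f s k‖))) volume 0 t := fun k _ => by
    have := hr k
    exact ContinuousOn.intervalIntegrable_of_Icc ht.1 (ContinuousOn.mono (by fun_prop) hsub)
  have h := Finset.sum_le_sum key
  rw [Finset.sum_add_distrib, ← intervalIntegral.integral_finsetSum hint, ← Finset.mul_sum] at h
  simp only [wsum, pow_zero, one_mul]
  refine h.trans (le_of_eq ?_)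
  congr 1
  refine intervalIntegral.integral_congr fun s _ => ?_
  simp only [← Finset.mul_sum, Finset.sum_sub_distrib, Finset.sum_add_distrib, Pi.smul_apply,
    norm_smul, Real.norm_of_nonneg (H.θ_nonneg s), sq_abs]
  rw [Finset.mul_sum S (fun k => (k : ℝ) ^ 2 * (θ s * ‖f s k‖))]
  simp only [mul_assoc]

/-- The estimate in the Wiener algebra: as long as the truncated unknowns `θ • f`, `θ • g` have
`ℓ¹` norm at most `E`, the smallness condition leaves the dissipation `σ` times two derivatives.
With `δ = 0` it shows that the norm does not increase, with `δ = σ / 2` that it decays. -/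
theorem wiener_estimate (H : IsGalerkin p S T θ f g) (hp : p.Good E σ κ)
    (hE : ∀ t ∈ Icc 0 T, θ t * (wsum S 0 (f t) + wsum S 0 (g t)) ≤ E) (δ : ℝ) {t : ℝ}
    (ht : t ∈ Icc 0 T) :
    Real.exp (δ * t) * (wsum S 0 (f t) + wsum S 0 (g t)) ≤ wsum S 0 (f 0) + wsum S 0 (g 0)
      + ∫ s in (0)..t, Real.exp (δ * s) * (δ * (wsum S 0 (f s) + wsum S 0 (g s))
        - σ * (θ s * (wsum S 2 (f s) + wsum S 2 (g s)))) := by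
  have hf := H.f_continuousOn
  have hg := H.g_continuousOn
  have hθ := H.θ_continuous
  have hsub : Icc 0 t ⊆ Icc 0 T := Icc_subset_Icc_right ht.2
  have hsf : ∀ i, ContinuousOn (fun s => wsum S i (f s)) (Icc 0 T) := fun i => continuousOn_wsum hf
  have hsg : ∀ i, ContinuousOn (fun s => wsum S i (g s)) (Icc 0 T) := fun i => continuousOn_wsum hg
  have hrem : ∀ (m α β : ℝ) (F G : ℝ → ℤ → ℂ), (∀ k, ContinuousOn (fun t => F t k) (Icc 0 T)) →
      (∀ k, ContinuousOn (fun t => G t k) (Icc 0 T)) → (∀ t, ∀ k ∉ S, F t k = 0) →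
      (∀ t, ∀ k ∉ S, G t k = 0) → IntervalIntegrable (fun s => Real.exp (δ * s) *
      (∑ k ∈ S, ‖remainder m α β (θ s • F s) (θ s • G s) k‖
        + δ * wsum S 0 (F s) - m * α * wsum S 2 (θ s • F s))) volume 0 t := by
    intro m α β F G hF hG hF0 hG0
    have hr : ∀ k, ContinuousOn
        (fun s => remainder m α β (θ s • F s) (θ s • G s) k) (Icc 0 T) := fun k =>
      continuousOn_remainder (S := S) (fun k => by simp only [Pi.smul_apply]; fun_prop)
        (fun k => by simp only [Pi.smul_apply]; fun_prop)
        (fun t k hk => by simp [hF0 t k hk]) (fun t k hk => by simp [hG0 t k hk]) k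
    have h0 : ContinuousOn (fun s => wsum S 0 (F s)) (Icc 0 T) := continuousOn_wsum hF
    have h2 : ContinuousOn (fun s => wsum S 2 (θ s • F s)) (Icc 0 T) :=
      continuousOn_wsum fun k => by simp only [Pi.smul_apply]; fun_prop
    exact ContinuousOn.intervalIntegrable_of_Icc ht.1 (ContinuousOn.mono (by fun_prop) hsub)
  have h1 := H.sum_norm_le δ ht
  have h2 := H.swap.sum_norm_le δ ht
  have h3 := hrem p.m p.α p.β f g hf hg H.f_support H.g_support
  have h4 := hrem p.n p.α' p.β' g f hg hf H.g_support H.f_support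
  have h5 := hsf 0
  have h6 := hsg 0
  have h7 := hsf 2
  have h8 := hsg 2
  have h9 := intervalIntegral.integral_mono_on ht.1 (h3.add h4)
    (g := fun s => Real.exp (δ * s) * (δ * (wsum S 0 (f s) + wsum S 0 (g s))
        - σ * (θ s * (wsum S 2 (f s) + wsum S 2 (g s)))))
    (ContinuousOn.intervalIntegrable_of_Icc ht.1 (ContinuousOn.mono (by fun_prop) hsub))
    (fun s hs => by
      rw [← mul_add]
      refine mul_le_mul_of_nonneg_left ?_ (Real.exp_pos _).le
      have hs' := hsub hs
      have hθ0 := H.θ_nonneg s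
      have r1 := sum_norm_remainder_le (S := S) (f := θ s • f s) (g := θ s • g s)
        (fun k hk => by simp [H.f_support s k hk]) (fun k hk => by simp [H.g_support s k hk])
        hp.m_nonneg hp.α_nonneg hp.β_nonneg
      have r2 := sum_norm_remainder_le (S := S) (f := θ s • g s) (g := θ s • f s)
        (fun k hk => by simp [H.g_support s k hk]) (fun k hk => by simp [H.f_support s k hk])
        hp.n_nonneg hp.α'_nonneg hp.β'_nonneg
      have hE' := hE s hs'
      rw [mul_add, ← wsum_smul hθ0, ← wsum_smul hθ0] at hE'
      rw [mul_add (θ s), ← wsum_smul hθ0, ← wsum_smul hθ0]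
      have w0 := wsum_nonneg S 0 (θ s • f s)
      have w0' := wsum_nonneg S 0 (θ s • g s)
      have w2 := wsum_nonneg S 2 (θ s • f s)
      have w2' := wsum_nonneg S 2 (θ s • g s)
      set F0 := wsum S 0 (θ s • f s)
      set G0 := wsum S 0 (θ s • g s)
      set F2 := wsum S 2 (θ s • f s)
      set G2 := wsum S 2 (θ s • g s)
      have u1 : F0 ≤ E := by linarith
      have u2 : G0 ≤ E := by linarith
      have := hp.α_nonneg
      have := hp.β_nonneg
      have := hp.α'_nonneg
      have := hp.β'_nonneg
      have v1 := mul_le_mul_of_nonneg_left u1 (by positivity : 0 ≤ p.α * F2)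
      have v2 := mul_le_mul_of_nonneg_left u1 (by positivity : 0 ≤ p.β * G2)
      have v3 := mul_le_mul_of_nonneg_left u2 (by positivity : 0 ≤ p.β * F2)
      have v4 := mul_le_mul_of_nonneg_left u2 (by positivity : 0 ≤ p.α' * G2)
      have v5 := mul_le_mul_of_nonneg_left u2 (by positivity : 0 ≤ p.β' * F2)
      have v6 := mul_le_mul_of_nonneg_left u1 (by positivity : 0 ≤ p.β' * G2)
      have v7 := mul_le_mul_of_nonneg_left hp.wiener_f w2
      have v8 := mul_le_mul_of_nonneg_left hp.wiener_g w2'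
      linarith)
  rw [intervalIntegral.integral_add h3 h4] at h9
  simp only [Coeffs.swap] at h2
  linarith

end IsGalerkin

/-- The constant `C` for which the growth rate of the squared `Ḣ¹` norm is at most
`C ∑ k² (|f_k| + |g_k|)`. -/
def Coeffs.growth (p : Coeffs) (E κ : ℝ) : ℝ :=
  (p.α + p.β + p.α' + p.β') * ((p.α + p.β + p.α' + p.β') + 1) * (E + 1) / (2 * κ)

lemma Coeffs.Good.growth_nonneg {p : Coeffs} {E σ κ : ℝ} (hp : p.Good E σ κ) :
    0 ≤ p.growth E κ := by
  have := hp.α_nonneg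
  have := hp.β_nonneg
  have := hp.α'_nonneg
  have := hp.β'_nonneg
  have := hp.κ_pos
  have := hp.E_nonneg
  unfold growth
  positivity

namespace IsGalerkin

variable {p : Coeffs} {S : Finset ℤ} {T : ℝ} {f g : ℝ → ℤ → ℂ} {E σ κ : ℝ}

lemma f_hasDeriv (H : IsGalerkin p S T (fun _ => 1) f g) {t : ℝ} (ht : t ∈ Icc 0 T) {k : ℤ}
    (hk : k ∈ S) :
    HasDerivWithinAt (fun s => f s k) (rhs p.m p.α p.β (f t) (g t) k) (Icc 0 T) t := by
  simpa using H.f_deriv t ht k hk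

lemma qsum_hasDeriv (H : IsGalerkin p S T (fun _ => 1) f g) {t : ℝ} (ht : t ∈ Icc 0 T) :
    HasDerivWithinAt (fun s => qsum S 1 (f s))
      (∑ k ∈ S, |(k : ℝ)| ^ 2 * (2 * inner ℝ (f t k) (rhs p.m p.α p.β (f t) (g t) k)))
      (Icc 0 T) t := by
  have : ∀ s, qsum S 1 (f s) = ∑ k ∈ S, |(k : ℝ)| ^ 2 * ‖f s k‖ ^ 2 := fun s => by
    simp only [qsum, mul_pow, pow_one]
  simp only [this]
  exact HasDerivWithinAt.fun_sum fun k hk => ((H.f_hasDeriv ht hk).norm_sq).const_mul _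

lemma qsum_deriv_le (m α β : ℝ) (F G : ℤ → ℂ) :
    ∑ k ∈ S, |(k : ℝ)| ^ 2 * (2 * inner ℝ (F k) (rhs m α β F G k)) ≤
      -2 * (m * α) * qsum S 2 F
        + 2 * ∑ k ∈ S, |(k : ℝ)| ^ 2 * ‖F k‖ * ‖remainder m α β F G k‖ := by
  rw [qsum, Finset.mul_sum, Finset.mul_sum, ← Finset.sum_add_distrib]
  refine Finset.sum_le_sum fun k _ => ?_
  have e : -((m * α * k ^ 2 : ℝ) : ℂ) * F k = (-(m * α * k ^ 2)) • F k := by simp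
  rw [rhs_eq, inner_add_right, e, real_inner_smul_right, real_inner_self_eq_norm_sq, ← sq_abs (k : ℝ)]
  have h := mul_le_mul_of_nonneg_left (real_inner_le_norm (F k) (remainder m α β F G k))
    (by positivity : 0 ≤ 2 * |(k : ℝ)| ^ 2)
  nlinarith

/-- The energy estimate in `Ḣ¹`.  The growth rate is integrable in time by the estimate in the
Wiener algebra, so that the exponential decay of the dissipation prevails. -/
theorem sobolev_estimate (H : IsGalerkin p S T (fun _ => 1) f g) (hp : p.Good E σ κ)
    (h0 : (0 : ℤ) ∉ S) (hE : ∀ t ∈ Icc 0 T, wsum S 0 (f t) + wsum S 0 (g t) ≤ E) {P : ℝ}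
    (hP : ∀ t ∈ Icc 0 T, ∫ s in (0)..t,
      p.growth E κ * (wsum S 2 (f s) + wsum S 2 (g s)) ≤ P) {t : ℝ} (ht : t ∈ Icc 0 T) :
    Real.exp (κ * t) * (qsum S 1 (f t) + qsum S 1 (g t))
        + κ * ∫ s in (0)..t, (qsum S 2 (f s) + qsum S 2 (g s)) ≤
      Real.exp P * (qsum S 1 (f 0) + qsum S 1 (g 0)) := by
  have hf := H.f_continuousOn
  have hg := H.g_continuousOn
  have q2f : ContinuousOn (fun s => qsum S 2 (f s)) (Icc 0 T) := continuousOn_qsum hf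
  have q2g : ContinuousOn (fun s => qsum S 2 (g s)) (Icc 0 T) := continuousOn_qsum hg
  have w2f : ContinuousOn (fun s => wsum S 2 (f s)) (Icc 0 T) := continuousOn_wsum hf
  have w2g : ContinuousOn (fun s => wsum S 2 (g s)) (Icc 0 T) := continuousOn_wsum hg
  refine gronwall_dissipation hp.κ_pos.le (fun t ht => (H.qsum_hasDeriv ht).add
      (H.swap.qsum_hasDeriv ht)) (fun t ht => ?_) (q2f.add q2g)
      (p := fun s => p.growth E κ * (wsum S 2 (f s) + wsum S 2 (g s))) (by fun_prop)
      (fun t _ => add_nonneg (qsum_nonneg _ _ _) (qsum_nonneg _ _ _))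
      (fun t _ => add_le_add (qsum_mono_exp one_le_two (H.f_support t 0 h0))
        (qsum_mono_exp one_le_two (H.g_support t 0 h0))) hP ht
  have hα := hp.α_nonneg
  have hβ := hp.β_nonneg
  have hα' := hp.α'_nonneg
  have hβ' := hp.β'_nonneg
  have hκ := hp.κ_pos
  have hE0 := hp.E_nonneg
  set B := p.α + p.β + p.α' + p.β' with hB
  have hB0 : 0 ≤ B := by positivity
  -- small enough for the lower order terms to use up no more than half of the dissipation
  set ε := 2 * κ / (B + 1) with hε
  have hε0 : 0 < ε := by positivity
  have hBε : B * (ε / 2) ≤ κ := by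
    rw [hε, show B * (2 * κ / (B + 1) / 2) = κ * (B / (B + 1)) by ring]
    exact mul_le_of_le_one_right hκ.le (div_le_one_of_le₀ (by linarith) (by positivity))
  have hgr : p.growth E κ = 2 * (B * ((E + 1) / (2 * ε))) := by
    rw [hε, Coeffs.growth, ← hB]
    field_simp
  have hE' := hE t ht
  have s1 := sum_test_remainder_le (H.f_support t) (H.g_support t) (H.f_support t 0 h0)
    hp.m_nonneg hα hβ hE' hε0
  have s2 := sum_test_remainder_le (H.g_support t) (H.f_support t) (H.g_support t 0 h0)
    hp.n_nonneg hα' hβ' (by linarith : wsum S 0 (g t) + wsum S 0 (f t) ≤ E) hε0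
  have d1 := qsum_deriv_le (S := S) p.m p.α p.β (f t) (g t)
  have d2 := qsum_deriv_le (S := S) p.n p.α' p.β' (g t) (f t)
  have hX := qsum_nonneg S 2 (f t)
  have hW := qsum_nonneg S 2 (g t)
  have hY : 0 ≤ qsum S 1 (f t) + qsum S 1 (g t) :=
    add_nonneg (qsum_nonneg _ _ _) (qsum_nonneg _ _ _)
  have hA : 0 ≤ wsum S 2 (f t) + wsum S 2 (g t) :=
    add_nonneg (wsum_nonneg _ _ _) (wsum_nonneg _ _ _)
  rw [add_comm (qsum S 1 (g t)), add_comm (wsum S 2 (g t))] at s2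
  simp only [Coeffs.swap]
  rw [hgr]
  change _ ≤ -2 * κ * (qsum S 2 (f t) + qsum S 2 (g t)) + 2 * (B * ((E + 1) / (2 * ε)))
    * (wsum S 2 (f t) + wsum S 2 (g t)) * (qsum S 1 (f t) + qsum S 1 (g t))
  set X := qsum S 2 (f t)
  set W := qsum S 2 (g t)
  set Y := qsum S 1 (f t) + qsum S 1 (g t)
  set M := (E + 1) / (2 * ε) * (wsum S 2 (f t) + wsum S 2 (g t)) with hM
  have c1 := mul_le_mul_of_nonneg_right hp.sobolev_f hX
  have c2 := mul_le_mul_of_nonneg_right hp.sobolev_g hW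
  have c3 : (p.α + p.β) * (ε / 2) * X ≤ κ * X := by
    refine mul_le_mul_of_nonneg_right (le_trans ?_ hBε) hX
    exact mul_le_mul_of_nonneg_right (by linarith) (by positivity)
  have c4 : (p.α' + p.β') * (ε / 2) * W ≤ κ * W := by
    refine mul_le_mul_of_nonneg_right (le_trans ?_ hBε) hW
    exact mul_le_mul_of_nonneg_right (by linarith) (by positivity)
  have e : 2 * (B * ((E + 1) / (2 * ε))) * (wsum S 2 (f t) + wsum S 2 (g t)) * Y
      = 2 * ((p.α + p.β) * M * Y) + 2 * ((p.α' + p.β') * M * Y) := by rw [hM, hB]; ring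
  linarith

end IsGalerkin

/-- The bound for the squared `Ḣ¹` norm of solutions with data of size `E` in the Wiener algebra
and squared norm `Y` in `Ḣ¹`; the exponent bounds the time integral of the growth rate. -/
def Coeffs.sobolevBound (p : Coeffs) (E σ κ Y : ℝ) : ℝ :=
  Real.exp (p.growth E κ * (2 * E / σ)) * Y

/-- Solutions of the Galerkin system, with bounds uniform in the set `S` of frequencies. -/
theorem exists_galerkin {p : Coeffs} {E σ κ Y : ℝ} (hp : p.Good E σ κ) {S : Finset ℤ}
    (hS : ∀ k, k ∈ S ↔ -k ∈ S) (h0 : (0 : ℤ) ∉ S) {a c : ℤ → ℂ}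
    (ha : ∀ k, a (-k) = conj (a k)) (hc : ∀ k, c (-k) = conj (c k))
    (hac : wsum S 0 a + wsum S 0 c ≤ E) (hY : qsum S 1 a + qsum S 1 c ≤ Y)
    {T : ℝ} (hT : 0 ≤ T) :
    ∃ f g : ℝ → ℤ → ℂ, IsGalerkin p S T (fun _ => 1) f g ∧
      (∀ k ∈ S, f 0 k = a k) ∧ (∀ k ∈ S, g 0 k = c k) ∧
      (∀ t ∈ Icc 0 T, ∀ k, f t (-k) = conj (f t k)) ∧
      (∀ t ∈ Icc 0 T, ∀ k, g t (-k) = conj (g t k)) ∧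
      (∀ t ∈ Icc 0 T, Real.exp (σ / 2 * t) * (wsum S 0 (f t) + wsum S 0 (g t)) ≤ E) ∧
      (∀ t ∈ Icc 0 T, ∫ s in (0)..t, (wsum S 2 (f s) + wsum S 2 (g s)) ≤ 2 * E / σ) ∧
      (∀ t ∈ Icc 0 T, Real.exp (κ * t) * (qsum S 1 (f t) + qsum S 1 (g t))
        + κ * ∫ s in (0)..t, (qsum S 2 (f s) + qsum S 2 (g s)) ≤ p.sobolevBound E σ κ Y) := by
  obtain ⟨f, g, θ, fS, gS, f0, g0, fr, gr, θc, θ0, θE, θ1, fd, gd⟩ :=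
    exists_galerkin_retracted hS p.m p.n p.α p.β p.α' p.β' ha hc hp.E_nonneg hT
  have H : IsGalerkin p S T θ f g := ⟨fS, gS, θc, θ0, fd, gd⟩
  have hσ := hp.σ_pos
  have init : ∀ i, wsum S i (f 0) = wsum S i a ∧ wsum S i (g 0) = wsum S i c := fun i =>
    ⟨Finset.sum_congr rfl fun k hk => by rw [f0 k hk],
      Finset.sum_congr rfl fun k hk => by rw [g0 k hk]⟩
  have initq : qsum S 1 (f 0) = qsum S 1 a ∧ qsum S 1 (g 0) = qsum S 1 c :=
    ⟨Finset.sum_congr rfl fun k hk => by rw [f0 k hk],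
      Finset.sum_congr rfl fun k hk => by rw [g0 k hk]⟩
  -- the retraction is never active
  have hE : ∀ t ∈ Icc 0 T, wsum S 0 (f t) + wsum S 0 (g t) ≤ E := by
    intro t ht
    have h := H.wiener_estimate hp (fun t _ => θE t) 0 ht
    rw [(init 0).1, (init 0).2] at h
    simp only [zero_mul, Real.exp_zero, one_mul, zero_sub] at h
    have h1 : ∫ s in (0)..t, -(σ * (θ s * (wsum S 2 (f s) + wsum S 2 (g s)))) ≤ 0 := by
      rw [intervalIntegral.integral_neg, neg_nonpos]
      refine intervalIntegral.integral_nonneg ht.1 fun s _ => ?_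
      have := wsum_nonneg S 2 (f s)
      have := wsum_nonneg S 2 (g s)
      have := θ0 s
      positivity
    linarith
  have H1 : IsGalerkin p S T (fun _ => 1) f g := by
    refine ⟨fS, gS, continuousOn_const, fun _ => zero_le_one, fun t ht k hk => ?_,
      fun t ht k hk => ?_⟩
    · have := fd t ht k hk
      rw [(θ1 t (hE t ht)).1, (θ1 t (hE t ht)).2] at this
      simpa using this
    · have := gd t ht k hk
      rw [(θ1 t (hE t ht)).1, (θ1 t (hE t ht)).2] at this
      simpa using this
  have w2f : ContinuousOn (fun s => wsum S 2 (f s)) (Icc 0 T) := continuousOn_wsum H.f_continuousOn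
  have w2g : ContinuousOn (fun s => wsum S 2 (g s)) (Icc 0 T) := continuousOn_wsum H.g_continuousOn
  have w0f : ContinuousOn (fun s => wsum S 0 (f s)) (Icc 0 T) := continuousOn_wsum H.f_continuousOn
  have w0g : ContinuousOn (fun s => wsum S 0 (g s)) (Icc 0 T) := continuousOn_wsum H.g_continuousOn
  have main : ∀ t ∈ Icc 0 T, Real.exp (σ / 2 * t) * (wsum S 0 (f t) + wsum S 0 (g t))
      + σ / 2 * ∫ s in (0)..t, (wsum S 2 (f s) + wsum S 2 (g s)) ≤ E := by
    intro t ht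
    have hsub : Icc 0 t ⊆ Icc 0 T := Icc_subset_Icc_right ht.2
    have h := H1.wiener_estimate hp (fun t ht => by simpa using hE t ht) (σ / 2) ht
    rw [(init 0).1, (init 0).2] at h
    have h1 := intervalIntegral.integral_mono_on (μ := volume) ht.1
      (f := fun s => Real.exp (σ / 2 * s) * (σ / 2 * (wsum S 0 (f s) + wsum S 0 (g s))
        - σ * (1 * (wsum S 2 (f s) + wsum S 2 (g s)))))
      (g := fun s => -(σ / 2) * (wsum S 2 (f s) + wsum S 2 (g s)))
      (ContinuousOn.intervalIntegrable_of_Icc ht.1 (ContinuousOn.mono (by fun_prop) hsub))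
      (ContinuousOn.intervalIntegrable_of_Icc ht.1 (ContinuousOn.mono (by fun_prop) hsub))
      (fun s hs => by
        have a1 := wsum_mono_exp (S := S) (zero_le_two) (fS s 0 h0)
        have a2 := wsum_mono_exp (S := S) (zero_le_two) (gS s 0 h0)
        have a3 := wsum_nonneg S 2 (f s)
        have a4 := wsum_nonneg S 2 (g s)
        have a5 : 1 ≤ Real.exp (σ / 2 * s) :=
          Real.one_le_exp (mul_nonneg (by positivity) hs.1)
        have a6 : σ / 2 * (wsum S 0 (f s) + wsum S 0 (g s))
            - σ * (1 * (wsum S 2 (f s) + wsum S 2 (g s)))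
            ≤ -(σ / 2 * (wsum S 2 (f s) + wsum S 2 (g s))) := by nlinarith
        have a7 : 0 ≤ σ / 2 * (wsum S 2 (f s) + wsum S 2 (g s)) := by positivity
        have a8 := mul_le_mul_of_nonneg_left a6 (Real.exp_pos (σ / 2 * s)).le
        nlinarith)
    rw [intervalIntegral.integral_const_mul] at h1
    linarith
  have int0 : ∀ t ∈ Icc 0 T, 0 ≤ ∫ s in (0)..t, (wsum S 2 (f s) + wsum S 2 (g s)) := fun t ht =>
    intervalIntegral.integral_nonneg ht.1 fun s _ =>
      add_nonneg (wsum_nonneg _ _ _) (wsum_nonneg _ _ _)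
  have hint : ∀ t ∈ Icc 0 T,
      ∫ s in (0)..t, (wsum S 2 (f s) + wsum S 2 (g s)) ≤ 2 * E / σ := by
    intro t ht
    have h := main t ht
    have h1 : 0 ≤ Real.exp (σ / 2 * t) * (wsum S 0 (f t) + wsum S 0 (g t)) :=
      mul_nonneg (Real.exp_pos _).le (add_nonneg (wsum_nonneg _ _ _) (wsum_nonneg _ _ _))
    rw [le_div_iff₀ hσ]
    linarith
  refine ⟨f, g, H1, f0, g0, fr, gr, fun t ht => ?_, hint, fun t ht => ?_⟩
  · have := mul_nonneg (half_pos hσ).le (int0 t ht)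
    linarith [main t ht]
  · have h := H1.sobolev_estimate hp h0 hE (P := p.growth E κ * (2 * E / σ))
      (fun t ht => by
        rw [intervalIntegral.integral_const_mul]
        exact mul_le_mul_of_nonneg_left (hint t ht) hp.growth_nonneg) ht
    rw [initq.1, initq.2] at h
    exact h.trans (mul_le_mul_of_nonneg_left hY (Real.exp_pos _).le)

section RhsBounds

variable {S : Finset ℤ} {f g : ℤ → ℂ} {m α β E : ℝ}

lemma norm_rhs_le (hm : 0 ≤ m) (hα : 0 ≤ α) (k : ℤ) :
    ‖rhs m α β f g k‖ ≤ m * α * (|(k : ℝ)| ^ 2 * ‖f k‖) + ‖remainder m α β f g k‖ := by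
  rw [rhs_eq]
  refine (norm_add_le _ _).trans (add_le_add_left (le_of_eq ?_) _)
  rw [norm_mul, norm_neg, Complex.norm_real, Real.norm_of_nonneg (by positivity), sq_abs]
  ring

lemma sum_norm_rhs_le (hf : ∀ k ∉ S, f k = 0) (hg : ∀ k ∉ S, g k = 0) (hm : 0 ≤ m)
    (hα : 0 ≤ α) (hβ : 0 ≤ β) (hE : wsum S 0 f + wsum S 0 g ≤ E) :
    ∑ k ∈ S, ‖rhs m α β f g k‖ ≤
      (m + 2 * E) * (α + β) * (wsum S 2 f + wsum S 2 g) := by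
  have h := Finset.sum_le_sum fun k (_ : k ∈ S) => norm_rhs_le (f := f) (g := g) (β := β) hm hα k
  rw [Finset.sum_add_distrib, ← Finset.mul_sum] at h
  have h1 := sum_norm_remainder_le hf hg hm hα hβ
  have a0 := wsum_nonneg S 0 f
  have b0 := wsum_nonneg S 0 g
  have a2 := wsum_nonneg S 2 f
  have b2 := wsum_nonneg S 2 g
  change _ ≤ m * α * wsum S 2 f + _ at h
  have uf : wsum S 0 f ≤ E := by linarith
  have ug : wsum S 0 g ≤ E := by linarith
  have hE0 : 0 ≤ E := a0.trans uf
  have i1 := mul_le_mul_of_nonneg_left uf (by positivity : 0 ≤ α * wsum S 2 f)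
  have i2 := mul_le_mul_of_nonneg_left uf (by positivity : 0 ≤ β * wsum S 2 g)
  have i3 := mul_le_mul_of_nonneg_left ug (by positivity : 0 ≤ β * wsum S 2 f)
  have i4 : 0 ≤ m * α * wsum S 2 g := by positivity
  have i5 : 0 ≤ m * β * wsum S 2 f := by positivity
  have i6 : 0 ≤ E * α * wsum S 2 g := by positivity
  have i7 : 0 ≤ E * β * wsum S 2 f := by positivity
  have i8 : 0 ≤ E * β * wsum S 2 g := by positivity
  linarith

lemma sum_test_rhs_le (hf : ∀ k ∉ S, f k = 0) (hg : ∀ k ∉ S, g k = 0) (hf0 : f 0 = 0)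
    (hm : 0 ≤ m) (hα : 0 ≤ α) (hβ : 0 ≤ β) (hE : wsum S 0 f + wsum S 0 g ≤ E) :
    ∑ k ∈ S, |(k : ℝ)| ^ 2 * ‖f k‖ * ‖rhs m α β f g k‖ ≤
      (m + E + 1) * (α + β) * (qsum S 2 f + qsum S 2 g)
      + (α + β) * (E + 1) * (wsum S 2 f + wsum S 2 g) * (qsum S 1 f + qsum S 1 g) := by
  have h := Finset.sum_le_sum fun k (_ : k ∈ S) => mul_le_mul_of_nonneg_left
    (norm_rhs_le (f := f) (g := g) (β := β) hm hα k) (by positivity : 0 ≤ |(k : ℝ)| ^ 2 * ‖f k‖)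
  have e : ∑ k ∈ S, |(k : ℝ)| ^ 2 * ‖f k‖ *
      (m * α * (|(k : ℝ)| ^ 2 * ‖f k‖) + ‖remainder m α β f g k‖) = m * α * qsum S 2 f
        + ∑ k ∈ S, |(k : ℝ)| ^ 2 * ‖f k‖ * ‖remainder m α β f g k‖ := by
    rw [qsum, Finset.mul_sum, ← Finset.sum_add_distrib]
    exact Finset.sum_congr rfl fun k _ => by ring
  rw [e] at h
  have h1 := sum_test_remainder_le hf hg hf0 hm hα hβ hE one_pos
  have hX := qsum_nonneg S 2 f
  have hW := qsum_nonneg S 2 g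
  have hY : 0 ≤ qsum S 1 f + qsum S 1 g := add_nonneg (qsum_nonneg _ _ _) (qsum_nonneg _ _ _)
  have hA : 0 ≤ wsum S 2 f + wsum S 2 g := add_nonneg (wsum_nonneg _ _ _) (wsum_nonneg _ _ _)
  have hE0 : 0 ≤ E := (add_nonneg (wsum_nonneg S 0 f) (wsum_nonneg S 0 g)).trans hE
  have i1 : (m * β + E * β) / 2 * (qsum S 2 f + qsum S 2 g) + (E * α + (α + β) * (1 / 2)) * qsum S 2 f
      + m * α * qsum S 2 f ≤ (m + E + 1) * (α + β) * (qsum S 2 f + qsum S 2 g) := by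
    have j1 : 0 ≤ m * β := by positivity
    have j2 : 0 ≤ E * β := by positivity
    have j3 : 0 ≤ E * α := by positivity
    have j4 : 0 ≤ m * α := by positivity
    nlinarith [mul_nonneg j1 hX, mul_nonneg j1 hW, mul_nonneg j2 hX, mul_nonneg j2 hW,
      mul_nonneg j3 hW, mul_nonneg j4 hW, mul_nonneg hα hX, mul_nonneg hα hW, mul_nonneg hβ hX,
      mul_nonneg hβ hW]
  have i2 : (α + β) * ((E + 1) / (2 * 1) * (wsum S 2 f + wsum S 2 g)) * (qsum S 1 f + qsum S 1 g)
      ≤ (α + β) * (E + 1) * (wsum S 2 f + wsum S 2 g) * (qsum S 1 f + qsum S 1 g) := by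
    have : 0 ≤ (α + β) * (E + 1) * (wsum S 2 f + wsum S 2 g) * (qsum S 1 f + qsum S 1 g) := by
      positivity
    linarith
  linarith

end RhsBounds

/-- A bound for `∑ₖ supₜ |k|² |f_k(t)|²`, with the times `τ k` close to the supremum.  Unlike the
bound for `supₜ ∑ₖ`, it yields continuity in time with values in `Ḣ¹`, by dominated convergence.
It holds because `∑ₖ |k|² |∂ₜ|f_k|²|` is integrable in time. -/
lemma IsGalerkin.sum_sq_le {p : Coeffs} {S : Finset ℤ} {T : ℝ} {f g : ℝ → ℤ → ℂ}
    {E σ κ B Q W : ℝ} (H : IsGalerkin p S T (fun _ => 1) f g) (hp : p.Good E σ κ)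
    (h0 : (0 : ℤ) ∉ S) (hT : 0 ≤ T)
    (hE : ∀ t ∈ Icc 0 T, wsum S 0 (f t) + wsum S 0 (g t) ≤ E)
    (hB : ∀ t ∈ Icc 0 T, qsum S 1 (f t) + qsum S 1 (g t) ≤ B)
    (hW : ∫ s in (0)..T, (wsum S 2 (f s) + wsum S 2 (g s)) ≤ W)
    (hQ : ∫ s in (0)..T, (qsum S 2 (f s) + qsum S 2 (g s)) ≤ Q)
    {τ : ℤ → ℝ} (hτ : ∀ k, τ k ∈ Icc 0 T) :
    ∑ k ∈ S, (|(k : ℝ)| * ‖f (τ k) k‖) ^ 2 ≤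
      B + 2 * ((p.m + E + 1) * (p.α + p.β) * Q + (p.α + p.β) * (E + 1) * B * W) := by
  have hf := H.f_continuousOn
  have hg := H.g_continuousOn
  have hα := hp.α_nonneg
  have hβ := hp.β_nonneg
  have hm := hp.m_nonneg
  have hE0 := hp.E_nonneg
  have hr : ∀ k, ContinuousOn (fun s => ‖rhs p.m p.α p.β (f s) (g s) k‖) (Icc 0 T) := fun k => by
    simp only [rhs_eq]
    have := continuousOn_remainder (m := p.m) (α := p.α) (β := p.β) hf hg H.f_support H.g_support k
    fun_prop
  have key : ∀ k ∈ S, (|(k : ℝ)| * ‖f (τ k) k‖) ^ 2 ≤ (|(k : ℝ)| ^ 1 * ‖f 0 k‖) ^ 2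
      + ∫ s in (0)..T, 2 * (|(k : ℝ)| ^ 2 * ‖f s k‖ * ‖rhs p.m p.α p.β (f s) (g s) k‖) := by
    intro k hk
    have ht := hτ k
    have hsub : Icc 0 (τ k) ⊆ Icc 0 T := Icc_subset_Icc_right ht.2
    have hfk := hf k
    have hrk := hr k
    have h := intervalIntegral.sub_le_integral_of_hasDeriv_right_of_le ht.1
      (g := fun s => |(k : ℝ)| ^ 2 * ‖f s k‖ ^ 2)
      (φ := fun s => 2 * (|(k : ℝ)| ^ 2 * ‖f s k‖ * ‖rhs p.m p.α p.β (f s) (g s) k‖))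
      (ContinuousOn.mono (by fun_prop) hsub)
      (fun s hs => by
        have hs' : s ∈ Ioo 0 T := ⟨hs.1, hs.2.trans_le ht.2⟩
        exact ((((H.f_hasDeriv (Ioo_subset_Icc_self hs') hk).hasDerivAt
          (Icc_mem_nhds hs'.1 hs'.2)).norm_sq).const_mul _).hasDerivWithinAt)
      (ContinuousOn.integrableOn_Icc (ContinuousOn.mono (by fun_prop) hsub))
      (fun s _ => by
        have := mul_le_mul_of_nonneg_left
          (real_inner_le_norm (f s k) (rhs p.m p.α p.β (f s) (g s) k))
          (by positivity : 0 ≤ 2 * |(k : ℝ)| ^ 2)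
        linarith)
    have h2 : ∫ s in (0)..τ k, 2 * (|(k : ℝ)| ^ 2 * ‖f s k‖ * ‖rhs p.m p.α p.β (f s) (g s) k‖)
        ≤ ∫ s in (0)..T, 2 * (|(k : ℝ)| ^ 2 * ‖f s k‖ * ‖rhs p.m p.α p.β (f s) (g s) k‖) :=
      intervalIntegral.integral_mono_interval le_rfl ht.1 ht.2
        (Filter.Eventually.of_forall fun s => by positivity)
        (ContinuousOn.intervalIntegrable_of_Icc hT (by fun_prop))
    rw [mul_pow, mul_pow, pow_one]
    linarith
  have h := Finset.sum_le_sum key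
  rw [Finset.sum_add_distrib, ← intervalIntegral.integral_finsetSum (fun k _ => by
    have hfk := hf k
    have hrk := hr k
    exact ContinuousOn.intervalIntegrable_of_Icc hT (by fun_prop))] at h
  have w2f : ContinuousOn (fun s => wsum S 2 (f s)) (Icc 0 T) := continuousOn_wsum hf
  have w2g : ContinuousOn (fun s => wsum S 2 (g s)) (Icc 0 T) := continuousOn_wsum hg
  have q2f : ContinuousOn (fun s => qsum S 2 (f s)) (Icc 0 T) := continuousOn_qsum hf
  have q2g : ContinuousOn (fun s => qsum S 2 (g s)) (Icc 0 T) := continuousOn_qsum hg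
  have iw : IntervalIntegrable (fun s => wsum S 2 (f s) + wsum S 2 (g s)) volume 0 T :=
    ContinuousOn.intervalIntegrable_of_Icc hT (by fun_prop)
  have iq : IntervalIntegrable (fun s => qsum S 2 (f s) + qsum S 2 (g s)) volume 0 T :=
    ContinuousOn.intervalIntegrable_of_Icc hT (by fun_prop)
  have h0T : (0 : ℝ) ∈ Icc 0 T := ⟨le_rfl, hT⟩
  have hB0 : 0 ≤ B := (add_nonneg (qsum_nonneg S 1 (f 0)) (qsum_nonneg S 1 (g 0))).trans (hB 0 h0T)
  have h3 := intervalIntegral.integral_mono_on hT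
    (f := fun s => ∑ k ∈ S, 2 * (|(k : ℝ)| ^ 2 * ‖f s k‖ * ‖rhs p.m p.α p.β (f s) (g s) k‖))
    (g := fun s => 2 * ((p.m + E + 1) * (p.α + p.β)) * (qsum S 2 (f s) + qsum S 2 (g s))
      + 2 * ((p.α + p.β) * (E + 1) * B) * (wsum S 2 (f s) + wsum S 2 (g s)))
    (ContinuousOn.intervalIntegrable_of_Icc hT (by fun_prop))
    ((iq.const_mul _).add (iw.const_mul _))
    (fun s hs => by
      have h1 := sum_test_rhs_le (H.f_support s) (H.g_support s) (H.f_support s 0 h0) hm hα hβ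
        (hE s hs)
      have h2 : (p.α + p.β) * (E + 1) * (wsum S 2 (f s) + wsum S 2 (g s))
          * (qsum S 1 (f s) + qsum S 1 (g s))
          ≤ (p.α + p.β) * (E + 1) * (wsum S 2 (f s) + wsum S 2 (g s)) * B := by
        refine mul_le_mul_of_nonneg_left (hB s hs) ?_
        have := wsum_nonneg S 2 (f s)
        have := wsum_nonneg S 2 (g s)
        positivity
      rw [← Finset.mul_sum]
      linarith)
  rw [intervalIntegral.integral_add (iq.const_mul _) (iw.const_mul _),
    intervalIntegral.integral_const_mul, intervalIntegral.integral_const_mul] at h3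
  have h4 : ∑ k ∈ S, (|(k : ℝ)| ^ 1 * ‖f 0 k‖) ^ 2 ≤ B := by
    have := hB 0 h0T
    have := qsum_nonneg S 1 (g 0)
    change qsum S 1 (f 0) ≤ B
    linarith
  have h5 := mul_le_mul_of_nonneg_left hQ
    (by positivity : 0 ≤ 2 * ((p.m + E + 1) * (p.α + p.β)))
  have h6 := mul_le_mul_of_nonneg_left hW
    (by positivity : 0 ≤ 2 * ((p.α + p.β) * (E + 1) * B))
  linarith

/-! ### Compactness -/

/-- The ball of radius `√B` of `Ḣ¹`, as a set of coefficient sequences with the product topology. -/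
def sobolevBall (B : ℝ) : Set (ℤ → ℂ) := {u | u 0 = 0 ∧ ∀ K : Finset ℤ, qsum K 1 u ≤ B}

lemma sq_norm_le_of_mem {B : ℝ} {u : ℤ → ℂ} (hu : u ∈ sobolevBall B) (k : ℤ) :
    ‖u k‖ ^ 2 ≤ (|(k : ℝ)| * ‖u k‖) ^ 2 := by
  rcases eq_or_ne k 0 with rfl | hk
  · simp [hu.1]
  · have : 1 ≤ |(k : ℝ)| := by exact_mod_cast Int.one_le_abs hk
    exact pow_le_pow_left₀ (norm_nonneg _) (le_mul_of_one_le_left (norm_nonneg _) this) 2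

lemma isCompact_sobolevBall (B : ℝ) : IsCompact (sobolevBall B) := by
  have hcl : IsClosed (sobolevBall B) := by
    have : sobolevBall B = {u | u 0 = 0} ∩ ⋂ K : Finset ℤ, {u | qsum K 1 u ≤ B} := by
      ext u; simp [sobolevBall]
    rw [this]
    refine (isClosed_eq (by fun_prop) continuous_const).inter (isClosed_iInter fun K => ?_)
    have h : Continuous fun u : ℤ → ℂ => qsum K 1 u := by
      simp only [qsum]
      fun_prop
    exact isClosed_le h continuous_const
  refine (isCompact_univ_pi fun _ : ℤ => isCompact_closedBall (0 : ℂ) √B).of_isClosed_subset hcl ?_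
  intro u hu k _
  rw [mem_closedBall_zero_iff]
  refine Real.le_sqrt_of_sq_le ((sq_norm_le_of_mem hu k).trans ?_)
  simpa [qsum] using hu.2 {k}

lemma sum_sq_shift_le {B : ℝ} {u : ℤ → ℂ} (hu : u ∈ sobolevBall B) (k : ℤ) (K : Finset ℤ) :
    ∑ j ∈ K, (|((k - j : ℤ) : ℝ)| * ‖u (k - j)‖) ^ 2 ≤ B := by
  have h := hu.2 (K.image fun j => k - j)
  rw [qsum, Finset.sum_image fun x _ y _ h => by simpa using h] at h
  simpa using h

lemma summable_conv {B : ℝ} {u v : ℤ → ℂ} (hu : u ∈ sobolevBall B) (hv : v ∈ sobolevBall B)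
    (k : ℤ) : Summable fun j : ℤ => u (k - j) * (j * v j) := by
  refine Summable.of_norm (summable_of_sum_le (c := B) (fun _ => norm_nonneg _) fun K => ?_)
  have h1 := sum_sq_shift_le hu k K
  have h2 := hv.2 K
  have h3 : ∀ j ∈ K, ‖u (k - j) * (j * v j)‖ ≤
      1 / 2 * (|((k - j : ℤ) : ℝ)| * ‖u (k - j)‖) ^ 2 + 1 / 2 * (|(j : ℝ)| ^ 1 * ‖v j‖) ^ 2 := by
    intro j _
    rw [norm_mul, norm_mul, Complex.norm_intCast]
    have := sq_norm_le_of_mem hu (k - j)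
    nlinarith [sq_nonneg (‖u (k - j)‖ - |(j : ℝ)| * ‖v j‖)]
  refine (Finset.sum_le_sum h3).trans ?_
  rw [Finset.sum_add_distrib, ← Finset.mul_sum, ← Finset.mul_sum]
  change _ + 1 / 2 * qsum K 1 v ≤ B
  linarith

lemma norm_conv_sub_sum_le {B : ℝ} {u v : ℤ → ℂ} (hu : u ∈ sobolevBall B)
    (hv : v ∈ sobolevBall B) {k : ℤ} {J : ℕ} (hJ : 0 < J) (hkJ : 2 * |k| ≤ J) :
    ‖conv u v k - ∑ j ∈ Finset.Icc (-(J : ℤ)) J, u (k - j) * (j * v j)‖ ≤ 2 * B / J := by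
  have hJ' : (0 : ℝ) < J := by exact_mod_cast hJ
  have hlim := ((summable_conv hu hv k).hasSum.sub_const
    (∑ j ∈ Finset.Icc (-(J : ℤ)) J, u (k - j) * (j * v j))).norm
  refine le_of_tendsto hlim ?_
  filter_upwards [Filter.eventually_ge_atTop (Finset.Icc (-(J : ℤ)) J)] with K hK
  rw [← Finset.sum_sdiff hK, add_sub_cancel_right]
  refine (norm_sum_le _ _).trans ?_
  have h1 := sum_sq_shift_le hu k (K \ Finset.Icc (-(J : ℤ)) J)
  have h2 := hv.2 (K \ Finset.Icc (-(J : ℤ)) J)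
  have h3 : ∀ j ∈ K \ Finset.Icc (-(J : ℤ)) J, ‖u (k - j) * (j * v j)‖ ≤
      1 / J * ((|((k - j : ℤ) : ℝ)| * ‖u (k - j)‖) ^ 2 + (|(j : ℝ)| ^ 1 * ‖v j‖) ^ 2) := by
    intro j hj
    rw [Finset.mem_sdiff, Finset.mem_Icc] at hj
    have hj2 : (J : ℤ) ≤ 2 * |k - j| := by
      rcases abs_cases k with ⟨_, _⟩ | ⟨_, _⟩ <;> rcases abs_cases (k - j) with ⟨_, _⟩ | ⟨_, _⟩ <;>
        omega
    have hj3 : (J : ℝ) ≤ 2 * |((k - j : ℤ) : ℝ)| := by exact_mod_cast hj2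
    rw [norm_mul, norm_mul, Complex.norm_intCast, one_div, inv_mul_eq_div, le_div_iff₀ hJ']
    have h := mul_le_mul_of_nonneg_left hj3
      (by positivity : 0 ≤ ‖u (k - j)‖ * (|(j : ℝ)| * ‖v j‖))
    nlinarith [sq_nonneg (|((k - j : ℤ) : ℝ)| * ‖u (k - j)‖ - |(j : ℝ)| * ‖v j‖)]
  refine (Finset.sum_le_sum h3).trans ?_
  rw [← Finset.mul_sum, Finset.sum_add_distrib, one_div, inv_mul_eq_div]
  refine div_le_div_of_nonneg_right ?_ hJ'.le
  change _ + qsum _ 1 v ≤ _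
  linarith

lemma continuousOn_conv (B : ℝ) (k : ℤ) :
    ContinuousOn (fun q : (ℤ → ℂ) × (ℤ → ℂ) => conv q.1 q.2 k)
      (sobolevBall B ×ˢ sobolevBall B) := by
  have h : TendstoUniformlyOn
      (fun (J : ℕ) (q : (ℤ → ℂ) × (ℤ → ℂ)) =>
        ∑ j ∈ Finset.Icc (-(J : ℤ)) J, q.1 (k - j) * (j * q.2 j))
      (fun q => conv q.1 q.2 k) atTop (sobolevBall B ×ˢ sobolevBall B) := by
    rw [Metric.tendstoUniformlyOn_iff]
    intro ε hε
    have hl : Tendsto (fun J : ℕ => 2 * B / (J : ℝ)) atTop (𝓝 0) :=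
      tendsto_const_div_atTop_nhds_zero_nat _
    filter_upwards [hl.eventually_lt_const hε, Filter.eventually_gt_atTop 0,
      Filter.eventually_ge_atTop (2 * |k|).toNat] with J h1 h2 h3 q hq
    rw [dist_eq_norm]
    exact (norm_conv_sub_sum_le hq.1 hq.2 h2 (by omega)).trans_lt h1
  refine h.continuousOn (Filter.Eventually.frequently (Filter.Eventually.of_forall fun J => ?_))
  fun_prop

lemma combination_mem_sobolevBall {B α β : ℝ} {u v : ℤ → ℂ} (hu : u ∈ sobolevBall B)
    (hv : v ∈ sobolevBall B) :
    (fun j => (α : ℂ) * u j + β * v j) ∈ sobolevBall (2 * α ^ 2 * B + 2 * β ^ 2 * B) := by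
  refine ⟨by simp [hu.1, hv.1], fun K => ?_⟩
  have h : qsum K 1 (fun j => (α : ℂ) * u j + β * v j)
      ≤ 2 * α ^ 2 * qsum K 1 u + 2 * β ^ 2 * qsum K 1 v := by
    rw [qsum, qsum, qsum, Finset.mul_sum, Finset.mul_sum, ← Finset.sum_add_distrib]
    refine Finset.sum_le_sum fun k _ => ?_
    have h1 : ‖(α : ℂ) * u k + β * v k‖ ≤ |α| * ‖u k‖ + |β| * ‖v k‖ := by
      refine (norm_add_le _ _).trans (le_of_eq ?_)
      simp
    have h2 : ‖(α : ℂ) * u k + β * v k‖ ^ 2 ≤ 2 * α ^ 2 * ‖u k‖ ^ 2 + 2 * β ^ 2 * ‖v k‖ ^ 2 := by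
      have := pow_le_pow_left₀ (norm_nonneg _) h1 2
      rw [← sq_abs α, ← sq_abs β]
      nlinarith [sq_nonneg (|α| * ‖u k‖ - |β| * ‖v k‖)]
    have h3 := mul_le_mul_of_nonneg_left h2 (by positivity : 0 ≤ (|(k : ℝ)| ^ 1) ^ 2)
    simp only [mul_pow] at h3 ⊢
    linarith
  have h1 := mul_le_mul_of_nonneg_left (hu.2 K) (by positivity : 0 ≤ 2 * α ^ 2)
  have h2 := mul_le_mul_of_nonneg_left (hv.2 K) (by positivity : 0 ≤ 2 * β ^ 2)
  linarith

lemma sobolevBall_mono {B B' : ℝ} (h : B ≤ B') : sobolevBall B ⊆ sobolevBall B' :=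
  fun _ hu => ⟨hu.1, fun K => (hu.2 K).trans h⟩

lemma continuousOn_rhs (m α β B : ℝ) (k : ℤ) :
    ContinuousOn (fun q : (ℤ → ℂ) × (ℤ → ℂ) => rhs m α β q.1 q.2 k)
      (sobolevBall B ×ˢ sobolevBall B) := by
  have h : ContinuousOn (fun q : (ℤ → ℂ) × (ℤ → ℂ) =>
      conv q.1 (fun j => (α : ℂ) * q.1 j + β * q.2 j) k) (sobolevBall B ×ˢ sobolevBall B) := by
    refine ContinuousOn.comp (t := sobolevBall (max B (2 * α ^ 2 * B + 2 * β ^ 2 * B)) ×ˢ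
      sobolevBall (max B (2 * α ^ 2 * B + 2 * β ^ 2 * B)))
      (g := fun q : (ℤ → ℂ) × (ℤ → ℂ) => conv q.1 q.2 k)
      (f := fun q : (ℤ → ℂ) × (ℤ → ℂ) => (q.1, fun j => (α : ℂ) * q.1 j + β * q.2 j))
      (continuousOn_conv _ k) (by fun_prop) fun q hq => ?_
    exact ⟨sobolevBall_mono (le_max_left _ _) hq.1,
      sobolevBall_mono (le_max_right _ _) (combination_mem_sobolevBall hq.1 hq.2)⟩
  unfold rhs
  fun_prop

/-! ### Passage to the limit -/

/-- Pointwise convergence of equi-Lipschitz functions on `[0, T]` is uniform. -/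
lemma tendstoUniformlyOn_of_lipschitz {ι : Type*} {l : Filter ι} [l.NeBot] {F : ι → ℝ → ℂ}
    {G : ℝ → ℂ} {T L : ℝ} (hL0 : 0 ≤ L)
    (hL : ∀ᶠ n in l, ∀ s ∈ Icc 0 T, ∀ t ∈ Icc 0 T, ‖F n t - F n s‖ ≤ L * |t - s|)
    (h : ∀ t ∈ Icc 0 T, Tendsto (fun n => F n t) l (𝓝 (G t))) :
    TendstoUniformlyOn F G l (Icc 0 T) := by
  have hG : ∀ s ∈ Icc 0 T, ∀ t ∈ Icc 0 T, ‖G t - G s‖ ≤ L * |t - s| := fun s hs t ht =>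
    le_of_tendsto ((h t ht).sub (h s hs)).norm (hL.mono fun n hn => hn s hs t ht)
  rw [Metric.tendstoUniformlyOn_iff]
  intro ε hε
  obtain ⟨A, hA, hAf, hcov⟩ := (isCompact_Icc (a := (0 : ℝ)) (b := T)).finite_cover_balls
    (e := ε / (3 * (L + 1))) (by positivity)
  have hev : ∀ᶠ n in l, ∀ s ∈ A, dist (F n s) (G s) < ε / 3 :=
    (Filter.eventually_all_finite hAf).2 fun s hs =>
      (h s (hA hs)).eventually (Metric.ball_mem_nhds _ (by positivity))
  filter_upwards [hL, hev] with n h1 h2 t ht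
  obtain ⟨s, hs, hts⟩ := mem_iUnion₂.1 (hcov ht)
  rw [Metric.mem_ball, Real.dist_eq] at hts
  have h3 : L * |t - s| < ε / 3 := by
    calc L * |t - s| ≤ (L + 1) * |t - s| := by
          exact mul_le_mul_of_nonneg_right (by linarith) (abs_nonneg _)
      _ < (L + 1) * (ε / (3 * (L + 1))) := mul_lt_mul_of_pos_left hts (by positivity)
      _ = ε / 3 := by field_simp
  have h4 := h1 s (hA hs) t ht
  have h5 := hG s (hA hs) t ht
  have h6 := h2 s hs
  rw [dist_eq_norm] at h6 ⊢
  calc ‖G t - F n t‖ = ‖(G t - G s) - (F n s - G s) - (F n t - F n s)‖ := by congr 1; ring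
    _ ≤ ‖G t - G s‖ + ‖F n s - G s‖ + ‖F n t - F n s‖ :=
      (norm_sub_le _ _).trans (add_le_add_left (norm_sub_le _ _) _)
    _ < ε := by linarith

lemma tendsto_integral_of_tendstoUniformlyOn {ι : Type*} {l : Filter ι} [l.NeBot]
    {u : ι → ℝ → ℝ} {v : ℝ → ℝ} {T : ℝ} (hT : 0 ≤ T)
    (hu : ∀ᶠ n in l, ContinuousOn (u n) (Icc 0 T)) (h : TendstoUniformlyOn u v l (Icc 0 T)) :
    Tendsto (fun n => ∫ s in (0)..T, u n s) l (𝓝 (∫ s in (0)..T, v s)) := by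
  have hv : ContinuousOn v (Icc 0 T) := h.continuousOn hu.frequently
  rw [Metric.tendsto_nhds]
  intro ε hε
  rw [Metric.tendstoUniformlyOn_iff] at h
  filter_upwards [hu, h (ε / (T + 1)) (by positivity)] with n h1 h2
  have h3 := intervalIntegral.norm_integral_le_of_norm_le_const (a := 0) (b := T)
    (f := fun s => u n s - v s) (C := ε / (T + 1)) (fun s hs => by
      rw [uIoc_of_le hT] at hs
      have := (h2 s (Ioc_subset_Icc_self hs)).le
      rwa [dist_comm, dist_eq_norm] at this)
  rw [intervalIntegral.integral_sub (h1.intervalIntegrable_of_Icc hT)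
    (hv.intervalIntegrable_of_Icc hT), sub_zero, abs_of_nonneg hT] at h3
  rw [dist_eq_norm]
  refine h3.trans_lt ?_
  rw [div_mul_eq_mul_div, div_lt_iff₀ (by positivity)]
  nlinarith

lemma tendstoUniformlyOn_pi {ι α κ β : Type*} [UniformSpace β] {l : Filter ι}
    {F : ι → α → κ → β} {G : α → κ → β} {s : Set α}
    (h : ∀ k, TendstoUniformlyOn (fun n t => F n t k) (fun t => G t k) l s) :
    TendstoUniformlyOn F G l s := by
  rw [tendstoUniformlyOn_iff_tendsto, Pi.uniformity, tendsto_iInf]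
  intro k
  rw [tendsto_comap_iff]
  exact tendstoUniformlyOn_iff_tendsto.1 (h k)

/-- The frequencies `0 < |k| ≤ N`. -/
def freq (N : ℕ) : Finset ℤ := (Finset.Icc (-(N : ℤ)) N).erase 0

lemma mem_freq {N : ℕ} {k : ℤ} : k ∈ freq N ↔ k ≠ 0 ∧ -(N : ℤ) ≤ k ∧ k ≤ N := by simp [freq]

lemma zero_notMem_freq (N : ℕ) : (0 : ℤ) ∉ freq N := by simp [freq]

lemma neg_mem_freq (N : ℕ) (k : ℤ) : k ∈ freq N ↔ -k ∈ freq N := by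
  simp only [mem_freq]; omega

lemma eventually_subset_freq {K : Finset ℤ} (hK : (0 : ℤ) ∉ K) :
    ∀ᶠ N in atTop, K ⊆ freq N := by
  filter_upwards [eventually_ge_atTop (K.sup Int.natAbs)] with N hN k hk
  have h1 := (Finset.le_sup (f := Int.natAbs) hk).trans hN
  have h2 : k ≠ 0 := fun h => hK (h ▸ hk)
  rw [mem_freq]
  omega

/-- A family `(f, g)` of coefficient functions that is the pointwise limit, along the filter `l`,
of a sequence of Galerkin solutions satisfying uniform bounds.  The `N`-th one has the frequencies
`0 < |k| ≤ N` and lives on `[0, N]`, hence eventually on each bounded interval.  The limit is extended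
to negative times by its initial value, which makes it continuous on `ℝ`. -/
structure GalerkinLimit (p : Coeffs) (E W B Q : ℝ) (l : Filter ℕ) (u v : ℕ → ℝ → ℤ → ℂ)
    (f g : ℝ → ℤ → ℂ) : Prop where
  le_atTop : l ≤ atTop
  galerkin : ∀ N, IsGalerkin p (freq N) N (fun _ => 1) (u N) (v N)
  wiener : ∀ N : ℕ, ∀ t ∈ Icc 0 (N : ℝ), wsum (freq N) 0 (u N t) + wsum (freq N) 0 (v N t) ≤ E
  wiener_int : ∀ N : ℕ, ∀ t ∈ Icc 0 (N : ℝ),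
    ∫ s in (0)..t, (wsum (freq N) 2 (u N s) + wsum (freq N) 2 (v N s)) ≤ W
  sobolev : ∀ N : ℕ, ∀ t ∈ Icc 0 (N : ℝ), qsum (freq N) 1 (u N t) + qsum (freq N) 1 (v N t) ≤ B
  sobolev_int : ∀ N : ℕ, ∀ t ∈ Icc 0 (N : ℝ),
    ∫ s in (0)..t, (qsum (freq N) 2 (u N s) + qsum (freq N) 2 (v N s)) ≤ Q
  tendsto_u : ∀ t k, Tendsto (fun N => u N (max t 0) k) l (𝓝 (f t k))
  tendsto_v : ∀ t k, Tendsto (fun N => v N (max t 0) k) l (𝓝 (g t k))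

namespace GalerkinLimit

variable {p : Coeffs} {E W B Q : ℝ} {l : Filter ℕ} {u v : ℕ → ℝ → ℤ → ℂ}
  {f g : ℝ → ℤ → ℂ}

lemma swap (H : GalerkinLimit p E W B Q l u v f g) : GalerkinLimit p.swap E W B Q l v u g f where
  le_atTop := H.le_atTop
  galerkin N := (H.galerkin N).swap
  wiener N t ht := by rw [add_comm]; exact H.wiener N t ht
  wiener_int N t ht := by simp_rw [add_comm (wsum _ _ (v N _))]; exact H.wiener_int N t ht
  sobolev N t ht := by rw [add_comm]; exact H.sobolev N t ht
  sobolev_int N t ht := by simp_rw [add_comm (qsum _ _ (v N _))]; exact H.sobolev_int N t ht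
  tendsto_u := H.tendsto_v
  tendsto_v := H.tendsto_u

lemma u_mem (H : GalerkinLimit p E W B Q l u v f g) {N : ℕ} {t : ℝ} (ht : t ∈ Icc 0 (N : ℝ)) :
    u N t ∈ sobolevBall B := by
  refine ⟨(H.galerkin N).f_support t 0 (zero_notMem_freq N), fun K => ?_⟩
  have h1 : qsum K 1 (u N t) ≤ qsum (freq N) 1 (u N t) :=
    sum_le_sum_of_support (fun k => by positivity)
      fun k hk => by simp [(H.galerkin N).f_support t k hk]
  linarith [H.sobolev N t ht, qsum_nonneg (freq N) 1 (v N t)]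

lemma eventually_mem_Icc (H : GalerkinLimit p E W B Q l u v f g) (T : ℝ) :
    ∀ᶠ N : ℕ in l, T ≤ N :=
  (tendsto_natCast_atTop_atTop.mono_left H.le_atTop).eventually_ge_atTop T

lemma eventually_subset (H : GalerkinLimit p E W B Q l u v f g) {K : Finset ℤ}
    (hK : (0 : ℤ) ∉ K) : ∀ᶠ N : ℕ in l, K ⊆ freq N :=
  H.le_atTop (eventually_subset_freq hK)

variable [l.NeBot]

lemma f_mem (H : GalerkinLimit p E W B Q l u v f g) (t : ℝ) : f t ∈ sobolevBall B :=
  (isCompact_sobolevBall B).isClosed.mem_of_tendsto (tendsto_pi_nhds.2 (H.tendsto_u t))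
    ((H.eventually_mem_Icc (max t 0)).mono fun _ hN => H.u_mem ⟨le_max_right _ _, hN⟩)

lemma mem (H : GalerkinLimit p E W B Q l u v f g) (t : ℝ) :
    (f t, g t) ∈ sobolevBall B ×ˢ sobolevBall B := ⟨H.f_mem t, H.swap.f_mem t⟩

/-- The coefficients converge locally uniformly in time: the right-hand side is bounded on the
compact `sobolevBall`, so that each of them is Lipschitz uniformly in `N`. -/
lemma tendstoUniformlyOn_u (H : GalerkinLimit p E W B Q l u v f g) (T : ℝ) :
    TendstoUniformlyOn u f l (Icc 0 T) := by
  refine tendstoUniformlyOn_pi fun k => ?_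
  obtain ⟨L, hL⟩ := (((isCompact_sobolevBall B).prod (isCompact_sobolevBall B)).image_of_continuousOn
    (continuousOn_rhs p.m p.α p.β B k)).isBounded.exists_norm_le
  have hL0 : 0 ≤ L := (norm_nonneg _).trans (hL _ (mem_image_of_mem _ (H.mem 0)))
  refine tendstoUniformlyOn_of_lipschitz hL0 ?_ fun t ht => by
    simpa [max_eq_left ht.1] using H.tendsto_u t k
  filter_upwards [H.eventually_mem_Icc T] with N hN s hs t ht
  have hsub : Icc 0 T ⊆ Icc 0 (N : ℝ) := Icc_subset_Icc_right hN
  by_cases hk : k ∈ freq N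
  · have := (convex_Icc (0 : ℝ) T).norm_image_sub_le_of_norm_hasDerivWithin_le (C := L)
      (f := fun t => u N t k)
      (fun x hx => ((H.galerkin N).f_hasDeriv (hsub hx) hk).mono hsub)
      (fun x hx => hL _ ⟨(u N x, v N x), ⟨H.u_mem (hsub hx), H.swap.u_mem (hsub hx)⟩, rfl⟩) hs ht
    simpa using this
  · rw [(H.galerkin N).f_support _ k hk, (H.galerkin N).f_support _ k hk]
    simpa using mul_nonneg hL0 (abs_nonneg (t - s))

lemma tendstoUniformlyOn_comp (H : GalerkinLimit p E W B Q l u v f g) (T : ℝ) {γ : Type*}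
    [UniformSpace γ] {Φ : (ℤ → ℂ) × (ℤ → ℂ) → γ}
    (hΦ : ContinuousOn Φ (sobolevBall B ×ˢ sobolevBall B)) :
    TendstoUniformlyOn (fun N t => Φ (u N t, v N t)) (fun t => Φ (f t, g t)) l (Icc 0 T) := by
  have hK := (isCompact_sobolevBall B).prod (isCompact_sobolevBall B)
  have h := (H.tendstoUniformlyOn_u T).prodMk (H.swap.tendstoUniformlyOn_u T)
  have h2 : TendstoUniformlyOn (fun N t => (u N t, v N t)) (fun t => (f t, g t)) l (Icc 0 T) := by
    rw [tendstoUniformlyOn_iff_tendsto] at *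
    exact h.comp ((tendsto_fst.prodMk tendsto_fst).prodMk tendsto_snd)
  refine UniformContinuousOn.comp_tendstoUniformlyOn_eventually ?_ (fun t _ => H.mem t)
    (hK.uniformContinuousOn_of_continuous hΦ) h2
  filter_upwards [H.eventually_mem_Icc T] with N hN t ht
  have ht' : t ∈ Icc 0 (N : ℝ) := ⟨ht.1, ht.2.trans hN⟩
  exact ⟨H.u_mem ht', H.swap.u_mem ht'⟩

lemma continuous_f (H : GalerkinLimit p E W B Q l u v f g) : Continuous f := by
  have h1 : ContinuousOn f (Ici 0) := by
    intro t ht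
    have h2 : ContinuousOn f (Icc 0 (t + 1)) :=
      (H.tendstoUniformlyOn_u (t + 1)).continuousOn (Filter.Eventually.frequently
        ((H.eventually_mem_Icc (t + 1)).mono fun N hN => continuousOn_pi.2 fun k =>
          ((H.galerkin N).f_continuousOn k).mono (Icc_subset_Icc_right hN)))
    exact (h2 t ⟨ht, by linarith⟩).mono_of_mem_nhdsWithin
      (inter_mem_nhdsWithin _ (Iic_mem_nhds (lt_add_one t)))
  have h3 : f = fun t => f (max t 0) := by
    ext t k
    exact tendsto_nhds_unique (H.tendsto_u t k) (by simpa using H.tendsto_u (max t 0) k)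
  rw [h3]
  exact h1.comp_continuous (by fun_prop) fun t => mem_Ici.2 (le_max_right _ _)

lemma continuous_comp (H : GalerkinLimit p E W B Q l u v f g) {γ : Type*}
    [TopologicalSpace γ] {Φ : (ℤ → ℂ) × (ℤ → ℂ) → γ}
    (hΦ : ContinuousOn Φ (sobolevBall B ×ˢ sobolevBall B)) :
    Continuous fun t => Φ (f t, g t) :=
  hΦ.comp_continuous (H.continuous_f.prodMk H.swap.continuous_f) H.mem

lemma tendsto_comp (H : GalerkinLimit p E W B Q l u v f g) {γ : Type*}
    [UniformSpace γ] {Φ : (ℤ → ℂ) × (ℤ → ℂ) → γ}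
    (hΦ : ContinuousOn Φ (sobolevBall B ×ˢ sobolevBall B)) {t : ℝ} (ht : 0 ≤ t) :
    Tendsto (fun N => Φ (u N t, v N t)) l (𝓝 (Φ (f t, g t))) :=
  (H.tendstoUniformlyOn_comp t hΦ).tendsto_at ⟨ht, le_rfl⟩

lemma tendsto_integral (H : GalerkinLimit p E W B Q l u v f g) {Φ : (ℤ → ℂ) × (ℤ → ℂ) → ℝ}
    (hΦ : ContinuousOn Φ (sobolevBall B ×ˢ sobolevBall B)) {t : ℝ} (ht : 0 ≤ t) :
    Tendsto (fun N => ∫ s in (0)..t, Φ (u N s, v N s)) l (𝓝 (∫ s in (0)..t, Φ (f s, g s))) := by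
  refine tendsto_integral_of_tendstoUniformlyOn ht ?_ (H.tendstoUniformlyOn_comp t hΦ)
  filter_upwards [H.eventually_mem_Icc t] with N hN
  have hsub : Icc 0 t ⊆ Icc 0 (N : ℝ) := Icc_subset_Icc_right hN
  refine hΦ.comp (t := sobolevBall B ×ˢ sobolevBall B) (f := fun s => (u N s, v N s)) ?_
    fun s hs => ⟨H.u_mem (hsub hs), H.swap.u_mem (hsub hs)⟩
  exact ((continuousOn_pi.2 (H.galerkin N).f_continuousOn).prodMk
    (continuousOn_pi.2 (H.galerkin N).g_continuousOn)).mono hsub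

/-- The limit solves the system. -/
theorem hasDerivAt (H : GalerkinLimit p E W B Q l u v f g) {t : ℝ} (ht : 0 < t) (k : ℤ) :
    HasDerivAt (fun s => f s k) (rhs p.m p.α p.β (f t) (g t) k) t := by
  rcases eq_or_ne k 0 with rfl | hk
  · have : ∀ s, f s 0 = 0 := fun s => (H.f_mem s).1
    simp only [this]
    simpa [rhs] using hasDerivAt_const t (0 : ℂ)
  · refine hasDerivAt_of_tendstoUniformlyOn (l := l) (s := Ioo 0 (t + 1)) isOpen_Ioo
      (f := fun N s => u N s k) (f' := fun N s => rhs p.m p.α p.β (u N s) (v N s) k)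
      (g' := fun s => rhs p.m p.α p.β (f s) (g s) k)
      ((H.tendstoUniformlyOn_comp (t + 1) (continuousOn_rhs p.m p.α p.β B k)).mono
        Ioo_subset_Icc_self) ?_ (fun s hs => by simpa [max_eq_left hs.1.le] using H.tendsto_u s k)
      ⟨ht, by linarith⟩
    filter_upwards [H.eventually_mem_Icc (t + 1), H.eventually_subset (K := {k})
      (by simpa using hk.symm)] with N hN hkN s hs
    have hs' : s ∈ Ioo 0 (N : ℝ) := ⟨hs.1, hs.2.trans_le hN⟩
    exact ((H.galerkin N).f_hasDeriv (Ioo_subset_Icc_self hs') (hkN (by simp))).hasDerivAt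
      (Icc_mem_nhds hs'.1 hs'.2)

end GalerkinLimit

/-! ### Global solutions in terms of Fourier coefficients -/

/-- Families `t ↦ (û(t, k))_k` of Fourier coefficients, of real functions with zero mean, that are
bounded in the Wiener algebra and in `Ḣ¹` and integrable in time with two more derivatives in the
former and one more in the latter.  All sums are over finite sets `K`, which avoids the values of
divergent series. -/
structure IsProfile (E C : ℝ) (u : ℝ → ℤ → ℂ) : Prop where
  zero : ∀ t, u t 0 = 0
  conj_neg : ∀ t k, u t (-k) = conj (u t k)
  continuous : ∀ k, Continuous fun t => u t k
  wiener : ∀ t K, wsum K 0 (u t) ≤ E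
  wiener_int : ∀ T, 0 ≤ T → ∀ K, ∫ s in (0)..T, wsum K 2 (u s) ≤ C
  sobolev : ∀ t K, qsum K 1 (u t) ≤ C
  sobolev_int : ∀ T, 0 ≤ T → ∀ K, ∫ s in (0)..T, qsum K 2 (u s) ≤ C
  sup : ∀ (K : Finset ℤ) (τ : ℤ → ℝ), ∑ k ∈ K, (|(k : ℝ)| * ‖u (τ k) k‖) ^ 2 ≤ C

lemma IsProfile.mono {E C C' : ℝ} {u : ℝ → ℤ → ℂ} (h : IsProfile E C u) (hC : C ≤ C') :
    IsProfile E C' u :=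
  ⟨h.zero, h.conj_neg, h.continuous, h.wiener, fun T hT K => (h.wiener_int T hT K).trans hC,
    fun t K => (h.sobolev t K).trans hC, fun T hT K => (h.sobolev_int T hT K).trans hC,
    fun K τ => (h.sup K τ).trans hC⟩

lemma Coeffs.Good.swap {p : Coeffs} {E σ κ : ℝ} (hp : p.Good E σ κ) : p.swap.Good E σ κ where
  m_nonneg := hp.n_nonneg
  n_nonneg := hp.m_nonneg
  α_nonneg := hp.α'_nonneg
  β_nonneg := hp.β'_nonneg
  α'_nonneg := hp.α_nonneg
  β'_nonneg := hp.β_nonneg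
  E_nonneg := hp.E_nonneg
  σ_pos := hp.σ_pos
  κ_pos := hp.κ_pos
  wiener_f := hp.wiener_g
  wiener_g := hp.wiener_f
  sobolev_f := by have := hp.sobolev_g; simp only [Coeffs.swap]; linarith
  sobolev_g := by have := hp.sobolev_f; simp only [Coeffs.swap]; linarith

lemma wsum_le_of_support {S K : Finset ℤ} {u : ℤ → ℂ} (hu : ∀ k ∉ S, u k = 0) (i : ℕ) :
    wsum K i u ≤ wsum S i u :=
  sum_le_sum_of_support (fun k => by positivity) (weight_support hu i)

lemma qsum_le_of_support {S K : Finset ℤ} {u : ℤ → ℂ} (hu : ∀ k ∉ S, u k = 0) (i : ℕ) :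
    qsum K i u ≤ qsum S i u :=
  sum_le_sum_of_support (fun k => by positivity) fun k hk => by simp [hu k hk]

lemma continuous_wsum (K : Finset ℤ) (i : ℕ) : Continuous fun u : ℤ → ℂ => wsum K i u := by
  simp only [wsum]; fun_prop

lemma continuous_qsum (K : Finset ℤ) (i : ℕ) : Continuous fun u : ℤ → ℂ => qsum K i u := by
  simp only [qsum]; fun_prop

namespace GalerkinLimit

variable {p : Coeffs} {E σ κ W B Q : ℝ} {l : Filter ℕ} {u v : ℕ → ℝ → ℤ → ℂ}
  {f g : ℝ → ℤ → ℂ} [l.NeBot]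

lemma integral_wsum_le (H : GalerkinLimit p E W B Q l u v f g) {T : ℝ} (hT : 0 ≤ T)
    (K : Finset ℤ) : ∫ s in (0)..T, wsum K 2 (f s) ≤ W := by
  have hΦ := continuous_wsum K 2
  refine le_of_tendsto (H.tendsto_integral (Φ := fun q => wsum K 2 q.1)
    (by fun_prop) hT) ?_
  filter_upwards [H.eventually_mem_Icc T] with N hN
  refine le_trans ?_ (H.wiener_int N T ⟨hT, hN⟩)
  have hsub : Icc 0 T ⊆ Icc 0 (N : ℝ) := Icc_subset_Icc_right hN
  have hu := (H.galerkin N).f_continuousOn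
  have hv := (H.galerkin N).g_continuousOn
  refine intervalIntegral.integral_mono_on hT
    ((continuousOn_wsum hu).mono hsub |>.intervalIntegrable_of_Icc hT)
    (((continuousOn_wsum hu).add (continuousOn_wsum hv)).mono hsub |>.intervalIntegrable_of_Icc hT)
    fun s _ => ?_
  have := wsum_le_of_support (K := K) ((H.galerkin N).f_support s) 2
  have := wsum_nonneg (freq N) 2 (v N s)
  linarith

lemma integral_qsum_le (H : GalerkinLimit p E W B Q l u v f g) {T : ℝ} (hT : 0 ≤ T)
    (K : Finset ℤ) : ∫ s in (0)..T, qsum K 2 (f s) ≤ Q := by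
  have hΦ := continuous_qsum K 2
  refine le_of_tendsto (H.tendsto_integral (Φ := fun q => qsum K 2 q.1)
    (by fun_prop) hT) ?_
  filter_upwards [H.eventually_mem_Icc T] with N hN
  refine le_trans ?_ (H.sobolev_int N T ⟨hT, hN⟩)
  have hsub : Icc 0 T ⊆ Icc 0 (N : ℝ) := Icc_subset_Icc_right hN
  have hu := (H.galerkin N).f_continuousOn
  have hv := (H.galerkin N).g_continuousOn
  refine intervalIntegral.integral_mono_on hT
    ((continuousOn_qsum hu).mono hsub |>.intervalIntegrable_of_Icc hT)
    (((continuousOn_qsum hu).add (continuousOn_qsum hv)).mono hsub |>.intervalIntegrable_of_Icc hT)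
    fun s _ => ?_
  have := qsum_le_of_support (K := K) ((H.galerkin N).f_support s) 2
  have := qsum_nonneg (freq N) 2 (v N s)
  linarith

lemma sum_sq_le (H : GalerkinLimit p E W B Q l u v f g) (hp : p.Good E σ κ) (K : Finset ℤ)
    (τ : ℤ → ℝ) : ∑ k ∈ K, (|(k : ℝ)| * ‖f (τ k) k‖) ^ 2 ≤
      B + 2 * ((p.m + E + 1) * (p.α + p.β) * Q + (p.α + p.β) * (E + 1) * B * W) := by
  have hlim : Tendsto (fun N => ∑ k ∈ K, (|(k : ℝ)| * ‖u N (max (τ k) 0) k‖) ^ 2) l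
      (𝓝 (∑ k ∈ K, (|(k : ℝ)| * ‖f (τ k) k‖) ^ 2)) :=
    tendsto_finsetSum _ fun k _ => ((H.tendsto_u (τ k) k).norm.const_mul _).pow 2
  refine le_of_tendsto hlim ?_
  have hev : ∀ᶠ N : ℕ in l, ∀ k ∈ K, max (τ k) 0 ≤ (N : ℝ) :=
    (Filter.eventually_all_finset K).2 fun k _ => H.eventually_mem_Icc _
  filter_upwards [hev] with N hN
  have hN0 : (0 : ℝ) ≤ N := N.cast_nonneg
  have h := (H.galerkin N).sum_sq_le hp (zero_notMem_freq N) hN0 (H.wiener N) (H.sobolev N)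
    (H.wiener_int N N ⟨hN0, le_rfl⟩) (H.sobolev_int N N ⟨hN0, le_rfl⟩)
    (τ := fun k => min (max (τ k) 0) N) fun k => ⟨le_min (le_max_right _ _) hN0, min_le_right _ _⟩
  refine le_trans ?_ h
  refine le_trans (le_of_eq (Finset.sum_congr rfl fun k hk => ?_))
    (sum_le_sum_of_support (K := K) (fun k => by positivity) fun k hk => by
      simp [(H.galerkin N).f_support _ k hk])
  rw [min_eq_left (hN k hk)]

lemma sum_integral_norm_rhs_le (H : GalerkinLimit p E W B Q l u v f g) (hp : p.Good E σ κ)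
    {T : ℝ} (hT : 0 ≤ T) (K : Finset ℤ) :
    ∑ k ∈ K, ∫ s in (0)..T, ‖rhs p.m p.α p.β (f s) (g s) k‖ ≤
      (p.m + 2 * E) * (p.α + p.β) * W := by
  have hm := hp.m_nonneg
  have hα := hp.α_nonneg
  have hβ := hp.β_nonneg
  have hE := hp.E_nonneg
  have hc : ∀ k, Continuous fun s => ‖rhs p.m p.α p.β (f s) (g s) k‖ := fun k =>
    (H.continuous_comp (continuousOn_rhs p.m p.α p.β B k)).norm
  have h0 : ∑ k ∈ K, ∫ s in (0)..T, ‖rhs p.m p.α p.β (f s) (g s) k‖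
      = ∫ s in (0)..T, ∑ k ∈ K.erase 0, ‖rhs p.m p.α p.β (f s) (g s) k‖ := by
    rw [intervalIntegral.integral_finsetSum fun k _ => (hc k).intervalIntegrable _ _]
    exact (Finset.sum_erase K (by simp [rhs])).symm
  rw [h0]
  refine le_of_tendsto (H.tendsto_integral
    (Φ := fun q => ∑ k ∈ K.erase 0, ‖rhs p.m p.α p.β q.1 q.2 k‖)
    (continuousOn_finsetSum _ fun k _ => (continuousOn_rhs p.m p.α p.β B k).norm) hT) ?_
  filter_upwards [H.eventually_mem_Icc T, H.eventually_subset (K := K.erase 0) (by simp)]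
    with N hN hKN
  have hsub : Icc 0 T ⊆ Icc 0 (N : ℝ) := Icc_subset_Icc_right hN
  have hu := (H.galerkin N).f_continuousOn
  have hv := (H.galerkin N).g_continuousOn
  have hr : ∀ k, ContinuousOn (fun s => rhs p.m p.α p.β (u N s) (v N s) k) (Icc 0 T) := fun k => by
    simp only [rhs_eq]
    have := (continuousOn_remainder (m := p.m) (α := p.α) (β := p.β) hu hv
      (H.galerkin N).f_support (H.galerkin N).g_support k).mono hsub
    have := (hu k).mono hsub
    fun_prop
  have hw : IntervalIntegrable (fun s => wsum (freq N) 2 (u N s) + wsum (freq N) 2 (v N s))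
      volume 0 T :=
    ((continuousOn_wsum hu).add (continuousOn_wsum hv)).mono hsub |>.intervalIntegrable_of_Icc hT
  have h1 := intervalIntegral.integral_mono_on hT
    (f := fun s => ∑ k ∈ K.erase 0, ‖rhs p.m p.α p.β (u N s) (v N s) k‖)
    (g := fun s => (p.m + 2 * E) * (p.α + p.β) *
      (wsum (freq N) 2 (u N s) + wsum (freq N) 2 (v N s)))
    (ContinuousOn.intervalIntegrable_of_Icc hT (by fun_prop)) (hw.const_mul _) (fun s hs => by
      refine le_trans (Finset.sum_le_sum_of_subset_of_nonneg hKN fun _ _ _ => norm_nonneg _) ?_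
      exact sum_norm_rhs_le ((H.galerkin N).f_support s) ((H.galerkin N).g_support s) hm hα hβ
        (H.wiener N s (hsub hs)))
  rw [intervalIntegral.integral_const_mul] at h1
  exact h1.trans (mul_le_mul_of_nonneg_left (H.wiener_int N T ⟨hT, hN⟩) (by positivity))

/-- All bounds pass to the limit, since they concern finitely many frequencies at a time. -/
lemma isProfile (H : GalerkinLimit p E W B Q l u v f g) (hp : p.Good E σ κ)
    (hu : ∀ N : ℕ, ∀ t ∈ Icc 0 (N : ℝ), ∀ k, u N t (-k) = conj (u N t k)) :
    ∃ C, IsProfile E C f := by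
  refine ⟨max (max W B) (max Q
    (B + 2 * ((p.m + E + 1) * (p.α + p.β) * Q + (p.α + p.β) * (E + 1) * B * W))),
    fun t => (H.f_mem t).1, fun t k => ?_, fun k => (continuous_apply k).comp H.continuous_f,
    fun t K => ?_, fun T hT K => ?_, fun t K => ?_, fun T hT K => ?_, fun K τ => ?_⟩
  · refine tendsto_nhds_unique_of_eventuallyEq (H.tendsto_u t (-k))
      ((Complex.continuous_conj.tendsto _).comp (H.tendsto_u t k)) ?_
    filter_upwards [H.eventually_mem_Icc (max t 0)] with N hN
    exact hu N _ ⟨le_max_right _ _, hN⟩ k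
  · refine le_of_tendsto (((continuous_wsum K 0).tendsto (f t)).comp
      (tendsto_pi_nhds.2 (H.tendsto_u t))) ?_
    filter_upwards [H.eventually_mem_Icc (max t 0)] with N hN
    have h1 := H.wiener N (max t 0) ⟨le_max_right _ _, hN⟩
    have h2 := wsum_le_of_support (K := K) ((H.galerkin N).f_support (max t 0)) 0
    have h3 := wsum_nonneg (freq N) 0 (v N (max t 0))
    simp only [Function.comp_apply]
    change wsum K 0 (u N (max t 0)) ≤ E
    linarith
  · exact (H.integral_wsum_le hT K).trans ((le_max_left _ _).trans (le_max_left _ _))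
  · exact ((H.f_mem t).2 K).trans ((le_max_right _ _).trans (le_max_left _ _))
  · exact (H.integral_qsum_le hT K).trans ((le_max_left _ _).trans (le_max_right _ _))
  · exact (H.sum_sq_le hp K τ).trans ((le_max_right _ _).trans (le_max_right _ _))

end GalerkinLimit

/-- A global solution of the system, in terms of the Fourier coefficients `f`, `g` of the unknowns;
`a`, `c` are the coefficients of the initial data, `σ / 2` and `κ` the rates of decay in the Wiener
algebra and in `Ḣ¹`, and `M` is the bound for the energy in `Ḣ¹`.  The constant `C` collects the other
bounds, of which only the finiteness matters. -/
structure IsFourierSolution (p : Coeffs) (E σ κ M C : ℝ) (a c : ℤ → ℂ) (f g : ℝ → ℤ → ℂ) :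
    Prop where
  f_profile : IsProfile E C f
  g_profile : IsProfile E C g
  f_init : f 0 = a
  g_init : g 0 = c
  f_deriv : ∀ t, 0 < t → ∀ k, HasDerivAt (fun s => f s k) (rhs p.m p.α p.β (f t) (g t) k) t
  g_deriv : ∀ t, 0 < t → ∀ k, HasDerivAt (fun s => g s k) (rhs p.n p.α' p.β' (g t) (f t) k) t
  f_rhs_continuous : ∀ k, Continuous fun s => rhs p.m p.α p.β (f s) (g s) k
  g_rhs_continuous : ∀ k, Continuous fun s => rhs p.n p.α' p.β' (g s) (f s) k
  f_rhs_int : ∀ T, 0 ≤ T → ∀ K : Finset ℤ,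
    ∑ k ∈ K, ∫ s in (0)..T, ‖rhs p.m p.α p.β (f s) (g s) k‖ ≤ C
  g_rhs_int : ∀ T, 0 ≤ T → ∀ K : Finset ℤ,
    ∑ k ∈ K, ∫ s in (0)..T, ‖rhs p.n p.α' p.β' (g s) (f s) k‖ ≤ C
  decay : ∀ t, 0 ≤ t → ∀ K, Real.exp (σ / 2 * t) * (wsum K 0 (f t) + wsum K 0 (g t)) ≤ E
  energy : ∀ t, 0 ≤ t → ∀ K, Real.exp (κ * t) * (qsum K 1 (f t) + qsum K 1 (g t))
    + κ * ∫ s in (0)..t, (qsum K 2 (f s) + qsum K 2 (g s)) ≤ M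

/-- Global existence for small data, as the limit of Galerkin solutions along an ultrafilter. -/
theorem exists_fourierSolution {p : Coeffs} {E σ κ Y : ℝ} (hp : p.Good E σ κ) {a c : ℤ → ℂ}
    (a0 : a 0 = 0) (c0 : c 0 = 0)
    (ha : ∀ k, a (-k) = conj (a k)) (hc : ∀ k, c (-k) = conj (c k))
    (hac : ∀ K, wsum K 0 a + wsum K 0 c ≤ E) (hY : ∀ K, qsum K 1 a + qsum K 1 c ≤ Y) :
    ∃ (f g : ℝ → ℤ → ℂ) (C : ℝ),
      IsFourierSolution p E σ κ (p.sobolevBound E σ κ Y) C a c f g := by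
  have hσ := hp.σ_pos
  have hκ := hp.κ_pos
  choose u v huv u0 v0 ur vr dec wint en using fun N : ℕ => exists_galerkin hp (neg_mem_freq N)
    (zero_notMem_freq N) ha hc (hac (freq N)) (hY (freq N)) (N.cast_nonneg : (0 : ℝ) ≤ N)
  set M := p.sobolevBound E σ κ Y with hM
  have wE : ∀ N : ℕ, ∀ t ∈ Icc 0 (N : ℝ),
      wsum (freq N) 0 (u N t) + wsum (freq N) 0 (v N t) ≤ E := fun N t ht =>
    le_trans (le_mul_of_one_le_left (add_nonneg (wsum_nonneg _ _ _) (wsum_nonneg _ _ _))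
      (Real.one_le_exp (mul_nonneg (by positivity) ht.1))) (dec N t ht)
  have q2 : ∀ N : ℕ, ∀ t ∈ Icc 0 (N : ℝ),
      0 ≤ ∫ s in (0)..t, (qsum (freq N) 2 (u N s) + qsum (freq N) 2 (v N s)) := fun N t ht =>
    intervalIntegral.integral_nonneg ht.1 fun s _ =>
      add_nonneg (qsum_nonneg _ _ _) (qsum_nonneg _ _ _)
  have q1 : ∀ N : ℕ, ∀ t ∈ Icc 0 (N : ℝ), qsum (freq N) 1 (u N t) + qsum (freq N) 1 (v N t)
      ≤ Real.exp (κ * t) * (qsum (freq N) 1 (u N t) + qsum (freq N) 1 (v N t)) := fun N t ht =>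
    le_mul_of_one_le_left (add_nonneg (qsum_nonneg _ _ _) (qsum_nonneg _ _ _))
      (Real.one_le_exp (mul_nonneg hκ.le ht.1))
  have q0 : ∀ N : ℕ, ∀ t, 0 ≤ qsum (freq N) 1 (u N t) + qsum (freq N) 1 (v N t) := fun N t =>
    add_nonneg (qsum_nonneg _ _ _) (qsum_nonneg _ _ _)
  let l : Filter ℕ := (hyperfilter ℕ : Filter ℕ)
  have hl : l ≤ atTop := by rw [← Nat.cofinite_eq_atTop]; exact hyperfilter_le_cofinite
  have hev : ∀ T : ℝ, ∀ᶠ N : ℕ in l, T ≤ N := fun T =>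
    (tendsto_natCast_atTop_atTop.mono_left hl).eventually_ge_atTop T
  -- pointwise limits along an ultrafilter exist by compactness of discs
  have lim : ∀ w : ℕ → ℝ → ℤ → ℂ, (∀ N : ℕ, ∀ t ∈ Icc 0 (N : ℝ), ∀ k, ‖w N t k‖ ≤ E) →
      ∀ t k, ∃ z, Tendsto (fun N => w N (max t 0) k) l (𝓝 z) := by
    intro w hw t k
    have hmem : Metric.closedBall (0 : ℂ) E ∈
        ((hyperfilter ℕ).map fun N => w N (max t 0) k : Ultrafilter ℂ) := by
      change ∀ᶠ N in l, w N (max t 0) k ∈ Metric.closedBall (0 : ℂ) E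
      filter_upwards [hev (max t 0)] with N hN
      simpa using hw N _ ⟨le_max_right _ _, hN⟩ k
    obtain ⟨z, -, hz⟩ := (isCompact_closedBall (0 : ℂ) E).ultrafilter_le_nhds' _ hmem
    exact ⟨z, hz⟩
  have single : ∀ {S : Finset ℤ} {w : ℤ → ℂ}, (∀ k ∉ S, w k = 0) → ∀ k, ‖w k‖ ≤ wsum S 0 w := by
    intro S w hw k
    simpa [wsum] using wsum_le_of_support (K := {k}) hw 0
  choose f hf using lim u fun N t ht k => (single ((huv N).f_support t) k).trans
    (by linarith [wE N t ht, wsum_nonneg (freq N) 0 (v N t)])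
  choose g hg using lim v fun N t ht k => (single ((huv N).g_support t) k).trans
    (by linarith [wE N t ht, wsum_nonneg (freq N) 0 (u N t)])
  have H : GalerkinLimit p E (2 * E / σ) M (M / κ) l u v f g :=
    ⟨hl, huv, wE, wint, fun N t ht => by
      linarith [en N t ht, q1 N t ht, mul_nonneg hκ.le (q2 N t ht)], fun N t ht => by
      rw [le_div_iff₀ hκ]
      linarith [en N t ht, q1 N t ht, q0 N t], hf, hg⟩
  have init : ∀ (w : ℕ → ℝ → ℤ → ℂ) (h : ℝ → ℤ → ℂ) (d : ℤ → ℂ), d 0 = 0 →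
      (∀ N, ∀ k ∈ freq N, w N 0 k = d k) → (∀ N, w N 0 0 = 0) →
      (∀ t k, Tendsto (fun N => w N (max t 0) k) l (𝓝 (h t k))) → h 0 = d := by
    intro w h d d0 hw hw0 hlim
    ext k
    refine tendsto_nhds_unique_of_eventuallyEq (hlim 0 k) tendsto_const_nhds ?_
    rcases eq_or_ne k 0 with rfl | hk
    · exact Filter.Eventually.of_forall fun N => by simp [hw0, d0]
    · filter_upwards [hl (eventually_subset_freq (K := {k}) (by simpa using hk.symm))] with N hN
      simpa using hw N k (hN (by simp))
  obtain ⟨C₁, hC₁⟩ := H.isProfile hp ur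
  obtain ⟨C₂, hC₂⟩ := H.swap.isProfile hp.swap vr
  set C₃ := (p.m + 2 * E) * (p.α + p.β) * (2 * E / σ)
  set C₄ := (p.swap.m + 2 * E) * (p.swap.α + p.swap.β) * (2 * E / σ)
  refine ⟨f, g, max (max C₁ C₂) (max C₃ C₄), hC₁.mono ((le_max_left _ _).trans (le_max_left _ _)),
    hC₂.mono ((le_max_right _ _).trans (le_max_left _ _)),
    init u f a a0 u0 (fun N => (huv N).f_support 0 0 (zero_notMem_freq N)) hf,
    init v g c c0 v0 (fun N => (huv N).g_support 0 0 (zero_notMem_freq N)) hg,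
    fun t ht k => H.hasDerivAt ht k, fun t ht k => H.swap.hasDerivAt ht k,
    fun k => H.continuous_comp (continuousOn_rhs p.m p.α p.β M k),
    fun k => H.swap.continuous_comp (continuousOn_rhs p.n p.α' p.β' M k),
    fun T hT K => (H.sum_integral_norm_rhs_le hp hT K).trans
      ((le_max_left _ _).trans (le_max_right _ _)),
    fun T hT K => (H.swap.sum_integral_norm_rhs_le hp.swap hT K).trans
      ((le_max_right _ _).trans (le_max_right _ _)), fun t ht K => ?_, fun t ht K => ?_⟩
  · have hw := continuous_wsum K 0
    refine le_of_tendsto (H.tendsto_comp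
      (Φ := fun q => Real.exp (σ / 2 * t) * (wsum K 0 q.1 + wsum K 0 q.2)) (by fun_prop) ht) ?_
    filter_upwards [hev t] with N hN
    refine le_trans (mul_le_mul_of_nonneg_left ?_ (Real.exp_pos _).le) (dec N t ⟨ht, hN⟩)
    exact add_le_add (wsum_le_of_support ((huv N).f_support t) 0)
      (wsum_le_of_support ((huv N).g_support t) 0)
  · have hw1 := continuous_qsum K 1
    have hw2 := continuous_qsum K 2
    have h1 := H.tendsto_comp
      (Φ := fun q => Real.exp (κ * t) * (qsum K 1 q.1 + qsum K 1 q.2)) (by fun_prop) ht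
    have h2 := H.tendsto_integral (Φ := fun q => qsum K 2 q.1 + qsum K 2 q.2) (by fun_prop) ht
    refine le_of_tendsto (h1.add (h2.const_mul κ)) ?_
    filter_upwards [hev t] with N hN
    have hsub : Icc 0 t ⊆ Icc 0 (N : ℝ) := Icc_subset_Icc_right hN
    have hu := (huv N).f_continuousOn
    have hv := (huv N).g_continuousOn
    refine le_trans (add_le_add (mul_le_mul_of_nonneg_left ?_ (Real.exp_pos _).le)
      (mul_le_mul_of_nonneg_left ?_ hκ.le)) (en N t ⟨ht, hN⟩)
    · exact add_le_add (qsum_le_of_support ((huv N).f_support t) 1)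
        (qsum_le_of_support ((huv N).g_support t) 1)
    · refine intervalIntegral.integral_mono_on ht
        (((continuousOn_qsum hu).add (continuousOn_qsum hv)).mono hsub
          |>.intervalIntegrable_of_Icc ht)
        (((continuousOn_qsum hu).add (continuousOn_qsum hv)).mono hsub
          |>.intervalIntegrable_of_Icc ht) fun s _ => ?_
      exact add_le_add (qsum_le_of_support ((huv N).f_support s) 2)
        (qsum_le_of_support ((huv N).g_support s) 2)

/-! ### Functions given by absolutely convergent Fourier series -/

/-- The character `x ↦ e^{ikx}`. -/
def char (k : ℤ) (x : ℝ) : ℂ := Complex.exp (k * x * Complex.I)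

lemma norm_char (k : ℤ) (x : ℝ) : ‖char k x‖ = 1 := by
  have : (k * x * Complex.I : ℂ) = ((k * x : ℝ) : ℂ) * Complex.I := by push_cast; ring
  rw [char, this, Complex.norm_exp_ofReal_mul_I]

lemma continuous_char (k : ℤ) : Continuous (char k) := by unfold char; fun_prop

lemma char_add (j k : ℤ) (x : ℝ) : char (j + k) x = char j x * char k x := by
  rw [char, char, char, ← Complex.exp_add]
  congr 1
  push_cast
  ring

lemma conj_char (k : ℤ) (x : ℝ) : conj (char k x) = char (-k) x := by
  rw [char, char, ← Complex.exp_conj]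
  simp

lemma char_periodic (k : ℤ) : Function.Periodic (char k) (2 * π) := by
  intro x
  rw [char, char, Complex.exp_eq_exp_iff_exists_int]
  exact ⟨k, by push_cast; ring⟩

lemma hasDerivAt_char (k : ℤ) (x : ℝ) : HasDerivAt (char k) (k * Complex.I * char k x) x := by
  have h : HasDerivAt (fun x : ℝ => (k * x * Complex.I : ℂ)) (k * 1 * Complex.I) x :=
    ((hasDerivAt_id x).ofReal_comp.const_mul _).mul_const _
  exact h.cexp.congr_deriv (by rw [char]; ring)

lemma integral_char (k : ℤ) : ∫ x in (-π)..π, char k x = if k = 0 then 2 * π else 0 := by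
  split_ifs with hk
  · simp [char, hk, two_mul]
  · have h1 : ∀ x ∈ uIcc (-π) π, HasDerivAt (fun x => (k * Complex.I : ℂ)⁻¹ * char k x)
        (char k x) x := fun x _ => by
      have hne : (k * Complex.I : ℂ) ≠ 0 := by simp [hk]
      exact ((hasDerivAt_char k x).const_mul (k * Complex.I : ℂ)⁻¹).congr_deriv
        (by rw [← mul_assoc, inv_mul_cancel₀ hne, one_mul])
    rw [intervalIntegral.integral_eq_sub_of_hasDerivAt h1
      ((continuous_char k).intervalIntegrable _ _)]
    have h2 : char k π = char k (-π) := by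
      rw [← char_periodic k (-π)]
      congr 1
      ring
    rw [h2, sub_self, Complex.ofReal_zero]

/-- The function with Fourier coefficients `a`, with values in `ℂ`. -/
def synthC (a : ℤ → ℂ) (x : ℝ) : ℂ := ∑' k, a k * char k x

/-- The real part of the function with Fourier coefficients `a`. -/
def synth (a : ℤ → ℂ) (x : ℝ) : ℝ := (synthC a x).re

/-- The Fourier coefficients of `synth a`; since `synth` takes the real part, they are the Hermitian
symmetrization of `a`. -/
def herm (a : ℤ → ℂ) (k : ℤ) : ℂ := (a k + conj (a (-k))) / 2

/-- `∑ |k|^i |a_k|`, in `[0, ∞]`. -/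
def eWiener (i : ℕ) (a : ℤ → ℂ) : ℝ≥0∞ := ∑' k : ℤ, ‖(k : ℂ) ^ i * a k‖ₑ

/-- `∑ |k|^{2i} |a_k|²`, in `[0, ∞]`. -/
def eSobolev (i : ℕ) (a : ℤ → ℂ) : ℝ≥0∞ := ∑' k : ℤ, ‖(k : ℂ) ^ i * a k‖ₑ ^ 2

lemma norm_term (a : ℤ → ℂ) (k : ℤ) (x : ℝ) : ‖a k * char k x‖ = ‖a k‖ := by
  rw [norm_mul, norm_char, mul_one]

lemma summable_of_eWiener {i : ℕ} {a : ℤ → ℂ} (h : eWiener i a < ⊤) :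
    Summable fun k : ℤ => ‖(k : ℂ) ^ i * a k‖ := by
  have := ENNReal.summable_toReal h.ne
  simpa using this

lemma summable_term {a : ℤ → ℂ} (ha : Summable fun k => ‖a k‖) (x : ℝ) :
    Summable fun k => a k * char k x :=
  Summable.of_norm (by simpa only [norm_term] using ha)

lemma synthC_periodic (a : ℤ → ℂ) : Function.Periodic (synthC a) (2 * π) := fun x => by
  simp only [synthC, char_periodic _ x]

lemma synth_periodic (a : ℤ → ℂ) : Function.Periodic (synth a) (2 * π) := fun x => by
  simp only [synth, synthC_periodic a x]

lemma continuous_synthC {a : ℤ → ℂ} (ha : Summable fun k => ‖a k‖) : Continuous (synthC a) :=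
  continuous_tsum (fun k => continuous_const.mul (continuous_char k)) ha
    fun k x => (norm_term a k x).le

lemma continuous_synth {a : ℤ → ℂ} (ha : Summable fun k => ‖a k‖) : Continuous (synth a) :=
  Complex.continuous_re.comp (continuous_synthC ha)

lemma enorm_synthC_le (a : ℤ → ℂ) (x : ℝ) : ‖synthC a x‖ₑ ≤ eWiener 0 a := by
  refine enorm_tsum_le_tsum_enorm.trans (ENNReal.tsum_le_tsum fun k => ?_)
  rw [pow_zero, one_mul, enorm_mul, show ‖char k x‖ₑ = 1 by
    rw [← ofReal_norm, norm_char, ENNReal.ofReal_one], mul_one]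

lemma enorm_re_le (z : ℂ) : ‖z.re‖ₑ ≤ ‖z‖ₑ := by
  rw [← ofReal_norm, ← ofReal_norm]
  exact ENNReal.ofReal_le_ofReal (Complex.abs_re_le_norm z)

lemma enorm_synth_le (a : ℤ → ℂ) (x : ℝ) : ‖synth a x‖ₑ ≤ eWiener 0 a :=
  (enorm_re_le _).trans (enorm_synthC_le a x)

lemma synthC_sub {a b : ℤ → ℂ} (ha : Summable fun k => ‖a k‖) (hb : Summable fun k => ‖b k‖) :
    synthC a - synthC b = synthC (a - b) := by
  ext x
  simp only [synthC, Pi.sub_apply, sub_mul]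
  exact ((summable_term ha x).tsum_sub (summable_term hb x)).symm

lemma synth_sub {a b : ℤ → ℂ} (ha : Summable fun k => ‖a k‖) (hb : Summable fun k => ‖b k‖) :
    synth a - synth b = synth (a - b) := by
  ext x
  simp only [synth, Pi.sub_apply, ← Complex.sub_re, ← synthC_sub ha hb]

lemma summable_norm_conj_neg {a : ℤ → ℂ} (ha : Summable fun k => ‖a k‖) :
    Summable fun k => ‖conj (a (-k))‖ := by
  simpa [Function.comp_def] using (Equiv.neg ℤ).summable_iff.2 ha

lemma ofReal_synth {a : ℤ → ℂ} (ha : Summable fun k => ‖a k‖) (x : ℝ) :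
    (synth a x : ℂ) = synthC (herm a) x := by
  have h1 : conj (synthC a x) = ∑' k, conj (a (-k)) * char k x := by
    rw [synthC, Complex.conj_tsum, ← (Equiv.neg ℤ).tsum_eq]
    refine tsum_congr fun k => ?_
    simp [conj_char]
  have h2 := summable_term ha x
  have h3 := summable_term (summable_norm_conj_neg ha) x
  rw [synth, Complex.re_eq_add_conj, h1, synthC, ← h2.tsum_add h3, ← tsum_div_const, synthC]
  exact tsum_congr fun k => by rw [herm]; ring

lemma herm_eq_self {a : ℤ → ℂ} (ha : ∀ k, a (-k) = conj (a k)) : herm a = a := by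
  ext k
  rw [herm, ha, Complex.conj_conj]
  ring

lemma norm_herm_le (a : ℤ → ℂ) (k : ℤ) : ‖herm a k‖ ≤ (‖a k‖ + ‖a (-k)‖) / 2 := by
  rw [herm, norm_div, RCLike.norm_ofNat]
  have := norm_add_le (a k) (conj (a (-k)))
  rw [Complex.norm_conj] at this
  linarith

lemma summable_herm {a : ℤ → ℂ} (ha : Summable fun k => ‖a k‖) :
    Summable fun k => ‖herm a k‖ := by
  refine Summable.of_nonneg_of_le (fun _ => norm_nonneg _) (norm_herm_le a) ?_
  have := (ha.add (summable_norm_conj_neg ha)).div_const 2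
  simpa using this

/-- Termwise differentiation. -/
lemma hasDerivAt_synthC {a : ℤ → ℂ} (h0 : Summable fun k => ‖a k‖)
    (h1 : Summable fun k : ℤ => ‖(k : ℂ) ^ 1 * a k‖) (x : ℝ) :
    HasDerivAt (synthC a) (synthC (fun k => k * Complex.I * a k) x) x := by
  refine (hasDerivAt_tsum (y₀ := 0) h1 (fun k y => (hasDerivAt_char k y).const_mul (a k))
    (fun k y => ?_) (summable_term h0 0) x).congr_deriv ?_
  · simp [norm_char, mul_comm]
  · exact tsum_congr fun k => by ring

lemma hasDerivAt_synth {a : ℤ → ℂ} (h0 : Summable fun k => ‖a k‖)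
    (h1 : Summable fun k : ℤ => ‖(k : ℂ) ^ 1 * a k‖) (x : ℝ) :
    HasDerivAt (synth a) (synth (fun k => k * Complex.I * a k) x) x :=
  Complex.reCLM.hasFDerivAt.comp_hasDerivAt x (hasDerivAt_synthC h0 h1 x)

/-- Termwise integration against an integrable function. -/
lemma hasSum_integral_synthC {a : ℤ → ℂ} (ha : Summable fun k => ‖a k‖) {ψ : ℝ → ℂ}
    (hψ : IntervalIntegrable ψ volume (-π) π) :
    HasSum (fun k => a k * ∫ x in (-π)..π, char k x * ψ x)
      (∫ x in (-π)..π, synthC a x * ψ x) := by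
  have hπ : (-π : ℝ) ≤ π := by linarith [Real.pi_pos]
  have hint : ∀ k, IntervalIntegrable (fun x => a k * char k x * ψ x) volume (-π) π := fun k =>
    hψ.continuousOn_mul (continuous_const.mul (continuous_char k)).continuousOn
  have h := hasSum_integral_of_summable_integral_norm
    (μ := volume.restrict (Ioc (-π) π)) (F := fun k x => a k * char k x * ψ x)
    (fun k => (intervalIntegrable_iff_integrableOn_Ioc_of_le hπ).1 (hint k)) (by
      have : ∀ k, ∫ x in Ioc (-π) π, ‖a k * char k x * ψ x‖
          = ‖a k‖ * ∫ x in Ioc (-π) π, ‖ψ x‖ := fun k => by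
        rw [← integral_const_mul]
        simp only [norm_mul, norm_char, mul_one]
      simp only [this]
      exact ha.mul_right _)
  have h2 : ∫ x in (-π)..π, synthC a x * ψ x
      = ∫ x in Ioc (-π) π, ∑' k, a k * char k x * ψ x := by
    rw [intervalIntegral.integral_of_le hπ]
    simp only [synthC, tsum_mul_right]
  rw [h2]
  refine h.congr_fun fun k => ?_
  rw [intervalIntegral.integral_of_le hπ, ← integral_const_mul]
  simp only [mul_assoc]

lemma integral_char_mul_char (j k : ℤ) :
    ∫ x in (-π)..π, char j x * char k x = if j + k = 0 then 2 * π else 0 := by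
  simp only [← char_add]
  exact integral_char _

lemma coeff_eq (u : ℝ → ℝ) (k : ℤ) :
    coeff u k = 1 / (2 * π) * ∫ x in (-π)..π, (u x : ℂ) * char (-k) x := by
  rw [coeff, fourierCoeffOn_eq_integral, Complex.real_smul]
  congr 1
  · push_cast
    ring
  · refine intervalIntegral.integral_congr fun x _ => ?_
    have : (π : ℂ) ≠ 0 := by exact_mod_cast Real.pi_ne_zero
    have h2 : (π : ℂ) - -π = 2 * π := by ring
    rw [smul_eq_mul, fourier_coe_apply, char, mul_comm]
    push_cast
    rw [h2]
    congr 2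
    field_simp

lemma coeff_synth {a : ℤ → ℂ} (ha : Summable fun k => ‖a k‖) (k : ℤ) :
    coeff (synth a) k = herm a k := by
  have h := hasSum_integral_synthC (summable_herm ha) (ψ := char (-k))
    ((continuous_char _).intervalIntegrable _ _)
  simp only [integral_char_mul_char] at h
  have h2 := h.unique (hasSum_single k fun j hj => by
    rw [if_neg (by rw [← sub_eq_add_neg, sub_eq_zero]; exact hj), Complex.ofReal_zero,
      mul_zero])
  have : (π : ℂ) ≠ 0 := by exact_mod_cast Real.pi_ne_zero
  rw [coeff_eq]
  simp only [ofReal_synth ha]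
  rw [h2, if_pos (by ring)]
  push_cast
  field_simp

lemma ofReal_mean (u : ℝ → ℝ) : (mean u : ℂ) = coeff u 0 := by
  rw [coeff_eq, mean]
  simp [char, intervalIntegral.integral_ofReal]

lemma mean_synth {a : ℤ → ℂ} (ha : Summable fun k => ‖a k‖) (h0 : a 0 = 0) :
    mean (synth a) = 0 := by
  have := ofReal_mean (synth a)
  rw [coeff_synth ha, herm, neg_zero, h0] at this
  simpa using this

/-- The Fourier coefficients of a product are given by an absolutely summable convolution. -/
lemma synthC_mul {a b : ℤ → ℂ} (ha : Summable fun k => ‖a k‖) (hb : Summable fun k => ‖b k‖) :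
    (Summable fun k : ℤ => ‖∑' j, a (k - j) * b j‖) ∧
      ∀ x, synthC a x * synthC b x = synthC (fun k => ∑' j, a (k - j) * b j) x := by
  have hab : Summable fun q : ℤ × ℤ => ‖a q.1 * b q.2‖ := ha.mul_norm hb
  let e : ℤ × ℤ ≃ ℤ × ℤ :=
    { toFun := fun q => (q.1 - q.2, q.2)
      invFun := fun q => (q.1 + q.2, q.2)
      left_inv := fun q => by simp
      right_inv := fun q => by simp }
  have he : Summable fun q : ℤ × ℤ => ‖a (q.1 - q.2) * b q.2‖ := e.summable_iff.2 hab
  have hs := he.of_norm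
  constructor
  · refine Summable.of_nonneg_of_le (fun _ => norm_nonneg _) (fun k => ?_) he.prod
    exact norm_tsum_le_tsum_norm (he.prod_factor k)
  · intro x
    have h1 : Summable fun q : ℤ × ℤ => (a q.1 * char q.1 x) * (b q.2 * char q.2 x) :=
      Summable.of_norm (by
        refine hab.congr fun q => ?_
        simp only [norm_mul, norm_char, mul_one])
    have h2 : Summable fun q : ℤ × ℤ =>
        (a (q.1 - q.2) * char (q.1 - q.2) x) * (b q.2 * char q.2 x) := e.summable_iff.2 h1
    rw [synthC, synthC, (summable_term ha x).tsum_mul_tsum (summable_term hb x) h1, ← e.tsum_eq,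
      synthC]
    refine h2.tsum_prod.trans (tsum_congr fun k => ?_)
    rw [← tsum_mul_right]
    refine tsum_congr fun j => ?_
    have : char k x = char (k - j) x * char j x := by rw [← char_add, sub_add_cancel]
    rw [this]
    ring

/-! ### Norms of functions given by Fourier series -/

/-- The Fourier coefficients of the derivative. -/
def diffCoeff (a : ℤ → ℂ) (k : ℤ) : ℂ := k * Complex.I * a k

lemma diffCoeff_zero (a : ℤ → ℂ) : diffCoeff a 0 = 0 := by simp [diffCoeff]

lemma eWiener_diffCoeff (i : ℕ) (a : ℤ → ℂ) : eWiener i (diffCoeff a) = eWiener (i + 1) a := by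
  refine tsum_congr fun k => ?_
  rw [← ofReal_norm, ← ofReal_norm]
  congr 1
  simp [diffCoeff, pow_succ, mul_assoc]

lemma enorm_pow_mul_le {i j : ℕ} (hij : i ≤ j) {a : ℤ → ℂ} (h0 : a 0 = 0) (k : ℤ) :
    ‖(k : ℂ) ^ i * a k‖ₑ ≤ ‖(k : ℂ) ^ j * a k‖ₑ := by
  rcases eq_or_ne k 0 with rfl | hk
  · simp [h0]
  · rw [← ofReal_norm, ← ofReal_norm]
    refine ENNReal.ofReal_le_ofReal ?_
    rw [norm_mul, norm_mul, norm_pow, norm_pow, Complex.norm_intCast]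
    exact mul_le_mul_of_nonneg_right (abs_int_pow_le hij (.inr hk)) (norm_nonneg _)

lemma eWiener_mono {i j : ℕ} (hij : i ≤ j) {a : ℤ → ℂ} (h0 : a 0 = 0) :
    eWiener i a ≤ eWiener j a :=
  ENNReal.tsum_le_tsum fun k => enorm_pow_mul_le hij h0 k

lemma ofReal_wsum (S : Finset ℤ) (i : ℕ) (a : ℤ → ℂ) :
    ENNReal.ofReal (wsum S i a) = ∑ k ∈ S, ‖(k : ℂ) ^ i * a k‖ₑ := by
  rw [wsum, ENNReal.ofReal_sum_of_nonneg fun _ _ => by positivity]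
  refine Finset.sum_congr rfl fun k _ => ?_
  rw [← ofReal_norm, norm_mul, norm_pow, Complex.norm_intCast]

lemma ofReal_qsum (S : Finset ℤ) (i : ℕ) (a : ℤ → ℂ) :
    ENNReal.ofReal (qsum S i a) = ∑ k ∈ S, ‖(k : ℂ) ^ i * a k‖ₑ ^ 2 := by
  rw [qsum, ENNReal.ofReal_sum_of_nonneg fun _ _ => by positivity]
  refine Finset.sum_congr rfl fun k _ => ?_
  rw [← ofReal_norm, norm_mul, norm_pow, Complex.norm_intCast, ENNReal.ofReal_pow (by positivity)]

lemma eWiener_le {i : ℕ} {a : ℤ → ℂ} {C : ℝ} (h : ∀ S, wsum S i a ≤ C) :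
    eWiener i a ≤ ENNReal.ofReal C := by
  rw [eWiener, ENNReal.tsum_eq_iSup_sum]
  exact iSup_le fun S => (ofReal_wsum S i a).symm.le.trans (ENNReal.ofReal_le_ofReal (h S))

lemma eSobolev_le {i : ℕ} {a : ℤ → ℂ} {C : ℝ} (h : ∀ S, qsum S i a ≤ C) :
    eSobolev i a ≤ ENNReal.ofReal C := by
  rw [eSobolev, ENNReal.tsum_eq_iSup_sum]
  exact iSup_le fun S => (ofReal_qsum S i a).symm.le.trans (ENNReal.ofReal_le_ofReal (h S))

lemma summable_norm_of_eWiener {i : ℕ} {a : ℤ → ℂ} (h0 : a 0 = 0) (h : eWiener i a < ⊤) :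
    Summable fun k => ‖a k‖ := by
  simpa using summable_of_eWiener ((eWiener_mono (Nat.zero_le i) h0).trans_lt h)

/-- Interpolation between Wiener norms. -/
lemma eWiener_one_sq_le (a : ℤ → ℂ) : eWiener 1 a ^ 2 ≤ eWiener 0 a * eWiener 2 a := by
  have h1 : Tendsto (fun S : Finset ℤ => (∑ k ∈ S, ‖(k : ℂ) ^ 1 * a k‖ₑ) ^ 2) atTop
      (𝓝 (eWiener 1 a ^ 2)) :=
    (ENNReal.continuous_pow 2).continuousAt.tendsto.comp ENNReal.summable.hasSum
  refine le_of_tendsto' h1 fun S => ?_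
  have h2 := wsum_one_mul_le (S := S) a a
  have h3 : wsum S 1 a ^ 2 ≤ wsum S 0 a * wsum S 2 a := by nlinarith
  calc (∑ k ∈ S, ‖(k : ℂ) ^ 1 * a k‖ₑ) ^ 2
      = ENNReal.ofReal (wsum S 1 a ^ 2) := by
        rw [ENNReal.ofReal_pow (wsum_nonneg _ _ _), ofReal_wsum]
    _ ≤ ENNReal.ofReal (wsum S 0 a * wsum S 2 a) := ENNReal.ofReal_le_ofReal h3
    _ = (∑ k ∈ S, ‖(k : ℂ) ^ 0 * a k‖ₑ) * ∑ k ∈ S, ‖(k : ℂ) ^ 2 * a k‖ₑ := by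
        rw [ENNReal.ofReal_mul (wsum_nonneg _ _ _), ofReal_wsum, ofReal_wsum]
    _ ≤ _ := mul_le_mul' (ENNReal.sum_le_tsum S) (ENNReal.sum_le_tsum S)

lemma eSobolev_le_eWiener_sq (i : ℕ) (a : ℤ → ℂ) : eSobolev i a ≤ eWiener i a ^ 2 := by
  rw [sq]
  nth_rw 1 [eWiener]
  rw [← ENNReal.tsum_mul_right]
  refine ENNReal.tsum_le_tsum fun k => ?_
  rw [sq]
  exact mul_le_mul_right (ENNReal.le_tsum k) _

lemma torus_univ : torus univ = ENNReal.ofReal (2 * π) := by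
  rw [torus, Measure.restrict_apply_univ, Real.volume_Ioc]
  congr 1
  ring

instance : IsFiniteMeasure torus := ⟨by rw [torus_univ]; exact ENNReal.ofReal_lt_top⟩

lemma integral_torus {F : Type*} [NormedAddCommGroup F] [NormedSpace ℝ F] (u : ℝ → F) :
    ∫ x, u x ∂torus = ∫ x in (-π)..π, u x := by
  rw [intervalIntegral.integral_of_le (by linarith [Real.pi_pos]), torus]

lemma integrable_torus {u : ℝ → ℝ} (hu : Continuous u) : Integrable u torus :=
  (hu.integrableOn_Icc (a := -π) (b := π)).mono_set Ioc_subset_Icc_self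

lemma eLpNorm_synth_le (p : ℝ≥0∞) (a : ℤ → ℂ) :
    eLpNorm (synth a) p torus ≤ eWiener 0 a * torus univ ^ p.toReal⁻¹ :=
  eLpNorm_le_of_ae_enorm_bound (ae_of_all _ (enorm_synth_le a))

/-- Integration by parts over a period. -/
lemma integral_mul_deriv_periodic {A : Type*} [NormedRing A] [NormedAlgebra ℝ A]
    [CompleteSpace A] {u v u' v' : ℝ → A} (hu : ∀ x, HasDerivAt u (u' x) x)
    (hv : ∀ x, HasDerivAt v (v' x) x) (hu' : Continuous u') (hv' : Continuous v')
    (hup : Function.Periodic u (2 * π)) (hvp : Function.Periodic v (2 * π)) :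
    ∫ x in (-π)..π, u x * v' x = - ∫ x in (-π)..π, u' x * v x := by
  rw [intervalIntegral.integral_mul_deriv_eq_deriv_mul (fun x _ => hu x) (fun x _ => hv x)
    (hu'.intervalIntegrable _ _) (hv'.intervalIntegrable _ _)]
  have h1 : u π = u (-π) := by rw [← hup (-π)]; congr 1; ring
  have h2 : v π = v (-π) := by rw [← hvp (-π)]; congr 1; ring
  rw [h1, h2, sub_self, zero_sub]

lemma hasDerivAt_synth_diffCoeff {a : ℤ → ℂ} (h0 : a 0 = 0) (h1 : eWiener 1 a < ⊤) (x : ℝ) :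
    HasDerivAt (synth a) (synth (diffCoeff a) x) x :=
  hasDerivAt_synth (summable_norm_of_eWiener h0 h1) (summable_of_eWiener h1) x

lemma continuous_synth_diffCoeff {a : ℤ → ℂ} (h1 : eWiener 1 a < ⊤) :
    Continuous (synth (diffCoeff a)) :=
  continuous_synth (summable_norm_of_eWiener (i := 0) (diffCoeff_zero a)
    (by rwa [eWiener_diffCoeff]))

lemma isWeakDeriv_synth {a : ℤ → ℂ} (h0 : a 0 = 0) (h1 : eWiener 1 a < ⊤) :
    IsWeakDeriv 1 (synth a) (synth (diffCoeff a)) := by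
  have hc := continuous_synth_diffCoeff h1
  refine ⟨integrable_torus (continuous_synth (summable_norm_of_eWiener h0 h1)),
    integrable_torus hc, fun φ hφ hper => ?_⟩
  rw [iteratedDeriv_one, pow_one, neg_one_mul]
  exact integral_mul_deriv_periodic (hasDerivAt_synth_diffCoeff h0 h1)
    (fun x => (hφ.differentiable (by simp) x).hasDerivAt) hc (hφ.continuous_deriv (by simp))
    (synth_periodic a) hper

lemma sobolevNorm_one_synth_le (p : ℝ≥0∞) {a : ℤ → ℂ} (h0 : a 0 = 0) :
    sobolevNorm 1 p (synth a) ≤ 2 * torus univ ^ p.toReal⁻¹ * eWiener 1 a := by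
  have hpos : torus univ ^ p.toReal⁻¹ ≠ 0 := by
    refine (ENNReal.rpow_pos ?_ (measure_ne_top _ _)).ne'
    rw [torus_univ]
    exact ENNReal.ofReal_pos.2 (by positivity)
  rcases lt_or_ge (eWiener 1 a) ⊤ with h1 | h1
  · have h2 : sobolevNorm 1 p (synth a) ≤
        eLpNorm (synth a) p torus + eLpNorm (synth (diffCoeff a)) p torus :=
      add_le_add le_rfl (iInf₂_le _ (isWeakDeriv_synth h0 h1))
    refine h2.trans ((add_le_add (eLpNorm_synth_le p a) (eLpNorm_synth_le p _)).trans ?_)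
    rw [eWiener_diffCoeff, zero_add]
    calc eWiener 0 a * torus univ ^ p.toReal⁻¹ + eWiener 1 a * torus univ ^ p.toReal⁻¹
        ≤ eWiener 1 a * torus univ ^ p.toReal⁻¹ + eWiener 1 a * torus univ ^ p.toReal⁻¹ := by
          gcongr
          exact eWiener_mono zero_le_one h0
      _ = _ := by ring
  · rw [top_le_iff.1 h1, ENNReal.mul_top (mul_ne_zero two_ne_zero hpos)]
    exact le_top

lemma lipschitzWith_synth {a : ℤ → ℂ} (h0 : a 0 = 0) (h1 : eWiener 1 a < ⊤) :
    LipschitzWith (eWiener 1 a).toNNReal (synth a) := by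
  refine lipschitzWith_of_nnnorm_deriv_le
    (fun x => (hasDerivAt_synth_diffCoeff h0 h1 x).differentiableAt) fun x => ?_
  rw [(hasDerivAt_synth_diffCoeff h0 h1 x).deriv, ← ENNReal.coe_le_coe, ENNReal.coe_toNNReal h1.ne]
  exact (enorm_synth_le _ x).trans (by rw [eWiener_diffCoeff])

lemma eHolderNorm_synth_le {α : ℝ≥0} (hα : α ≤ 1) {a : ℤ → ℂ} (h0 : a 0 = 0)
    (h1 : eWiener 1 a < ⊤) : (eHolderNorm α (synth a) : ℝ≥0∞) ≤ 2 * eWiener 1 a := by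
  have key : HolderWith (2 * (eWiener 1 a).toNNReal) α (synth a) := by
    intro x y
    rw [ENNReal.coe_mul, ENNReal.coe_toNNReal h1.ne, ENNReal.coe_ofNat]
    -- small distances: Lipschitz bound; large distances: bound by the supremum
    rcases le_total (edist x y) 1 with hxy | hxy
    · have := lipschitzWith_synth h0 h1 x y
      rw [ENNReal.coe_toNNReal h1.ne] at this
      refine this.trans (mul_le_mul' ?_ ?_)
      · rw [two_mul]
        exact le_self_add
      · calc edist x y = edist x y ^ (1 : ℝ) := (ENNReal.rpow_one _).symm
          _ ≤ edist x y ^ (α : ℝ) := ENNReal.rpow_le_rpow_of_exponent_ge hxy (by exact_mod_cast hα)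
    · calc edist (synth a x) (synth a y) ≤ ‖synth a x‖ₑ + ‖synth a y‖ₑ := by
            rw [edist_eq_enorm_sub]
            exact enorm_sub_le
        _ ≤ eWiener 0 a + eWiener 0 a := add_le_add (enorm_synth_le _ _) (enorm_synth_le _ _)
        _ ≤ 2 * eWiener 1 a := by
            rw [two_mul]
            exact add_le_add (eWiener_mono zero_le_one h0) (eWiener_mono zero_le_one h0)
        _ = 2 * eWiener 1 a * 1 := (mul_one _).symm
        _ ≤ _ := by
            gcongr
            simpa using ENNReal.rpow_le_rpow_of_exponent_le hxy α.coe_nonneg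
  have := key.eHolderNorm_le
  rwa [ENNReal.coe_mul, ENNReal.coe_toNNReal h1.ne, ENNReal.coe_ofNat] at this

lemma holderNorm_synth_le {α : ℝ≥0} (hα : α ≤ 1) {a : ℤ → ℂ} (h0 : a 0 = 0) :
    holderNorm α (synth a) ≤ 4 * eWiener 2 a := by
  rcases lt_or_ge (eWiener 2 a) ⊤ with h2 | h2
  · have h1 : eWiener 1 a < ⊤ := (eWiener_mono one_le_two h0).trans_lt h2
    have hd : deriv (synth a) = synth (diffCoeff a) :=
      funext fun x => (hasDerivAt_synth_diffCoeff h0 h1 x).deriv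
    have hC : ContDiff ℝ 1 (synth a) := contDiff_one_iff_deriv.2
      ⟨fun x => (hasDerivAt_synth_diffCoeff h0 h1 x).differentiableAt,
        hd ▸ continuous_synth_diffCoeff h1⟩
    refine (iInf₂_le (synth a) ⟨hC, synth_periodic a, ae_eq_refl _⟩).trans ?_
    rw [hd]
    have e1 : eWiener 1 (diffCoeff a) = eWiener 2 a := eWiener_diffCoeff 1 a
    calc _ ≤ eWiener 2 a + eWiener 2 a + 2 * eWiener 2 a := by
          refine add_le_add (add_le_add (iSup_le fun x => ?_) (iSup_le fun x => ?_)) ?_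
          · exact (enorm_synth_le a x).trans (eWiener_mono (Nat.zero_le _) h0)
          · exact (enorm_synth_le _ x).trans
              (e1 ▸ eWiener_mono zero_le_one (diffCoeff_zero a))
          · exact e1 ▸ eHolderNorm_synth_le hα (diffCoeff_zero a) (e1 ▸ h2)
      _ = _ := by ring
  · rw [top_le_iff.1 h2, ENNReal.mul_top (by simp)]
    exact le_top

lemma eSobolev_herm_le (i : ℕ) (a : ℤ → ℂ) : eSobolev i (herm a) ≤ eSobolev i a := by
  have hneg : ∑' k : ℤ, ‖(k : ℂ) ^ i * a (-k)‖ₑ ^ 2 = eSobolev i a := by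
    rw [eSobolev, ← (Equiv.neg ℤ).tsum_eq]
    refine tsum_congr fun k => ?_
    rw [← ofReal_norm, ← ofReal_norm]
    simp
  have key : ∀ k : ℤ, ‖(k : ℂ) ^ i * herm a k‖ₑ ^ 2
      ≤ ENNReal.ofReal (1 / 2) * ‖(k : ℂ) ^ i * a k‖ₑ ^ 2
        + ENNReal.ofReal (1 / 2) * ‖(k : ℂ) ^ i * a (-k)‖ₑ ^ 2 := fun k => by
    simp only [← ofReal_norm]
    rw [← ENNReal.ofReal_pow (norm_nonneg _), ← ENNReal.ofReal_pow (norm_nonneg _),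
      ← ENNReal.ofReal_pow (norm_nonneg _), ← ENNReal.ofReal_mul (by norm_num),
      ← ENNReal.ofReal_mul (by norm_num), ← ENNReal.ofReal_add (by positivity) (by positivity)]
    refine ENNReal.ofReal_le_ofReal ?_
    simp only [norm_mul, mul_pow]
    have h1 := norm_herm_le a k
    have h2 : ‖herm a k‖ ^ 2 ≤ 1 / 2 * ‖a k‖ ^ 2 + 1 / 2 * ‖a (-k)‖ ^ 2 := by
      nlinarith [sq_nonneg (‖a k‖ - ‖a (-k)‖), norm_nonneg (herm a k)]
    have h3 : 0 ≤ ‖(k : ℂ) ^ i‖ ^ 2 := by positivity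
    nlinarith
  calc eSobolev i (herm a) ≤ ∑' k : ℤ, (ENNReal.ofReal (1 / 2) * ‖(k : ℂ) ^ i * a k‖ₑ ^ 2
        + ENNReal.ofReal (1 / 2) * ‖(k : ℂ) ^ i * a (-k)‖ₑ ^ 2) := ENNReal.tsum_le_tsum key
    _ = ENNReal.ofReal (1 / 2) * eSobolev i a + ENNReal.ofReal (1 / 2) * eSobolev i a := by
        rw [ENNReal.tsum_add, ENNReal.tsum_mul_left, ENNReal.tsum_mul_left, hneg, ← eSobolev]
    _ = eSobolev i a := by
        rw [← add_mul, ← ENNReal.ofReal_add (by norm_num) (by norm_num)]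
        norm_num

lemma memLp_synth {a : ℤ → ℂ} (ha : Summable fun k => ‖a k‖) (p : ℝ≥0∞) :
    MemLp (synth a) p torus := by
  refine MemLp.of_bound (continuous_synth ha).aestronglyMeasurable (∑' k, ‖a k‖)
    (ae_of_all _ fun x => ?_)
  refine (Complex.abs_re_le_norm _).trans ((norm_tsum_le_tsum_norm ?_).trans_eq ?_)
  · simpa only [norm_term] using ha
  · simp only [norm_term]

/-- The homogeneous Sobolev norms increase with the exponent, by the Poincaré inequality. -/
lemma hdotNorm_synth_sq_le {s : ℝ} {i : ℕ} (hs : s ≤ i) {a : ℤ → ℂ} (h0 : a 0 = 0)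
    (ha : Summable fun k => ‖a k‖) : hdotNorm s (synth a) ^ 2 ≤ eSobolev i a := by
  rw [hdotNorm, iInf_pos ⟨memLp_synth ha 2, mean_synth ha h0⟩, ← ENNReal.rpow_natCast,
    ← ENNReal.rpow_mul]
  norm_num
  refine le_trans (ENNReal.tsum_le_tsum fun k => ?_) (eSobolev_herm_le i a)
  rw [coeff_synth ha]
  rcases eq_or_ne k 0 with rfl | hk
  · simp [herm, h0]
  · rw [enorm_mul, mul_pow]
    gcongr
    rw [← ofReal_norm, ← ENNReal.ofReal_pow (norm_nonneg _), norm_pow, Complex.norm_intCast,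
      ← pow_mul, ← Real.rpow_natCast]
    refine ENNReal.ofReal_le_ofReal (Real.rpow_le_rpow_of_exponent_le ?_ ?_)
    · exact_mod_cast Int.one_le_abs hk
    · push_cast
      linarith

/-! ### Strong measurability of Fourier series in Bochner spaces -/

/-- A simple function that approximates the identity uniformly on `[0, T]`. -/
lemma exists_simpleFunc_near_id {T δ : ℝ} (hδ : 0 < δ) :
    ∃ τ : SimpleFunc ℝ ℝ, ∀ t ∈ Icc 0 T, τ t ∈ Icc 0 T ∧ dist t (τ t) < δ := by
  have hm : Measurable fun t : ℝ => δ * (⌊min t T / δ⌋₊ : ℝ) :=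
    ((measurable_from_nat (f := fun n : ℕ => (n : ℝ))).comp (Nat.measurable_floor.comp
      ((measurable_id.min measurable_const).div_const δ))).const_mul δ
  refine ⟨⟨fun t => δ * (⌊min t T / δ⌋₊ : ℝ), fun x => hm (measurableSet_singleton x), ?_⟩, ?_⟩
  · refine ((Set.finite_Iic ⌊T / δ⌋₊).image fun n : ℕ => δ * (n : ℝ)).subset ?_
    rintro _ ⟨t, rfl⟩
    refine ⟨_, Nat.floor_le_floor ?_, rfl⟩
    gcongr
    exact min_le_right _ _
  · rintro t ⟨h0, hT⟩
    have h1 : δ * (⌊min t T / δ⌋₊ : ℝ) ≤ t := by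
      rw [min_eq_left hT, mul_comm, ← le_div_iff₀ hδ]
      exact Nat.floor_le (div_nonneg h0 hδ.le)
    have h2 : t < δ * (⌊min t T / δ⌋₊ : ℝ) + δ := by
      have := Nat.lt_floor_add_one (t / δ)
      rw [div_lt_iff₀ hδ] at this
      rw [min_eq_left hT]
      linarith
    refine ⟨⟨mul_nonneg hδ.le (Nat.cast_nonneg _), h1.trans hT⟩, ?_⟩
    change |t - δ * (⌊min t T / δ⌋₊ : ℝ)| < δ
    rw [abs_lt]
    constructor <;> linarith

/-- Simple functions that approximate finitely many coefficients uniformly on `[0, T]`. -/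
lemma exists_simpleFunc_coeff {u : ℝ → ℤ → ℂ} (hu : ∀ k, Continuous fun t => u t k)
    (h0 : ∀ t, u t 0 = 0) (K : Finset ℤ) (T : ℝ) {ε : ℝ} (hε : 0 < ε) :
    ∃ s : SimpleFunc ℝ (ℤ → ℂ), (∀ t, s t 0 = 0) ∧ (∀ t, ∀ k ∉ K, s t k = 0) ∧
      ∀ t ∈ Icc 0 T, ∀ k ∈ K, ‖(k : ℂ) ^ 2 * (u t k - s t k)‖ ≤ ε := by
  have hF : Continuous fun t (k : K) => ((k : ℤ) : ℂ) ^ 2 * u t k :=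
    continuous_pi fun k => continuous_const.mul (hu k)
  obtain ⟨δ, hδ, h⟩ := Metric.uniformContinuousOn_iff.1
    ((isCompact_Icc (a := (0 : ℝ)) (b := T)).uniformContinuousOn_of_continuous hF.continuousOn) ε hε
  obtain ⟨τ, hτ⟩ := exists_simpleFunc_near_id (T := T) hδ
  refine ⟨τ.map fun r k => if k ∈ K then u r k else 0, fun t => ?_, fun t k hk => ?_,
    fun t ht k hk => ?_⟩
  · simp [h0]
  · simp [hk]
  · have h1 := h t ht (τ t) (hτ t ht).1 (hτ t ht).2
    have h2 := (dist_le_pi_dist _ _ (⟨k, hk⟩ : K)).trans h1.le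
    simpa [hk, dist_eq_norm, mul_sub] using h2

lemma tendsto_zero_of_pow {ι : Type*} {l : Filter ι} {F : ι → ℝ≥0∞} {p : ℕ} (hp : p ≠ 0)
    (h : Tendsto (fun i => F i ^ p) l (𝓝 0)) : Tendsto F l (𝓝 0) := by
  have h5 := (ENNReal.continuous_rpow_const (y := (p : ℝ)⁻¹)).continuousAt.tendsto.comp h
  simp only [Function.comp_def, ← ENNReal.rpow_natCast] at h5
  simp only [ENNReal.rpow_rpow_inv (Nat.cast_ne_zero.2 hp)] at h5
  rwa [ENNReal.zero_rpow_of_pos (by positivity)] at h5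

/-- Membership in `L^r(0, T; X)` of a family of Fourier series, when the norm of `X` is controlled
by a weighted `ℓ^p` norm of the coefficients. -/
lemma inBochner_synth {N : (ℝ → ℝ) → ℝ≥0∞} {p : ℕ} (hp : p ≠ 0) {c : ℝ≥0∞} (hc : c ≠ ⊤)
    (hN : ∀ a : ℤ → ℂ, a 0 = 0 → (Summable fun k => ‖a k‖) →
      N (synth a) ^ p ≤ c * ∑' k : ℤ, ‖(k : ℂ) ^ 2 * a k‖ₑ ^ p)
    {u : ℝ → ℤ → ℂ} (h0 : ∀ t, u t 0 = 0) (hu : ∀ k, Continuous fun t => u t k)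
    (hs : ∀ t, Summable fun k => ‖u t k‖) {T : ℝ}
    (hfin : ∀ᵐ t ∂(volume.restrict (Ioo 0 T)), ∑' k : ℤ, ‖(k : ℂ) ^ 2 * u t k‖ₑ ^ p < ⊤) {r : ℝ}
    (hint : ∫⁻ t in Ioo 0 T, N (synth (u t)) ^ r < ⊤) :
    InBochner N r T (fun t => synth (u t)) := by
  refine ⟨?_, hint⟩
  -- the frequencies `|k| ≤ n` are approximated up to a total error `1 / (n + 1)`
  let K : ℕ → Finset ℤ := fun n => Finset.Icc (-(n : ℤ)) n
  let ε : ℕ → ℝ := fun n => 1 / ((n + 1) * ((K n).card + 1))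
  have hε : ∀ n, 0 < ε n := fun n => by positivity
  have hε1 : ∀ n, ε n ≤ 1 := fun n => by
    refine (div_le_one (by positivity)).2 ?_
    exact one_le_mul_of_one_le_of_one_le (by linarith [n.cast_nonneg (α := ℝ)])
      (by linarith [(K n).card.cast_nonneg (α := ℝ)])
  choose s hs0 hsK hsu using fun n => exists_simpleFunc_coeff hu h0 (K n) T (hε n)
  have hsum : ∀ n t, Summable fun k => ‖s n t k‖ := fun n t =>
    summable_of_ne_finset_zero (s := K n) fun k hk => by rw [hsK n t k hk, norm_zero]
  refine ⟨fun n => (s n).map synth, fun n t => ?_, ?_⟩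
  · have h1 := hN (s n t) (hs0 n t) (hsum n t)
    rw [tsum_eq_sum (s := K n) fun k hk => by simp [hsK n t k hk, hp]] at h1
    have h2 : N (synth (s n t)) ^ p < ⊤ :=
      h1.trans_lt (ENNReal.mul_lt_top hc.lt_top (ENNReal.sum_lt_top.2 fun k _ =>
        ENNReal.pow_lt_top enorm_lt_top))
    rw [SimpleFunc.map_apply]
    exact (ENNReal.pow_lt_top_iff.1 h2).resolve_right hp
  · filter_upwards [hfin, ae_restrict_mem measurableSet_Ioo] with t ht htT
    have key : ∀ n, N (synth (u t) - synth (s n t)) ^ p ≤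
        c * (ENNReal.ofReal (1 / (n + 1)) +
          ∑' k : {k // k ∉ K n}, ‖(k : ℂ) ^ 2 * u t k‖ₑ ^ p) := fun n => by
      rw [synth_sub (hs t) (hsum n t)]
      refine (hN _ (by simp [h0, hs0]) ?_).trans (mul_le_mul_right ?_ c)
      · refine Summable.of_nonneg_of_le (fun _ => norm_nonneg _) (fun k => norm_sub_le _ _)
          ((hs t).add (hsum n t))
      · rw [← ENNReal.sum_add_tsum_compl (K n)]
        refine add_le_add ?_ (ENNReal.tsum_le_tsum fun k => ?_)
        · calc ∑ k ∈ K n, ‖(k : ℂ) ^ 2 * (u t - s n t) k‖ₑ ^ p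
              ≤ ∑ k ∈ K n, ENNReal.ofReal (ε n) := by
                refine Finset.sum_le_sum fun k hk => ?_
                rw [← ofReal_norm, ← ENNReal.ofReal_pow (norm_nonneg _)]
                refine ENNReal.ofReal_le_ofReal ?_
                have h1 := hsu n t ⟨htT.1.le, htT.2.le⟩ k hk
                exact (pow_le_pow_left₀ (norm_nonneg _) h1 p).trans
                  (pow_le_of_le_one (hε n).le (hε1 n) hp)
            _ = ENNReal.ofReal ((K n).card * ε n) := by
                rw [Finset.sum_const, nsmul_eq_mul, ENNReal.ofReal_mul (by positivity),
                  ENNReal.ofReal_natCast]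
            _ ≤ _ := by
                refine ENNReal.ofReal_le_ofReal ?_
                simp only [ε]
                rw [mul_one_div, div_le_div_iff₀ (by positivity) (by positivity)]
                have : (0 : ℝ) ≤ n + 1 := by positivity
                nlinarith
        · have hk : (k : ℤ) ∉ K n := fun h => k.2 (by simpa using h)
          simp [hsK n t k hk]
    have h1 : Tendsto (fun n : ℕ => c * (ENNReal.ofReal (1 / (n + 1)) +
        ∑' k : {k // k ∉ K n}, ‖(k : ℂ) ^ 2 * u t k‖ₑ ^ p)) atTop (𝓝 0) := by
      have h2 : Tendsto (fun n : ℕ => ENNReal.ofReal (1 / ((n : ℝ) + 1))) atTop (𝓝 0) := by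
        simpa using ENNReal.tendsto_ofReal tendsto_one_div_add_atTop_nhds_zero_nat
      have h3 := (ENNReal.tendsto_tsum_compl_atTop_zero ht.ne).comp
        (Finset.tendsto_Icc_neg (R := ℤ))
      simpa using ENNReal.Tendsto.const_mul (h2.add h3) (.inr hc)
    have h4 := tendsto_of_tendsto_of_tendsto_of_le_of_le tendsto_const_nhds h1
      (fun _ => zero_le) key
    exact tendsto_zero_of_pow hp h4

/-! ### Regularity of functions with a bounded family of Fourier coefficients -/

/-- Sequences in the weighted `ℓ²` space with weight `|k|` are summable, i.e. `Ḣ¹` embeds into the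
Wiener algebra. -/
lemma summable_of_weighted {B : ℤ → ℝ} (hB : ∀ k, 0 ≤ B k) (h0 : B 0 = 0)
    (h : Summable fun k : ℤ => (|(k : ℝ)| * B k) ^ 2) : Summable B := by
  have hinv : Summable fun k : ℤ => 1 / (k : ℝ) ^ 2 := Real.summable_one_div_int_pow.2 one_lt_two
  refine Summable.of_nonneg_of_le hB (fun k => ?_) (hinv.add h)
  rcases eq_or_ne k 0 with rfl | hk
  · simp [h0]
  · have hk' : 0 < |(k : ℝ)| := abs_pos.2 (Int.cast_ne_zero.2 hk)
    have h1 : 1 / (k : ℝ) ^ 2 = |(k : ℝ)|⁻¹ ^ 2 := by rw [inv_pow, sq_abs, one_div]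
    have h2 : B k = |(k : ℝ)|⁻¹ * (|(k : ℝ)| * B k) := by field_simp
    rw [h1]
    nth_rw 1 [h2]
    nlinarith [sq_nonneg (|(k : ℝ)|⁻¹ - |(k : ℝ)| * B k),
      sq_nonneg (|(k : ℝ)|⁻¹ + |(k : ℝ)| * B k)]

namespace IsProfile

variable {E C : ℝ} {u : ℝ → ℤ → ℂ}

lemma bound_nonneg (h : IsProfile E C u) : 0 ≤ E := (wsum_nonneg ∅ 0 (u 0)).trans (h.wiener 0 ∅)

lemma eWiener_zero_le (h : IsProfile E C u) (t : ℝ) : eWiener 0 (u t) ≤ ENNReal.ofReal E :=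
  eWiener_le (h.wiener t)

lemma eSobolev_one_le (h : IsProfile E C u) (t : ℝ) : eSobolev 1 (u t) ≤ ENNReal.ofReal C :=
  eSobolev_le (h.sobolev t)

lemma summable (h : IsProfile E C u) (t : ℝ) : Summable fun k => ‖u t k‖ :=
  summable_norm_of_eWiener (h.zero t) ((h.eWiener_zero_le t).trans_lt ENNReal.ofReal_lt_top)

lemma abs_synth_le (h : IsProfile E C u) (t x : ℝ) : |synth (u t) x| ≤ E := by
  have := (enorm_synth_le (u t) x).trans (h.eWiener_zero_le t)
  rwa [← ofReal_norm, ENNReal.ofReal_le_ofReal_iff h.bound_nonneg] at this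

lemma continuous_term (h : IsProfile E C u) (i : ℕ) (k : ℤ) :
    Continuous fun t => ‖(k : ℂ) ^ i * u t k‖ₑ :=
  (continuous_const.mul (h.continuous k)).enorm

lemma measurable_eWiener (h : IsProfile E C u) (i : ℕ) : Measurable fun t => eWiener i (u t) :=
  Measurable.tsum fun k => (h.continuous_term i k).measurable

lemma measurable_eSobolev (h : IsProfile E C u) (i : ℕ) :
    Measurable fun t => eSobolev i (u t) :=
  Measurable.tsum fun k => ((h.continuous_term i k).measurable.pow_const 2)

lemma lintegral_ofReal_eq {F : ℝ → ℝ} (hF : Continuous F) (h0 : ∀ t, 0 ≤ F t) {T : ℝ}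
    (hT : 0 ≤ T) : ∫⁻ t in Ioo 0 T, ENNReal.ofReal (F t) = ENNReal.ofReal (∫ t in (0)..T, F t) := by
  rw [intervalIntegral.integral_of_le hT, integral_Ioc_eq_integral_Ioo,
    ofReal_integral_eq_lintegral_ofReal
      (hF.integrableOn_Icc.mono_set Ioo_subset_Icc_self) (ae_of_all _ h0)]

lemma lintegral_eWiener_le (h : IsProfile E C u) {T : ℝ} (hT : 0 ≤ T) :
    ∫⁻ t in Ioo 0 T, eWiener 2 (u t) ≤ ENNReal.ofReal C := by
  unfold eWiener
  rw [lintegral_tsum fun k => (h.continuous_term 2 k).aemeasurable, ENNReal.tsum_eq_iSup_sum]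
  refine iSup_le fun S => ?_
  rw [← lintegral_finsetSum S fun k _ => (h.continuous_term 2 k).measurable]
  simp only [← ofReal_wsum]
  rw [lintegral_ofReal_eq ?_ (fun t => wsum_nonneg _ _ _) hT]
  · exact ENNReal.ofReal_le_ofReal (h.wiener_int T hT S)
  · exact (continuous_wsum S 2).comp (continuous_pi h.continuous)

lemma tendsto_integral_qsum (h : IsProfile E C u) {T : ℝ} (hT : 0 ≤ T) :
    Tendsto (fun K => ENNReal.ofReal (∫ t in (0)..T, qsum K 2 (u t))) atTop
      (𝓝 (∫⁻ t in Ioo 0 T, eSobolev 2 (u t))) := by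
  have hm : ∀ k : ℤ, Measurable fun t => ‖(k : ℂ) ^ 2 * u t k‖ₑ ^ 2 := fun k =>
    (h.continuous_term 2 k).measurable.pow_const 2
  unfold eSobolev
  rw [lintegral_tsum fun k => (hm k).aemeasurable]
  refine Tendsto.congr (fun K => ?_) ENNReal.summable.hasSum
  rw [← lintegral_ofReal_eq (F := fun t => qsum K 2 (u t))
    ((continuous_qsum K 2).comp (continuous_pi h.continuous)) (fun t => qsum_nonneg _ _ _) hT]
  simp only [ofReal_qsum]
  exact (lintegral_finsetSum K fun k _ => hm k).symm

lemma lintegral_eSobolev_le (h : IsProfile E C u) {T : ℝ} (hT : 0 ≤ T) :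
    ∫⁻ t in Ioo 0 T, eSobolev 2 (u t) ≤ ENNReal.ofReal C :=
  le_of_tendsto' (h.tendsto_integral_qsum hT) fun K =>
    ENNReal.ofReal_le_ofReal (h.sobolev_int T hT K)

lemma ae_eWiener_lt_top (h : IsProfile E C u) {T : ℝ} (hT : 0 ≤ T) :
    ∀ᵐ t ∂(volume.restrict (Ioo 0 T)), eWiener 2 (u t) < ⊤ :=
  ae_lt_top (h.measurable_eWiener 2)
    ((h.lintegral_eWiener_le hT).trans_lt ENNReal.ofReal_lt_top).ne

lemma ae_eSobolev_lt_top (h : IsProfile E C u) {T : ℝ} (hT : 0 ≤ T) :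
    ∀ᵐ t ∂(volume.restrict (Ioo 0 T)), eSobolev 2 (u t) < ⊤ :=
  ae_lt_top (h.measurable_eSobolev 2)
    ((h.lintegral_eSobolev_le hT).trans_lt ENNReal.ofReal_lt_top).ne

/-- A norm controlled by `∑ k² |û(k)|` gives membership in `L¹(0, T; X)`. -/
lemma inBochner_one (h : IsProfile E C u) {N : (ℝ → ℝ) → ℝ≥0∞} {c : ℝ≥0∞} (hc : c ≠ ⊤)
    (hN : ∀ a : ℤ → ℂ, a 0 = 0 → N (synth a) ≤ c * eWiener 2 a) {T : ℝ} (hT : 0 ≤ T) :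
    InBochner N 1 T (fun t => synth (u t)) := by
  refine inBochner_synth one_ne_zero hc (fun a ha _ => ?_) h.zero h.continuous h.summable ?_ ?_
  · simpa only [pow_one, eWiener] using hN a ha
  · simpa only [pow_one, eWiener] using h.ae_eWiener_lt_top hT
  · simp only [ENNReal.rpow_one]
    refine (lintegral_mono fun t => hN (u t) (h.zero t)).trans_lt ?_
    rw [lintegral_const_mul _ (h.measurable_eWiener 2)]
    exact ENNReal.mul_lt_top hc.lt_top
      ((h.lintegral_eWiener_le hT).trans_lt ENNReal.ofReal_lt_top)

/-- A norm controlled by `∑ |k| |û(k)|` gives membership in `L²(0, T; X)`, by interpolation between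
the bound for `∑ |û(k)|` and the time integral of `∑ k² |û(k)|`. -/
lemma inBochner_two (h : IsProfile E C u) {N : (ℝ → ℝ) → ℝ≥0∞} {c : ℝ≥0∞} (hc : c ≠ ⊤)
    (hN : ∀ a : ℤ → ℂ, a 0 = 0 → N (synth a) ≤ c * eWiener 1 a) {T : ℝ} (hT : 0 ≤ T) :
    InBochner N 2 T (fun t => synth (u t)) := by
  refine inBochner_synth one_ne_zero hc (fun a ha _ => ?_) h.zero h.continuous h.summable ?_ ?_
  · simpa only [pow_one, eWiener] using (hN a ha).trans (mul_le_mul_right (eWiener_mono one_le_two ha) c)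
  · simpa only [pow_one, eWiener] using h.ae_eWiener_lt_top hT
  · have key : ∀ t, N (synth (u t)) ^ (2 : ℝ) ≤ c ^ 2 * ENNReal.ofReal E * eWiener 2 (u t) :=
      fun t => by
        rw [ENNReal.rpow_ofNat]
        calc N (synth (u t)) ^ 2 ≤ (c * eWiener 1 (u t)) ^ 2 :=
              pow_le_pow_left' (hN (u t) (h.zero t)) 2
          _ = c ^ 2 * eWiener 1 (u t) ^ 2 := mul_pow _ _ _
          _ ≤ c ^ 2 * (ENNReal.ofReal E * eWiener 2 (u t)) := by
              gcongr
              exact (eWiener_one_sq_le _).trans (mul_le_mul_left (h.eWiener_zero_le t) _)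
          _ = _ := (mul_assoc _ _ _).symm
    refine (lintegral_mono key).trans_lt ?_
    rw [lintegral_const_mul _ (h.measurable_eWiener 2)]
    exact ENNReal.mul_lt_top (ENNReal.mul_lt_top (ENNReal.pow_lt_top hc.lt_top)
      ENNReal.ofReal_lt_top) ((h.lintegral_eWiener_le hT).trans_lt ENNReal.ofReal_lt_top)

lemma inBochner_hdotNorm_two (h : IsProfile E C u) {T : ℝ} (hT : 0 ≤ T) :
    InBochner (hdotNorm 2) 2 T (fun t => synth (u t)) := by
  have hN : ∀ a : ℤ → ℂ, a 0 = 0 → (Summable fun k => ‖a k‖) →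
      hdotNorm 2 (synth a) ^ 2 ≤ eSobolev 2 a := fun a h0 ha =>
    hdotNorm_synth_sq_le (i := 2) (by norm_num) h0 ha
  refine inBochner_synth (c := 1) two_ne_zero ENNReal.one_ne_top (fun a h0 ha => ?_) h.zero
    h.continuous h.summable (h.ae_eSobolev_lt_top hT) ?_
  · rw [one_mul]
    exact hN a h0 ha
  · simp only [ENNReal.rpow_ofNat]
    exact (lintegral_mono fun t => hN (u t) (h.zero t) (h.summable t)).trans_lt
      ((h.lintegral_eSobolev_le hT).trans_lt ENNReal.ofReal_lt_top)

lemma hdotNorm_one_synth_le {a : ℤ → ℂ} (h0 : a 0 = 0) :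
    hdotNorm 1 (synth a) ≤ 1 * eWiener 1 a := by
  rcases lt_or_ge (eWiener 1 a) ⊤ with h1 | h1
  · rw [one_mul, ← ENNReal.pow_le_pow_left_iff two_ne_zero]
    exact (hdotNorm_synth_sq_le (i := 1) (by norm_num) h0 (summable_norm_of_eWiener h0 h1)).trans
      (eSobolev_le_eWiener_sq 1 a)
  · rw [top_le_iff.1 h1, one_mul]
    exact le_top

/-- Each coefficient is controlled, uniformly in time, by a sequence with square summable
`|k| B k`. -/
lemma exists_bound (h : IsProfile E C u) : ∃ B : ℤ → ℝ, (∀ t k, ‖u t k‖ ≤ B k) ∧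
    (Summable fun k : ℤ => (|(k : ℝ)| * B k) ^ 2) ∧ Summable B := by
  have hb : ∀ k, BddAbove (range fun t => ‖u t k‖) := fun k => ⟨E, by
    rintro _ ⟨t, rfl⟩
    simpa [wsum] using h.wiener t {k}⟩
  -- times at which the coefficients are, up to a factor 2, the largest
  have hτ : ∀ k, ∃ τ, ∀ t, ‖u t k‖ ≤ 2 * ‖u τ k‖ := fun k => by
    rcases (Real.iSup_nonneg fun t => norm_nonneg (u t k)).eq_or_lt with h0 | h0
    · exact ⟨0, fun t => (le_ciSup (hb k) t).trans (by rw [← h0]; positivity)⟩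
    · obtain ⟨τ, hτ⟩ := exists_lt_of_lt_ciSup (half_lt_self h0)
      exact ⟨τ, fun t => (le_ciSup (hb k) t).trans (by linarith)⟩
  choose τ hτ using hτ
  have hsq : Summable fun k : ℤ => (|(k : ℝ)| * (2 * ‖u (τ k) k‖)) ^ 2 := by
    have : Summable fun k : ℤ => (|(k : ℝ)| * ‖u (τ k) k‖) ^ 2 :=
      summable_of_sum_le (fun _ => sq_nonneg _) (h.sup · τ)
    exact (this.mul_left 4).congr fun k => by ring
  exact ⟨fun k => 2 * ‖u (τ k) k‖, fun t k => hτ k t, hsq,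
    summable_of_weighted (fun _ => by positivity) (by simp [h.zero]) hsq⟩

lemma continuous_uncurry (h : IsProfile E C u) :
    Continuous (Function.uncurry fun t => synth (u t)) := by
  obtain ⟨B, hB, -, hs⟩ := h.exists_bound
  refine Complex.continuous_re.comp (continuous_tsum
    (f := fun k (q : ℝ × ℝ) => u q.1 k * char k q.2) (fun k => ?_) hs fun k q => ?_)
  · exact ((h.continuous k).comp continuous_fst).mul ((continuous_char k).comp continuous_snd)
  · rw [norm_term]
    exact hB _ _

instance (T : ℝ) : IsFiniteMeasure (cylinder T) := by unfold cylinder; infer_instance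

lemma memLp_uncurry (h : IsProfile E C u) (p : ℝ≥0∞) (T : ℝ) :
    MemLp (Function.uncurry fun t => synth (u t)) p (cylinder T) :=
  MemLp.of_bound h.continuous_uncurry.aestronglyMeasurable E
    (ae_of_all _ fun q => h.abs_synth_le q.1 q.2)

lemma abs_integral_mul_le {v φ : ℝ → ℝ} {A S : ℝ} (hA : 0 ≤ A) (hv : ∀ x, |v x| ≤ A)
    (hφ : Continuous φ) (hS : ∫ x in (-π)..π, |φ x| ≤ S) :
    |∫ x in (-π)..π, v x * φ x| ≤ A * S := by
  have hπ : (-π : ℝ) ≤ π := by linarith [Real.pi_pos]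
  have h1 : |∫ x in (-π)..π, v x * φ x| ≤ ∫ x in (-π)..π, A * |φ x| := by
    rw [← Real.norm_eq_abs]
    refine intervalIntegral.norm_integral_le_of_norm_le hπ (ae_of_all _ fun x _ => ?_)
      ((continuous_const.mul hφ.abs).intervalIntegrable _ _)
    rw [norm_mul]
    exact mul_le_mul_of_nonneg_right (hv x) (abs_nonneg _)
  rw [intervalIntegral.integral_const_mul] at h1
  exact h1.trans (mul_le_mul_of_nonneg_left hS hA)

lemma derivIsMeasure_zero (h : IsProfile E C u) {T : ℝ} (hT : 0 ≤ T) :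
    DerivIsMeasure 0 T (fun t => synth (u t)) := by
  refine ⟨memLp_one_iff_integrable.1 (h.memLp_uncurry 1 T), E * T, fun φ hφ _ _ S hS => ?_⟩
  have h1 := intervalIntegral.norm_integral_le_of_norm_le_const (a := 0) (b := T) (C := E * S)
    (f := fun t => ∫ x in (-π)..π, synth (u t) x * iteratedDeriv 0 (φ t) x) fun t _ => by
      rw [iteratedDeriv_zero]
      exact abs_integral_mul_le h.bound_nonneg (h.abs_synth_le t)
        (hφ.continuous.comp (Continuous.prodMk_right t)) (hS t)
  rw [sub_zero, abs_of_nonneg hT] at h1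
  calc _ ≤ E * S * T := h1
    _ = _ := by ring

lemma integral_synth_mul_deriv_two {a : ℤ → ℂ} (h0 : a 0 = 0) (h2 : eWiener 2 a < ⊤) {φ : ℝ → ℝ}
    (hφ : ContDiff ℝ ∞ φ) (hper : Function.Periodic φ (2 * π)) :
    ∫ x in (-π)..π, synth a x * iteratedDeriv 2 φ x =
      ∫ x in (-π)..π, synth (diffCoeff (diffCoeff a)) x * φ x := by
  have h1 : eWiener 1 a < ⊤ := (eWiener_mono one_le_two h0).trans_lt h2
  have h1' : eWiener 1 (diffCoeff a) < ⊤ := by rwa [eWiener_diffCoeff]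
  have hφ' : ContDiff ℝ ∞ (deriv φ) := hφ.deriv'
  have hper' : Function.Periodic (deriv φ) (2 * π) := fun x => by
    rw [← deriv_comp_add_const, funext hper]
  rw [iteratedDeriv_succ, iteratedDeriv_one,
    integral_mul_deriv_periodic (hasDerivAt_synth_diffCoeff h0 h1)
      (fun x => (hφ'.differentiable (by simp) x).hasDerivAt) (continuous_synth_diffCoeff h1)
      (hφ'.continuous_deriv (by simp)) (synth_periodic a) hper',
    integral_mul_deriv_periodic (hasDerivAt_synth_diffCoeff (diffCoeff_zero a) h1')
      (fun x => (hφ.differentiable (by simp) x).hasDerivAt) (continuous_synth_diffCoeff h1')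
      (hφ.continuous_deriv (by simp)) (synth_periodic _) hper, neg_neg]

/-- The second derivative is in fact in `L¹(0, T; L^∞)`, with norm at most `∑ k² |û(k)|`. -/
lemma derivIsMeasure_two (h : IsProfile E C u) {T : ℝ} (hT : 0 ≤ T) :
    DerivIsMeasure 2 T (fun t => synth (u t)) := by
  refine ⟨memLp_one_iff_integrable.1 (h.memLp_uncurry 1 T),
    ∫ t in (0)..T, (eWiener 2 (u t)).toReal, fun φ hφ hper _ S hS => ?_⟩
  have hint : IntervalIntegrable (fun t => (eWiener 2 (u t)).toReal) volume 0 T := by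
    rw [intervalIntegrable_iff_integrableOn_Ioo_of_le hT]
    exact integrable_toReal_of_lintegral_ne_top (h.measurable_eWiener 2).aemeasurable
      ((h.lintegral_eWiener_le hT).trans_lt ENNReal.ofReal_lt_top).ne
  rw [← intervalIntegral.integral_mul_const, ← Real.norm_eq_abs]
  refine intervalIntegral.norm_integral_le_of_norm_le hT ?_ (hint.mul_const S)
  have hae := h.ae_eWiener_lt_top hT
  rw [restrict_Ioo_eq_restrict_Ioc, ae_restrict_iff' measurableSet_Ioc] at hae
  filter_upwards [hae] with t ht htT
  have hφt : ContDiff ℝ ∞ (φ t) := hφ.comp (contDiff_prodMk_right t)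
  rw [integral_synth_mul_deriv_two (h.zero t) (ht htT) hφt (hper t)]
  refine abs_integral_mul_le ENNReal.toReal_nonneg (fun x => ?_) hφt.continuous (hS t)
  have h1 := enorm_synth_le (diffCoeff (diffCoeff (u t))) x
  rw [eWiener_diffCoeff, eWiener_diffCoeff] at h1
  have := ENNReal.toReal_mono (ht htT).ne h1
  simpa using this

theorem wienerRegularity (h : IsProfile E C u) {T : ℝ} (hT : 0 ≤ T) :
    WienerRegularity T (fun t => synth (u t)) where
  bounded := h.memLp_uncurry ⊤ T
  lipschitz := h.inBochner_two (c := 2) ENNReal.ofNat_ne_top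
    (fun a h0 => (sobolevNorm_one_synth_le ⊤ h0).trans (by simp)) hT
  holder α hα := h.inBochner_one (c := 4) ENNReal.ofNat_ne_top
    (fun a h0 => holderNorm_synth_le (hα.le.trans (by norm_num)) h0) hT
  measure := ⟨h.derivIsMeasure_zero hT, h.derivIsMeasure_two hT⟩
  hdot := h.inBochner_two ENNReal.one_ne_top (fun a h0 => hdotNorm_one_synth_le h0) hT

lemma inBochner_sobolevNorm (h : IsProfile E C u) {T : ℝ} (hT : 0 ≤ T) :
    InBochner (sobolevNorm 1 1) 1 T (fun t => synth (u t)) := by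
  refine h.inBochner_one (c := 2 * torus univ ^ (1 : ℝ≥0∞).toReal⁻¹) ?_ (fun a h0 => ?_) hT
  · simp [ENNReal.mul_eq_top]
  · exact (sobolevNorm_one_synth_le 1 h0).trans (mul_le_mul_right (eWiener_mono one_le_two h0) _)

/-- Continuity in time with values in `Ḣ¹`, by dominated convergence with the bounds of
`exists_bound`. -/
theorem inCont (h : IsProfile E C u) (T : ℝ) : InCont (hdotNorm 1) T (fun t => synth (u t)) := by
  have hN : ∀ a : ℤ → ℂ, a 0 = 0 → (Summable fun k => ‖a k‖) →
      hdotNorm 1 (synth a) ^ 2 ≤ eSobolev 1 a := fun a h0 ha =>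
    hdotNorm_synth_sq_le (i := 1) (by norm_num) h0 ha
  constructor
  · intro t _
    have := (hN (u t) (h.zero t) (h.summable t)).trans_lt
      ((h.eSobolev_one_le t).trans_lt ENNReal.ofReal_lt_top)
    exact (ENNReal.pow_lt_top_iff.1 this).resolve_right two_ne_zero
  · intro t₀ _
    refine Tendsto.mono_left ?_ nhdsWithin_le_nhds
    obtain ⟨B, hB, hB2, -⟩ := h.exists_bound
    have h1 : Tendsto (fun t => ∑' k : ℤ, ‖(k : ℂ) ^ 1 * (u t - u t₀) k‖ ^ 2) (𝓝 t₀) (𝓝 0) := by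
      have h2 := tendsto_tsum_of_dominated_convergence (𝓕 := 𝓝 t₀)
        (f := fun t (k : ℤ) => ‖(k : ℂ) ^ 1 * (u t - u t₀) k‖ ^ 2) (g := fun _ => 0)
        (bound := fun k : ℤ => 4 * (|(k : ℝ)| * B k) ^ 2) (hB2.mul_left 4) (fun k => ?_)
        (.of_forall fun t k => ?_)
      · simpa using h2
      · have h3 : Continuous fun t => ‖(k : ℂ) ^ 1 * (u t - u t₀) k‖ ^ 2 :=
          ((continuous_const.mul ((h.continuous k).sub continuous_const)).norm).pow 2
        simpa using h3.tendsto t₀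
      · rw [Real.norm_of_nonneg (by positivity), norm_mul, pow_one, Complex.norm_intCast]
        have h3 : ‖(u t - u t₀) k‖ ≤ 2 * B k :=
          (norm_sub_le _ _).trans (by linarith [hB t k, hB t₀ k])
        calc (|(k : ℝ)| * ‖(u t - u t₀) k‖) ^ 2 ≤ (|(k : ℝ)| * (2 * B k)) ^ 2 := by gcongr
          _ = _ := by ring
    have hsq : ∀ t, hdotNorm 1 (synth (u t) - synth (u t₀)) ^ 2
        ≤ ENNReal.ofReal (∑' k : ℤ, ‖(k : ℂ) ^ 1 * (u t - u t₀) k‖ ^ 2) := fun t => by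
      have hd : Summable fun k => ‖(u t - u t₀) k‖ :=
        Summable.of_nonneg_of_le (fun _ => norm_nonneg _) (fun k => norm_sub_le _ _)
          ((h.summable t).add (h.summable t₀))
      rw [synth_sub (h.summable t) (h.summable t₀), ENNReal.ofReal_tsum_of_nonneg]
      · refine (hN _ (by simp [h.zero]) hd).trans (ENNReal.tsum_le_tsum fun k => ?_)
        rw [← ofReal_norm, ENNReal.ofReal_pow (norm_nonneg _)]
      · exact fun _ => by positivity
      · refine Summable.of_nonneg_of_le (fun _ => by positivity) (fun k => ?_) (hB2.mul_left 4)
        rw [norm_mul, pow_one, Complex.norm_intCast]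
        have h3 : ‖(u t - u t₀) k‖ ≤ 2 * B k :=
          (norm_sub_le _ _).trans (by linarith [hB t k, hB t₀ k])
        calc (|(k : ℝ)| * ‖(u t - u t₀) k‖) ^ 2 ≤ (|(k : ℝ)| * (2 * B k)) ^ 2 := by gcongr
          _ = _ := by ring
    have h4 := tendsto_of_tendsto_of_tendsto_of_le_of_le tendsto_const_nhds
      (by simpa using ENNReal.tendsto_ofReal h1) (fun _ => zero_le) hsq
    exact tendsto_zero_of_pow two_ne_zero h4

end IsProfile

/-! ### The flux in terms of Fourier coefficients -/

lemma diffCoeff_conj {a : ℤ → ℂ} (ha : ∀ k, a (-k) = conj (a k)) (k : ℤ) :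
    diffCoeff a (-k) = conj (diffCoeff a k) := by
  simp [diffCoeff, ha]

lemma ofReal_synth_of_conj {a : ℤ → ℂ} (hs : Summable fun k => ‖a k‖)
    (ha : ∀ k, a (-k) = conj (a k)) (x : ℝ) : (synth a x : ℂ) = synthC a x := by
  rw [ofReal_synth hs, herm_eq_self ha]

lemma ofReal_integral_synth_mul {a : ℤ → ℂ} (hs : Summable fun k => ‖a k‖)
    (ha : ∀ k, a (-k) = conj (a k)) (ψ : ℝ → ℝ) :
    ((∫ x in (-π)..π, synth a x * ψ x : ℝ) : ℂ) = ∫ x in (-π)..π, synthC a x * ψ x := by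
  rw [← intervalIntegral.integral_ofReal]
  simp only [Complex.ofReal_mul, ofReal_synth_of_conj hs ha]

lemma synth_combination {a c : ℤ → ℂ} (ha : Summable fun k => ‖a k‖)
    (hc : Summable fun k => ‖c k‖) (α β : ℝ) (x : ℝ) :
    synth (fun k => α * a k + β * c k) x = α * synth a x + β * synth c x := by
  have h1 : synthC (fun k => α * a k + β * c k) x = α * synthC a x + β * synthC c x := by
    rw [synthC, synthC, synthC, ← tsum_mul_left, ← tsum_mul_left,
      ← ((summable_term ha x).mul_left _).tsum_add ((summable_term hc x).mul_left _)]
    exact tsum_congr fun k => by ring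
  rw [synth, h1, Complex.add_re, Complex.re_ofReal_mul, Complex.re_ofReal_mul, synth, synth]

lemma diffCoeff_combination (a c : ℤ → ℂ) (α β : ℝ) :
    diffCoeff (fun k => α * a k + β * c k) = fun k => α * diffCoeff a k + β * diffCoeff c k := by
  ext k
  simp only [diffCoeff]
  ring

/-- The weak form of `∂ₓ[(u + m) ∂ₓ w]` at a fixed time, by Parseval's identity. -/
lemma hasSum_flux {m : ℝ} {u w : ℤ → ℂ} (hu : Summable fun k => ‖u k‖)
    (huc : ∀ k, u (-k) = conj (u k)) (hwc : ∀ k, w (-k) = conj (w k))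
    (hw : eWiener 1 w < ⊤) {φ : ℝ → ℝ} (hφ : ContDiff ℝ 1 φ)
    (hper : Function.Periodic φ (2 * π)) :
    HasSum (fun k : ℤ => ((m * k ^ 2 : ℝ) * w k + k * conv u w k) * ∫ x in (-π)..π, char k x * φ x)
      ((∫ x in (-π)..π, (m * synth (diffCoeff w) x + synth u x * synth (diffCoeff w) x) *
        deriv φ x : ℝ) : ℂ) := by
  have hdw : Summable fun k => ‖diffCoeff w k‖ :=
    summable_norm_of_eWiener (i := 0) (diffCoeff_zero w) (by rwa [eWiener_diffCoeff])
  obtain ⟨hs, hmul⟩ := synthC_mul hu hdw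
  set c : ℤ → ℂ := fun k => m * diffCoeff w k + ∑' j, u (k - j) * diffCoeff w j with hc
  have hcs : Summable fun k => ‖c k‖ := by
    refine Summable.of_nonneg_of_le (fun _ => norm_nonneg _) (fun k => norm_add_le _ _)
      (Summable.add ?_ hs)
    simpa only [norm_mul] using hdw.mul_left ‖(m : ℂ)‖
  have hck : ∀ k, c k = Complex.I * (m * k * w k + conv u w k) := fun k => by
    have : ∑' j, u (k - j) * diffCoeff w j = Complex.I * conv u w k := by
      rw [conv, ← tsum_mul_left]
      exact tsum_congr fun j => by rw [diffCoeff]; ring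
    have e : c k = m * diffCoeff w k + ∑' j, u (k - j) * diffCoeff w j := rfl
    rw [e, this, diffCoeff]
    ring
  have hcx : ∀ x, ((m * synth (diffCoeff w) x + synth u x * synth (diffCoeff w) x : ℝ) : ℂ)
      = synthC c x := fun x => by
    push_cast
    rw [ofReal_synth_of_conj hu huc, ofReal_synth_of_conj hdw (diffCoeff_conj hwc), hmul,
      synthC, synthC, synthC, ← tsum_mul_left,
      ← ((summable_term hdw x).mul_left _).tsum_add (summable_term hs x)]
    exact tsum_congr fun k => by rw [hc]; ring
  have hφ' : Continuous fun x => ((deriv φ x : ℝ) : ℂ) :=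
    Complex.continuous_ofReal.comp (hφ.continuous_deriv le_rfl)
  have h := hasSum_integral_synthC hcs (ψ := fun x => ((deriv φ x : ℝ) : ℂ))
    (hφ'.intervalIntegrable _ _)
  rw [← intervalIntegral.integral_ofReal]
  simp only [Complex.ofReal_mul _ (deriv φ _), hcx]
  refine h.congr_fun fun k => ?_
  have hibp : ∫ x in (-π)..π, char k x * ((deriv φ x : ℝ) : ℂ)
      = -∫ x in (-π)..π, k * Complex.I * char k x * φ x :=
    integral_mul_deriv_periodic (hasDerivAt_char k)
      (fun x => ((hφ.differentiable one_ne_zero x).hasDerivAt).ofReal_comp)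
      (continuous_const.mul (continuous_char k)) hφ' (char_periodic k)
      (fun x => by rw [hper])
  simp only [mul_assoc, intervalIntegral.integral_const_mul] at hibp
  rw [hibp, hck]
  push_cast
  linear_combination ((k : ℂ) * (m * k * w k + conv u w k) *
    ∫ x in (-π)..π, char k x * φ x) * Complex.I_sq

/-! ### Pairing with test functions -/

lemma hasDerivAt_fst {φ : ℝ → ℝ → ℝ} (hφ : ContDiff ℝ 1 (Function.uncurry φ)) (t x : ℝ) :
    HasDerivAt (fun r => φ r x) (fderiv ℝ (Function.uncurry φ) (t, x) (1, 0)) t := by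
  have h : HasDerivAt (fun r => (r, x)) ((1 : ℝ), (0 : ℝ)) t :=
    (hasDerivAt_id t).prodMk (hasDerivAt_const t x)
  exact (hφ.differentiable one_ne_zero (t, x)).hasFDerivAt.comp_hasDerivAt (f := fun r => (r, x)) t h

lemma hasDerivAt_snd {φ : ℝ → ℝ → ℝ} (hφ : ContDiff ℝ 1 (Function.uncurry φ)) (t x : ℝ) :
    HasDerivAt (φ t) (fderiv ℝ (Function.uncurry φ) (t, x) (0, 1)) x := by
  have h : HasDerivAt (fun r => (t, r)) ((0 : ℝ), (1 : ℝ)) x :=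
    (hasDerivAt_const x t).prodMk (hasDerivAt_id x)
  exact (hφ.differentiable one_ne_zero (t, x)).hasFDerivAt.comp_hasDerivAt (f := fun r => (t, r)) x h

lemma continuous_deriv_fst {φ : ℝ → ℝ → ℝ} (hφ : ContDiff ℝ 1 (Function.uncurry φ)) :
    Continuous (Function.uncurry fun t x => deriv (fun r => φ r x) t) := by
  have : (Function.uncurry fun t x => deriv (fun r => φ r x) t)
      = fun q => fderiv ℝ (Function.uncurry φ) q (1, 0) :=
    funext fun q => (hasDerivAt_fst hφ q.1 q.2).deriv
  rw [this]
  exact (hφ.continuous_fderiv one_ne_zero).clm_apply continuous_const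

lemma continuous_deriv_snd {φ : ℝ → ℝ → ℝ} (hφ : ContDiff ℝ 1 (Function.uncurry φ)) :
    Continuous (Function.uncurry fun t x => deriv (φ t) x) := by
  have : (Function.uncurry fun t x => deriv (φ t) x)
      = fun q => fderiv ℝ (Function.uncurry φ) q (0, 1) :=
    funext fun q => (hasDerivAt_snd hφ q.1 q.2).deriv
  rw [this]
  exact (hφ.continuous_fderiv one_ne_zero).clm_apply continuous_const

/-- The pairing of the `k`-th character with a function on the torus. -/
def pairing (k : ℤ) (ψ : ℝ → ℝ) : ℂ := ∫ x in (-π)..π, char k x * ψ x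

lemma continuous_pairing {ψ : ℝ → ℝ → ℝ} (hψ : Continuous (Function.uncurry ψ)) (k : ℤ) :
    Continuous fun t => pairing k (ψ t) := by
  refine intervalIntegral.continuous_parametric_intervalIntegral_of_continuous'
    (f := fun t x => char k x * (ψ t x : ℂ)) ?_ _ _
  exact ((continuous_char k).comp continuous_snd).mul (Complex.continuous_ofReal.comp hψ)

lemma exists_bound_Icc {ψ : ℝ → ℝ → ℝ} (hψ : Continuous (Function.uncurry ψ)) (a b : ℝ) :
    ∃ D, 0 ≤ D ∧ ∀ t ∈ Icc a b, ∀ x ∈ Icc (-π) π, ‖ψ t x‖ ≤ D := by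
  obtain ⟨D, hD⟩ := ((isCompact_Icc (a := a) (b := b)).prod
    (isCompact_Icc (a := -π) (b := π))).exists_bound_of_continuousOn hψ.continuousOn
  exact ⟨max D 0, le_max_right _ _, fun t ht x hx => (hD (t, x) ⟨ht, hx⟩).trans (le_max_left _ _)⟩

lemma mem_Icc_of_uIoc {x : ℝ} (hx : x ∈ uIoc (-π) π) : x ∈ Icc (-π) π := by
  rw [uIoc_of_le (by linarith [Real.pi_pos])] at hx
  exact Ioc_subset_Icc_self hx

lemma exists_pairing_bound {ψ : ℝ → ℝ → ℝ} (hψ : Continuous (Function.uncurry ψ)) (T : ℝ) :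
    ∃ D, 0 ≤ D ∧ ∀ k, ∀ t ∈ Icc 0 T, ‖pairing k (ψ t)‖ ≤ D := by
  obtain ⟨D, hD0, hD⟩ := exists_bound_Icc hψ 0 T
  refine ⟨D * |π - -π|, by positivity, fun k t ht => ?_⟩
  refine intervalIntegral.norm_integral_le_of_norm_le_const fun x hx => ?_
  rw [norm_mul, norm_char, one_mul, Complex.norm_real]
  exact hD t ht x (mem_Icc_of_uIoc hx)

lemma hasDerivAt_pairing {φ : ℝ → ℝ → ℝ} (hφ : ContDiff ℝ 1 (Function.uncurry φ)) (k : ℤ)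
    (t : ℝ) : HasDerivAt (fun s => pairing k (φ s))
      (pairing k fun x => deriv (fun r => φ r x) t) t := by
  obtain ⟨D, -, hD⟩ := exists_bound_Icc (continuous_deriv_fst hφ) (t - 1) (t + 1)
  have hc : ∀ s, Continuous fun x => char k x * (φ s x : ℂ) := fun s =>
    (continuous_char k).mul (Complex.continuous_ofReal.comp
      (hφ.continuous.comp (Continuous.prodMk_right s)))
  have hc' : Continuous fun x => char k x * ((deriv (fun r => φ r x) t : ℝ) : ℂ) :=
    (continuous_char k).mul (Complex.continuous_ofReal.comp
      ((continuous_deriv_fst hφ).comp (Continuous.prodMk_right t)))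
  exact (intervalIntegral.hasDerivAt_integral_of_dominated_loc_of_deriv_le
    (F := fun s x => char k x * (φ s x : ℂ))
    (F' := fun s x => char k x * ((deriv (fun r => φ r x) s : ℝ) : ℂ)) (bound := fun _ => D)
    (s := Icc (t - 1) (t + 1)) (Icc_mem_nhds (by linarith) (by linarith))
    (.of_forall fun s => (hc s).aestronglyMeasurable) ((hc t).intervalIntegrable _ _)
    hc'.aestronglyMeasurable (ae_of_all _ fun x hx s hs => by
      rw [norm_mul, norm_char, one_mul, Complex.norm_real]
      exact hD s hs x (mem_Icc_of_uIoc hx))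
    (continuous_const.intervalIntegrable _ _) (ae_of_all _ fun x _ s _ =>
      ((hasDerivAt_fst hφ s x).differentiableAt.hasDerivAt.ofReal_comp).const_mul _)).2

/-! ### The weak formulation -/

lemma integral_cylinder {F : ℝ → ℝ → ℝ} {T : ℝ} (hT : 0 ≤ T)
    (hF : Integrable (Function.uncurry F) (cylinder T)) :
    ∫ t in (0)..T, ∫ x in (-π)..π, F t x = ∫ q, F q.1 q.2 ∂(cylinder T) := by
  rw [intervalIntegral.integral_of_le hT, integral_Ioc_eq_integral_Ioo]
  simp only [← integral_torus]
  exact (integral_prod _ hF).symm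

lemma ae_cylinder_mem (T : ℝ) : ∀ᵐ q ∂(cylinder T), q ∈ Ioo 0 T ×ˢ Ioc (-π) π := by
  rw [cylinder, torus, Measure.prod_restrict]
  exact ae_restrict_mem (measurableSet_Ioo.prod measurableSet_Ioc)

lemma integrable_mul_continuous {F ψ : ℝ → ℝ → ℝ} {T : ℝ}
    (hF : Integrable (Function.uncurry F) (cylinder T)) (hψ : Continuous (Function.uncurry ψ)) :
    Integrable (Function.uncurry fun t x => F t x * ψ t x) (cylinder T) := by
  obtain ⟨D, -, hD⟩ := exists_bound_Icc hψ 0 T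
  refine hF.mul_bdd (c := D) (g := Function.uncurry ψ) hψ.aestronglyMeasurable ?_
  filter_upwards [ae_cylinder_mem T] with q hq
  exact hD q.1 (Ioo_subset_Icc_self hq.1) q.2 (Ioc_subset_Icc_self hq.2)

lemma eWiener_combination_le (i : ℕ) (a c : ℤ → ℂ) (α β : ℝ) :
    eWiener i (fun k => α * a k + β * c k) ≤ ‖α‖ₑ * eWiener i a + ‖β‖ₑ * eWiener i c := by
  rw [eWiener, eWiener, eWiener, ← ENNReal.tsum_mul_left, ← ENNReal.tsum_mul_left,
    ← ENNReal.tsum_add]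
  refine ENNReal.tsum_le_tsum fun k => ?_
  have : (k : ℂ) ^ i * (α * a k + β * c k)
      = (α : ℂ) * ((k : ℂ) ^ i * a k) + (β : ℂ) * ((k : ℂ) ^ i * c k) := by ring
  rw [this]
  refine (enorm_add_le _ _).trans_eq ?_
  have h : ∀ r : ℝ, ‖(r : ℂ)‖ₑ = ‖r‖ₑ := fun r => by
    rw [← ofReal_norm, ← ofReal_norm, Complex.norm_real]
  rw [enorm_mul (α : ℂ), enorm_mul (β : ℂ), h, h]

namespace IsProfile

variable {E C : ℝ} {u v : ℝ → ℤ → ℂ}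

lemma measurable_diff (h : IsProfile E C u) :
    Measurable (Function.uncurry fun t => synth (diffCoeff (u t))) := by
  refine Complex.measurable_re.comp (Measurable.tsum
    (f := fun k (q : ℝ × ℝ) => diffCoeff (u q.1) k * char k q.2) fun k => ?_)
  exact Continuous.measurable ((continuous_const.mul ((h.continuous k).comp continuous_fst)).mul
    ((continuous_char k).comp continuous_snd))

lemma integrable_diff (h : IsProfile E C u) {T : ℝ} (hT : 0 ≤ T) :
    Integrable (Function.uncurry fun t => synth (diffCoeff (u t))) (cylinder T) := by
  refine ⟨h.measurable_diff.aestronglyMeasurable, ?_⟩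
  rw [HasFiniteIntegral, cylinder, lintegral_prod _ h.measurable_diff.enorm.aemeasurable]
  have h1 : ∀ t, ∫⁻ x, ‖synth (diffCoeff (u t)) x‖ₑ ∂torus ≤ eWiener 2 (u t) * torus univ :=
    fun t => by
      rw [← lintegral_const]
      refine lintegral_mono fun x => (enorm_synth_le _ x).trans ?_
      rw [eWiener_diffCoeff]
      exact eWiener_mono one_le_two (h.zero t)
  refine (lintegral_mono h1).trans_lt ?_
  rw [lintegral_mul_const _ (h.measurable_eWiener 2)]
  exact ENNReal.mul_lt_top ((h.lintegral_eWiener_le hT).trans_lt ENNReal.ofReal_lt_top)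
    (measure_lt_top _ _)

lemma integrable_gradient (hu : IsProfile E C u) (hv : IsProfile E C v) (α β : ℝ) {T : ℝ}
    (hT : 0 ≤ T) : Integrable (Function.uncurry fun t x =>
      α * synth (diffCoeff (u t)) x + β * synth (diffCoeff (v t)) x) (cylinder T) :=
  ((hu.integrable_diff hT).const_mul α).add ((hv.integrable_diff hT).const_mul β)

lemma integrable_flux (hu : IsProfile E C u) (hv : IsProfile E C v) (α β : ℝ) {T : ℝ}
    (hT : 0 ≤ T) : Integrable (Function.uncurry fun t x => synth (u t) x *
      (α * synth (diffCoeff (u t)) x + β * synth (diffCoeff (v t)) x)) (cylinder T) :=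
  (integrable_gradient hu hv α β hT).bdd_mul hu.continuous_uncurry.aestronglyMeasurable
    (ae_of_all _ fun q => hu.abs_synth_le q.1 q.2)

/-- Parseval's identity for the pairing of a profile with `ψ` over space and time. -/
lemma hasSum_integral_time (hu : IsProfile E C u) {T : ℝ} (hT : 0 ≤ T) {ψ : ℝ → ℝ → ℝ}
    (hψ : Continuous (Function.uncurry ψ)) :
    HasSum (fun k => ∫ t in (0)..T, u t k * pairing k (ψ t))
      ((∫ t in (0)..T, ∫ x in (-π)..π, synth (u t) x * ψ t x : ℝ) : ℂ) := by
  obtain ⟨B, hB, -, hBs⟩ := hu.exists_bound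
  obtain ⟨D, hD0, hD⟩ := exists_pairing_bound hψ T
  rw [← intervalIntegral.integral_ofReal]
  refine intervalIntegral.hasSum_integral_of_dominated_convergence (fun k _ => B k * D)
    (fun k => ((hu.continuous k).mul (continuous_pairing hψ k)).aestronglyMeasurable)
    (fun k => ae_of_all _ fun t ht => ?_) (ae_of_all _ fun _ _ => hBs.mul_right D)
    (continuous_const.intervalIntegrable _ _) (ae_of_all _ fun t _ => ?_)
  · rw [uIoc_of_le hT] at ht
    rw [norm_mul]
    exact mul_le_mul (hB t k) (hD k t (Ioc_subset_Icc_self ht)) (norm_nonneg _)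
      ((norm_nonneg _).trans (hB t k))
  · rw [ofReal_integral_synth_mul (hu.summable t) (hu.conj_neg t)]
    exact hasSum_integral_synthC (hu.summable t) ((Complex.continuous_ofReal.comp
      (hψ.comp (Continuous.prodMk_right t))).intervalIntegrable _ _)

/-- The flux tested against `∂ₓφ`, as a sum over the frequencies: `hasSum_flux` at almost every time,
and summation under the time integral. -/
lemma hasSum_integral_flux (hu : IsProfile E C u) (hv : IsProfile E C v) {m α β : ℝ}
    (hcont : ∀ k, Continuous fun s => rhs m α β (u s) (v s) k) {T : ℝ} (hT : 0 ≤ T)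
    (hint : ∀ K : Finset ℤ, ∑ k ∈ K, ∫ s in (0)..T, ‖rhs m α β (u s) (v s) k‖ ≤ C)
    {φ : ℝ → ℝ → ℝ} (hφ : ContDiff ℝ 1 (Function.uncurry φ))
    (hper : ∀ t, Function.Periodic (φ t) (2 * π)) :
    HasSum (fun k => ∫ t in (0)..T, -rhs m α β (u t) (v t) k * pairing k (φ t))
      ((∫ t in (0)..T, ∫ x in (-π)..π,
        (m * (α * synth (diffCoeff (u t)) x + β * synth (diffCoeff (v t)) x) + synth (u t) x *
          (α * synth (diffCoeff (u t)) x + β * synth (diffCoeff (v t)) x)) *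
            deriv (φ t) x : ℝ) : ℂ) := by
  obtain ⟨D, hD0, hD⟩ := exists_pairing_bound hφ.continuous T
  have hc : ∀ k, Continuous fun t => -rhs m α β (u t) (v t) k * pairing k (φ t) := fun k =>
    (hcont k).neg.mul (continuous_pairing hφ.continuous k)
  have h := hasSum_integral_of_summable_integral_norm (μ := volume.restrict (Ioc 0 T))
    (F := fun k t => -rhs m α β (u t) (v t) k * pairing k (φ t))
    (fun k => (hc k).integrableOn_Icc.mono_set Ioc_subset_Icc_self) (by
      have hs : Summable fun k => ∫ s in (0)..T, ‖rhs m α β (u s) (v s) k‖ :=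
        summable_of_sum_le (fun k => intervalIntegral.integral_nonneg hT fun _ _ => norm_nonneg _)
          hint
      refine Summable.of_nonneg_of_le (fun k => integral_nonneg fun _ => norm_nonneg _)
        (fun k => ?_) (hs.mul_right D)
      rw [← intervalIntegral.integral_of_le hT, ← intervalIntegral.integral_mul_const]
      refine intervalIntegral.integral_mono_on hT ((hc k).norm.intervalIntegrable _ _)
        (((hcont k).norm.mul continuous_const).intervalIntegrable _ _) fun t ht => ?_
      rw [norm_mul, norm_neg]
      exact mul_le_mul_of_nonneg_left (hD k t ht) (norm_nonneg _))
  have hlim : ∫ t in Ioc 0 T, ∑' k, -rhs m α β (u t) (v t) k * pairing k (φ t)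
      = ((∫ t in (0)..T, ∫ x in (-π)..π,
        (m * (α * synth (diffCoeff (u t)) x + β * synth (diffCoeff (v t)) x) + synth (u t) x *
          (α * synth (diffCoeff (u t)) x + β * synth (diffCoeff (v t)) x)) *
            deriv (φ t) x : ℝ) : ℂ) := by
    rw [← intervalIntegral.integral_ofReal, intervalIntegral.integral_of_le hT]
    refine integral_congr_ae ?_
    have h1 := hu.ae_eWiener_lt_top hT
    have h2 := hv.ae_eWiener_lt_top hT
    rw [restrict_Ioo_eq_restrict_Ioc] at h1 h2
    filter_upwards [h1, h2] with t hut hvt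
    have hu1 := (eWiener_mono one_le_two (hu.zero t)).trans_lt hut
    have hv1 := (eWiener_mono one_le_two (hv.zero t)).trans_lt hvt
    have hs : ∀ {a : ℤ → ℂ}, eWiener 1 a < ⊤ → Summable fun k => ‖diffCoeff a k‖ := fun ha =>
      summable_norm_of_eWiener (i := 0) (diffCoeff_zero _) (by rwa [eWiener_diffCoeff])
    have hw1 : eWiener 1 (fun k => α * u t k + β * v t k) < ⊤ :=
      (eWiener_combination_le 1 _ _ α β).trans_lt (ENNReal.add_lt_top.2
        ⟨ENNReal.mul_lt_top enorm_lt_top hu1, ENNReal.mul_lt_top enorm_lt_top hv1⟩)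
    have key := hasSum_flux (m := m) (hu.summable t) (hu.conj_neg t)
      (w := fun k => α * u t k + β * v t k) (φ := φ t)
      (fun k => by simp [hu.conj_neg t, hv.conj_neg t]) hw1
      (hφ.comp (contDiff_prodMk_right t)) (hper t)
    simp only [diffCoeff_combination, synth_combination (hs hu1) (hs hv1)] at key
    rw [← key.tsum_eq]
    refine tsum_congr fun k => ?_
    rw [rhs, pairing]
    ring
  rw [hlim] at h
  refine h.congr_fun fun k => ?_
  rw [intervalIntegral.integral_of_le hT]

/-- The evolution equations of the Fourier coefficients yield the weak formulation, by integration
by parts in time for each frequency. -/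
theorem weak_formulation (hu : IsProfile E C u) (hv : IsProfile E C v) {m α β : ℝ}
    (hd : ∀ t, 0 < t → ∀ k, HasDerivAt (fun s => u s k) (rhs m α β (u t) (v t) k) t)
    (hcont : ∀ k, Continuous fun s => rhs m α β (u s) (v s) k) {T : ℝ} (hT : 0 ≤ T)
    (hint : ∀ K : Finset ℤ, ∑ k ∈ K, ∫ s in (0)..T, ‖rhs m α β (u s) (v s) k‖ ≤ C)
    {φ : ℝ → ℝ → ℝ} (hφ : IsTest T φ) :
    -(∫ x in (-π)..π, synth (u 0) x * φ 0 x)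
        - ∫ t in (0)..T, ∫ x in (-π)..π, synth (u t) x * deriv (fun r => φ r x) t =
      -(m * ∫ t in (0)..T, ∫ x in (-π)..π,
          (α * synth (diffCoeff (u t)) x + β * synth (diffCoeff (v t)) x) * deriv (φ t) x)
        - ∫ t in (0)..T, ∫ x in (-π)..π, synth (u t) x *
          (α * synth (diffCoeff (u t)) x + β * synth (diffCoeff (v t)) x) * deriv (φ t) x := by
  have hφ' := continuous_deriv_fst hφ.contDiff
  have hA := hu.hasSum_integral_time hT hφ'
  have hB := hasSum_integral_flux hu hv hcont hT hint hφ.contDiff hφ.periodic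
  have hC : HasSum (fun k => u 0 k * pairing k (φ 0))
      ((∫ x in (-π)..π, synth (u 0) x * φ 0 x : ℝ) : ℂ) := by
    rw [ofReal_integral_synth_mul (hu.summable 0) (hu.conj_neg 0)]
    exact hasSum_integral_synthC (hu.summable 0) ((Complex.continuous_ofReal.comp
      (hφ.contDiff.continuous.comp (Continuous.prodMk_right 0))).intervalIntegrable _ _)
  have hφT : φ T = 0 := by
    obtain ⟨T', hT', h⟩ := hφ.support
    exact funext fun x => h T hT'.le x
  -- integration by parts in time, for each frequency
  have hk : ∀ k, (∫ t in (0)..T, u t k * pairing k fun x => deriv (fun r => φ r x) t)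
      - ∫ t in (0)..T, -rhs m α β (u t) (v t) k * pairing k (φ t)
      = -(u 0 k * pairing k (φ 0)) := fun k => by
    have hc1 : Continuous fun t => u t k * pairing k fun x => deriv (fun r => φ r x) t :=
      (hu.continuous k).mul (continuous_pairing hφ' k)
    have hc2 : Continuous fun t => -rhs m α β (u t) (v t) k * pairing k (φ t) :=
      (hcont k).neg.mul (continuous_pairing hφ.contDiff.continuous k)
    have h := intervalIntegral.integral_eq_sub_of_hasDerivAt_of_le hT
      (f := fun t => u t k * pairing k (φ t))
      (f' := fun t => (u t k * pairing k fun x => deriv (fun r => φ r x) t)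
        - -rhs m α β (u t) (v t) k * pairing k (φ t))
      ((hu.continuous k).mul (continuous_pairing hφ.contDiff.continuous k)).continuousOn
      (fun t ht => ((hd t ht.1 k).mul (hasDerivAt_pairing hφ.contDiff k t)).congr_deriv (by ring))
      ((hc1.sub hc2).intervalIntegrable _ _)
    rw [intervalIntegral.integral_sub (hc1.intervalIntegrable _ _)
      (hc2.intervalIntegrable _ _)] at h
    rw [h, hφT]
    simp [pairing]
  have hfin := ((hA.sub hB).congr_fun fun k => (hk k).symm).unique hC.neg
  have hreal : (∫ t in (0)..T, ∫ x in (-π)..π, synth (u t) x * deriv (fun r => φ r x) t)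
      - (∫ t in (0)..T, ∫ x in (-π)..π,
        (m * (α * synth (diffCoeff (u t)) x + β * synth (diffCoeff (v t)) x) + synth (u t) x *
          (α * synth (diffCoeff (u t)) x + β * synth (diffCoeff (v t)) x)) *
            deriv (φ t) x) = -∫ x in (-π)..π, synth (u 0) x * φ 0 x := by
    exact_mod_cast hfin
  have hψ := continuous_deriv_snd hφ.contDiff
  have i1 := integrable_mul_continuous (integrable_gradient hu hv α β hT) hψ
  have i2 := integrable_mul_continuous (integrable_flux hu hv α β hT) hψ
  have hsplit : (∫ t in (0)..T, ∫ x in (-π)..π,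
        (m * (α * synth (diffCoeff (u t)) x + β * synth (diffCoeff (v t)) x) + synth (u t) x *
          (α * synth (diffCoeff (u t)) x + β * synth (diffCoeff (v t)) x)) * deriv (φ t) x)
      = (m * ∫ t in (0)..T, ∫ x in (-π)..π,
          (α * synth (diffCoeff (u t)) x + β * synth (diffCoeff (v t)) x) * deriv (φ t) x)
        + ∫ t in (0)..T, ∫ x in (-π)..π, synth (u t) x *
          (α * synth (diffCoeff (u t)) x + β * synth (diffCoeff (v t)) x) * deriv (φ t) x := by
    rw [integral_cylinder hT i1, integral_cylinder hT i2, ← integral_const_mul,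
      integral_cylinder hT]
    · refine Eq.trans ?_ (integral_add (i1.const_mul m) i2)
      refine integral_congr_ae (ae_of_all _ fun q => ?_)
      simp only
      ring
    · refine ((i1.const_mul m).add i2).congr (ae_of_all _ fun q => ?_)
      simp only [Pi.add_apply, Function.uncurry]
      ring
  linarith

end IsProfile

/-! ### Fourier coefficients of the initial data -/

lemma coeff_neg (u : ℝ → ℝ) (k : ℤ) : coeff u (-k) = conj (coeff u k) := by
  rw [coeff_eq, coeff_eq, map_mul, ← intervalIntegral.intervalIntegral_conj]
  congr 1
  · have h : (1 / (2 * π) : ℂ) = ((1 / (2 * π) : ℝ) : ℂ) := by push_cast; rfl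
    rw [h, Complex.conj_ofReal]
  · refine intervalIntegral.integral_congr fun x _ => ?_
    simp only [map_mul, Complex.conj_ofReal, conj_char]

lemma coeff_sub {u v : ℝ → ℝ} (hu : Integrable u torus) (hv : Integrable v torus) (k : ℤ) :
    coeff (u - v) k = coeff u k - coeff v k := by
  have hi : ∀ {w : ℝ → ℝ}, Integrable w torus →
      IntervalIntegrable (fun x => (w x : ℂ) * char (-k) x) volume (-π) π := fun hw => by
    rw [intervalIntegrable_iff_integrableOn_Ioc_of_le (by linarith [Real.pi_pos])]
    exact hw.ofReal.mul_bdd (c := 1) (continuous_char _).aestronglyMeasurable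
      (ae_of_all _ fun x => (norm_char _ _).le)
  rw [coeff_eq, coeff_eq, coeff_eq, ← mul_sub, ← intervalIntegral.integral_sub (hi hu) (hi hv)]
  congr 1
  refine intervalIntegral.integral_congr fun x _ => ?_
  simp only [Pi.sub_apply]
  push_cast
  ring

/-- A square integrable function with vanishing Fourier coefficients vanishes. -/
lemma ae_eq_zero_of_coeff {u : ℝ → ℝ} (hu : MemLp u 2 torus) (h : ∀ k, coeff u k = 0) :
    u =ᵐ[torus] 0 := by
  have hu' : MemLp (fun x => (u x : ℂ)) 2 (volume.restrict (Ioc (-π) π)) := hu.ofReal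
  have h1 := hasSum_sq_fourierCoeffOn (neg_lt_self Real.pi_pos) hu'
  have h2 : (fun k => ‖fourierCoeffOn (neg_lt_self Real.pi_pos) (fun x => (u x : ℂ)) k‖ ^ 2)
      = fun _ => 0 := funext fun k => by
    have := h k
    rw [coeff] at this
    rw [this, norm_zero, zero_pow two_ne_zero]
  rw [h2] at h1
  have h3 := h1.unique hasSum_zero
  have hπ : (π - -π)⁻¹ ≠ 0 := inv_ne_zero (by linarith [Real.pi_pos])
  rw [smul_eq_mul, mul_eq_zero, or_iff_right hπ, ← integral_torus] at h3
  have h4 : Integrable (fun x => ‖(u x : ℂ)‖ ^ 2) torus := hu'.integrable_norm_pow two_ne_zero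
  filter_upwards [(integral_eq_zero_iff_of_nonneg (fun _ => by positivity) h4).1 h3] with x hx
  simpa using hx

lemma mem_of_hdotNorm_lt_top {s : ℝ} {w : ℝ → ℝ} (h : hdotNorm s w < ⊤) :
    MemLp w 2 torus ∧ mean w = 0 := by
  by_contra hc
  rw [hdotNorm, iInf_neg hc] at h
  exact lt_irrefl _ h

lemma coeff_zero_of_hdotNorm {w : ℝ → ℝ} (h : hdotNorm 1 w < ⊤) : coeff w 0 = 0 := by
  rw [← ofReal_mean, (mem_of_hdotNorm_lt_top h).2, Complex.ofReal_zero]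

lemma eSobolev_coeff_lt_top {w : ℝ → ℝ} (h : hdotNorm 1 w < ⊤) : eSobolev 1 (coeff w) < ⊤ := by
  rw [hdotNorm, iInf_pos (mem_of_hdotNorm_lt_top h)] at h
  have h1 := (ENNReal.rpow_lt_top_iff_of_pos (by norm_num)).1 h
  refine lt_of_le_of_lt (ENNReal.tsum_le_tsum fun k => ?_) h1
  rw [enorm_mul, mul_pow]
  refine mul_le_mul_left (le_of_eq ?_) _
  rw [← ofReal_norm, ← ENNReal.ofReal_pow (norm_nonneg _), norm_pow, Complex.norm_intCast]
  congr 1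
  rw [mul_one, pow_one, Real.rpow_two]

lemma summable_coeff {w : ℝ → ℝ} (h : hdotNorm 1 w < ⊤) : Summable fun k => ‖coeff w k‖ := by
  refine summable_of_weighted (fun _ => norm_nonneg _)
    (by rw [coeff_zero_of_hdotNorm h, norm_zero]) ?_
  refine (ENNReal.summable_toReal (eSobolev_coeff_lt_top h).ne).congr fun k => ?_
  simp

/-- A function in `Ḣ¹` is the sum of its Fourier series almost everywhere. -/
lemma ae_eq_synth_coeff {w : ℝ → ℝ} (h : hdotNorm 1 w < ⊤) : w =ᵐ[torus] synth (coeff w) := by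
  have hs := summable_coeff h
  have hw := (mem_of_hdotNorm_lt_top h).1
  have h1 := memLp_synth hs 2
  have h2 := ae_eq_zero_of_coeff (hw.sub h1) fun k => by
    rw [coeff_sub (hw.integrable one_le_two) (h1.integrable one_le_two), coeff_synth hs,
      herm_eq_self (coeff_neg w), sub_self]
  filter_upwards [h2] with x hx
  exact sub_eq_zero.1 hx

/-- Data in `Ḣ¹` are integrable with zero mean, so that `wienerNorm` does not take its value `∞` off
the space. -/
lemma wienerNorm_zero {w : ℝ → ℝ} (h : hdotNorm 1 w < ⊤) : wienerNorm 0 w = eWiener 0 (coeff w) := by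
  have hw := mem_of_hdotNorm_lt_top h
  rw [wienerNorm, iInf_pos ⟨hw.1.integrable one_le_two, hw.2⟩]
  refine tsum_congr fun k => ?_
  simp

/-! ### Bounds for pairs of Fourier series -/

lemma tendsto_add_wsum (i : ℕ) (a c : ℤ → ℂ) :
    Tendsto (fun K => ENNReal.ofReal (wsum K i a + wsum K i c)) atTop
      (𝓝 (eWiener i a + eWiener i c)) := by
  simp only [ENNReal.ofReal_add (wsum_nonneg _ _ _) (wsum_nonneg _ _ _), ofReal_wsum]
  exact Tendsto.add ENNReal.summable.hasSum ENNReal.summable.hasSum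

lemma tendsto_add_qsum (i : ℕ) (a c : ℤ → ℂ) :
    Tendsto (fun K => ENNReal.ofReal (qsum K i a + qsum K i c)) atTop
      (𝓝 (eSobolev i a + eSobolev i c)) := by
  simp only [ENNReal.ofReal_add (qsum_nonneg _ _ _) (qsum_nonneg _ _ _), ofReal_qsum]
  exact Tendsto.add ENNReal.summable.hasSum ENNReal.summable.hasSum

lemma wsum_le_toReal {a c : ℤ → ℂ} {i : ℕ} (h : eWiener i a + eWiener i c ≠ ⊤) (K : Finset ℤ) :
    wsum K i a + wsum K i c ≤ (eWiener i a + eWiener i c).toReal := by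
  rw [← ENNReal.ofReal_le_iff_le_toReal h,
    ENNReal.ofReal_add (wsum_nonneg _ _ _) (wsum_nonneg _ _ _), ofReal_wsum, ofReal_wsum]
  exact add_le_add (ENNReal.sum_le_tsum K) (ENNReal.sum_le_tsum K)

lemma qsum_le_toReal {a c : ℤ → ℂ} {i : ℕ} (h : eSobolev i a + eSobolev i c ≠ ⊤)
    (K : Finset ℤ) : qsum K i a + qsum K i c ≤ (eSobolev i a + eSobolev i c).toReal := by
  rw [← ENNReal.ofReal_le_iff_le_toReal h,
    ENNReal.ofReal_add (qsum_nonneg _ _ _) (qsum_nonneg _ _ _), ofReal_qsum, ofReal_qsum]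
  exact add_le_add (ENNReal.sum_le_tsum K) (ENNReal.sum_le_tsum K)

/-! ### The solution in physical space -/

namespace IsFourierSolution

variable {p : Coeffs} {E σ κ M C : ℝ} {a c : ℤ → ℂ} {f g : ℝ → ℤ → ℂ}

lemma eLpNorm_decay (h : IsFourierSolution p E σ κ M C a c f g) {t : ℝ} (ht : 0 ≤ t) :
    eLpNorm (synth (f t)) ⊤ torus + eLpNorm (synth (g t)) ⊤ torus
      ≤ ENNReal.ofReal (E * Real.exp (-(σ / 2) * t)) := by
  have h1 : ∀ a : ℤ → ℂ, eLpNorm (synth a) ⊤ torus ≤ eWiener 0 a := fun a => by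
    simpa using eLpNorm_synth_le ⊤ a
  refine (add_le_add (h1 _) (h1 _)).trans (le_of_tendsto' (tendsto_add_wsum 0 _ _) fun K => ?_)
  refine ENNReal.ofReal_le_ofReal ?_
  have h2 := h.decay t ht K
  rwa [neg_mul, Real.exp_neg, ← div_eq_mul_inv, le_div_iff₀ (Real.exp_pos _), mul_comm]

lemma sobolevEnergy_le (h : IsFourierSolution p E σ κ M C a c f g) {s : ℝ} {i : ℕ} (hs : s ≤ i)
    (t : ℝ) : sobolevEnergy s (synth (f t)) (synth (g t)) ≤ eSobolev i (f t) + eSobolev i (g t) :=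
  add_le_add (hdotNorm_synth_sq_le hs (h.f_profile.zero t) (h.f_profile.summable t))
    (hdotNorm_synth_sq_le hs (h.g_profile.zero t) (h.g_profile.summable t))

lemma intervalIntegrable_qsum {u : ℝ → ℤ → ℂ} (hu : IsProfile E C u) (K : Finset ℤ) (T : ℝ) :
    IntervalIntegrable (fun s => qsum K 2 (u s)) volume 0 T :=
  ((continuous_qsum K 2).comp (continuous_pi hu.continuous)).intervalIntegrable _ _

/-- The decay in `Ḣ¹` carries over to `Ḣ^s` with `s ≤ 1`, since the mean vanishes. -/
lemma sobolevEnergy_decay (h : IsFourierSolution p E σ κ M C a c f g) (hκ : 0 ≤ κ) {s : ℝ}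
    (hs : s ≤ 1) {t : ℝ} (ht : 0 ≤ t) : sobolevEnergy s (synth (f t)) (synth (g t))
      ≤ ENNReal.ofReal (M * Real.exp (-κ * t)) := by
  refine (h.sobolevEnergy_le (i := 1) (by simpa using hs) t).trans
    (le_of_tendsto' (tendsto_add_qsum 1 _ _) fun K => ENNReal.ofReal_le_ofReal ?_)
  have h1 := h.energy t ht K
  have h2 : 0 ≤ κ * ∫ s in (0)..t, (qsum K 2 (f s) + qsum K 2 (g s)) :=
    mul_nonneg hκ (intervalIntegral.integral_nonneg ht fun s _ =>
      add_nonneg (qsum_nonneg _ _ _) (qsum_nonneg _ _ _))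
  rw [neg_mul, Real.exp_neg, ← div_eq_mul_inv, le_div_iff₀ (Real.exp_pos _), mul_comm]
  linarith

lemma sobolevEnergy_dissipation (h : IsFourierSolution p E σ κ M C a c f g) (hκ : 0 ≤ κ) {t : ℝ}
    (ht : 0 ≤ t) : sobolevEnergy 1 (synth (f t)) (synth (g t)) + ENNReal.ofReal κ *
      ∫⁻ s in Ioo 0 t, sobolevEnergy 2 (synth (f s)) (synth (g s)) ≤ ENNReal.ofReal M := by
  have h1 : ∫⁻ s in Ioo 0 t, sobolevEnergy 2 (synth (f s)) (synth (g s))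
      ≤ (∫⁻ s in Ioo 0 t, eSobolev 2 (f s)) + ∫⁻ s in Ioo 0 t, eSobolev 2 (g s) := by
    rw [← lintegral_add_left (h.f_profile.measurable_eSobolev 2)]
    exact lintegral_mono fun s => h.sobolevEnergy_le (i := 2) (by norm_num) s
  have hlim := (tendsto_add_qsum 1 (f t) (g t)).add (ENNReal.Tendsto.const_mul
    ((h.f_profile.tendsto_integral_qsum ht).add (h.g_profile.tendsto_integral_qsum ht))
    (.inr (ENNReal.ofReal_ne_top (r := κ))))
  refine (add_le_add (h.sobolevEnergy_le (i := 1) (by norm_num) t)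
    (mul_le_mul_right h1 _)).trans (le_of_tendsto' hlim fun K => ?_)
  have hn : ∀ u : ℝ → ℤ → ℂ, 0 ≤ ∫ s in (0)..t, qsum K 2 (u s) := fun u =>
    intervalIntegral.integral_nonneg ht fun s _ => qsum_nonneg _ _ _
  have hq : 0 ≤ qsum K 1 (f t) + qsum K 1 (g t) :=
    add_nonneg (qsum_nonneg _ _ _) (qsum_nonneg _ _ _)
  rw [← ENNReal.ofReal_add (hn f) (hn g), ← ENNReal.ofReal_mul hκ,
    ← ENNReal.ofReal_add hq (mul_nonneg hκ (add_nonneg (hn f) (hn g)))]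
  refine ENNReal.ofReal_le_ofReal ?_
  have h2 := h.energy t ht K
  rw [intervalIntegral.integral_add (intervalIntegrable_qsum h.f_profile K t)
    (intervalIntegrable_qsum h.g_profile K t)] at h2
  have h3 : 1 * (qsum K 1 (f t) + qsum K 1 (g t))
      ≤ Real.exp (κ * t) * (qsum K 1 (f t) + qsum K 1 (g t)) :=
    mul_le_mul_of_nonneg_right (Real.one_le_exp (mul_nonneg hκ ht)) hq
  linarith

/-- The Fourier series form a weak solution of the Muskat system, whose second equation has
`α' = β' = bμ`. -/
theorem isWeakSolution {b bρ bμ m n : ℝ} {f₀ g₀ : ℝ → ℝ}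
    (h : IsFourierSolution ⟨m, n, bρ, b, bμ, bμ⟩ E σ κ M C a c f g)
    (hf₀ : f₀ =ᵐ[torus] synth a) (hg₀ : g₀ =ᵐ[torus] synth c) {T : ℝ} (hT : 0 ≤ T) :
    IsWeakSolution b bρ bμ m n f₀ g₀ T (fun t => synth (f t)) (fun t => synth (g t)) := by
  have hf := h.f_profile
  have hg := h.g_profile
  have hinit : ∀ {u v : ℝ → ℝ}, u =ᵐ[torus] v → ∀ ψ : ℝ → ℝ,
      ∫ x in (-π)..π, u x * ψ x = ∫ x in (-π)..π, v x * ψ x := fun huv ψ => by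
    rw [← integral_torus, ← integral_torus]
    refine integral_congr_ae ?_
    filter_upwards [huv] with x hx
    rw [hx]
  have hcomm : ∀ t x, bμ * synth (diffCoeff (g t)) x + bμ * synth (diffCoeff (f t)) x
      = bμ * synth (diffCoeff (f t)) x + bμ * synth (diffCoeff (g t)) x := fun t x => add_comm _ _
  refine
    { mem_f := hf.inBochner_sobolevNorm hT
      mem_g := hg.inBochner_sobolevNorm hT
      mean_f := ae_of_all _ fun t => mean_synth (hf.summable t) (hf.zero t)
      mean_g := ae_of_all _ fun t => mean_synth (hg.summable t) (hg.zero t)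
      integrable_f := memLp_one_iff_integrable.1 (hf.memLp_uncurry 1 T)
      integrable_g := memLp_one_iff_integrable.1 (hg.memLp_uncurry 1 T)
      weak := ⟨fun t => synth (diffCoeff (f t)), fun t => synth (diffCoeff (g t)), ?_,
        hf.integrable_diff hT, hg.integrable_diff hT, hf.integrable_flux hg bρ b hT, ?_,
        fun φ hφ => ?_, fun ψ hψ => ?_⟩ }
  · filter_upwards [hf.ae_eWiener_lt_top hT, hg.ae_eWiener_lt_top hT] with t h1 h2
    exact ⟨isWeakDeriv_synth (hf.zero t) ((eWiener_mono one_le_two (hf.zero t)).trans_lt h1),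
      isWeakDeriv_synth (hg.zero t) ((eWiener_mono one_le_two (hg.zero t)).trans_lt h2)⟩
  · simpa only [hcomm] using hg.integrable_flux hf bμ bμ hT
  · have := hf.weak_formulation hg h.f_deriv h.f_rhs_continuous hT (h.f_rhs_int T hT) hφ
    rwa [h.f_init, ← hinit hf₀] at this
  · have := hg.weak_formulation hf h.g_deriv h.g_rhs_continuous hT (h.g_rhs_int T hT) hψ
    simp only [hcomm] at this
    rwa [h.g_init, ← hinit hg₀] at this

end IsFourierSolution

end Muskat
end

open Muskat
theorem theorem4
    -- densities and viscosities of the lower (`l`) and of the upper (`u`) fluid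
    (ρl ρu μl μu : ℝ) (hρl : 0 < ρl) (hρu : 0 < ρu) (hμl : 0 < μl) (hμu : 0 < μu)
    (b bμ bρ : ℝ) (hb : b = ρu) (hbμ : bμ = μl / μu * b) (hbρ : bρ = ρl / ρu * b)
    -- initial data, whose zero-mean parts lie in `Ḣ¹` (hence in the Wiener algebra)
    (f₀ g₀ : ℝ → ℝ)
    (hf₀ : hdotNorm 1 (centered f₀) < ⊤) (hg₀ : hdotNorm 1 (centered g₀) < ⊤)
    (E₀ : ℝ) (hE₀ : E₀ = (wienerEnergy 0 (centered f₀) (centered g₀)).toReal)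
    (hsmall : E₀ < min (mean f₀) (mean g₀))
    (hσ₁ : 0 < mean f₀ * bρ - mean g₀ * bμ - E₀ * (2 * bρ + 2 * b + 4 * bμ))
    (hσ₂ : 0 < mean g₀ * bμ - mean f₀ * b - E₀ * (2 * bρ + 2 * b + 4 * bμ))
    (h₁ : 0 < mean f₀ * bρ - 1 / 2 * (mean g₀ * bμ + mean f₀ * b)
      - (bρ + bμ + 5 * bμ / 2 + 5 * b / 2) * E₀)
    (h₂ : 0 < mean g₀ * bμ - 1 / 2 * (mean g₀ * bμ + mean f₀ * b)
      - (bρ + bμ + 5 * bμ / 2 + 5 * b / 2) * E₀) :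
    ∃ δ c₁ c₂ c₃ : ℝ, ∃ c : ℝ → ℝ,
      0 < δ ∧ 0 < c₁ ∧ 0 < c₂ ∧ 0 < c₃ ∧ (∀ s, 0 ≤ s → s < 1 → 0 < c s) ∧
      ∃ f g : ℝ → ℝ → ℝ,
        ∀ T : ℝ, 0 < T →
          -- a global weak solution in the Wiener class, with exponential decay in `L^∞`
          IsWeakSolution b bρ bμ (mean f₀) (mean g₀) (centered f₀) (centered g₀) T f g ∧
          WienerRegularity T f ∧ WienerRegularity T g ∧
          eLpNorm (f T) ⊤ torus + eLpNorm (g T) ⊤ torus ≤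
            ENNReal.ofReal (E₀ * Real.exp (-δ * T)) ∧
          -- propagation of Sobolev regularity
          InCont (hdotNorm 1) T f ∧ InCont (hdotNorm 1) T g ∧
          InBochner (hdotNorm 2) 2 T f ∧ InBochner (hdotNorm 2) 2 T g ∧
          sobolevEnergy 1 (f T) (g T)
              + ENNReal.ofReal c₁ * ∫⁻ t in Ioo 0 T, sobolevEnergy 2 (f t) (g t) ≤
            ENNReal.ofReal c₂ ∧
          ∀ s : ℝ, 0 ≤ s → s < 1 →
            sobolevEnergy s (f T) (g T) ≤ ENNReal.ofReal (c₃ * Real.exp (-c s * T)) := by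
  obtain ⟨hb0, hbμ0, hbρ0⟩ : 0 < b ∧ 0 < bμ ∧ 0 < bρ := by
    subst hb hbμ hbρ
    exact ⟨hρu, by positivity, by positivity⟩
  have hE : E₀ = (eWiener 0 (coeff (centered f₀)) + eWiener 0 (coeff (centered g₀))).toReal := by
    rw [hE₀, wienerEnergy, wienerNorm_zero hf₀, wienerNorm_zero hg₀]
  have hE0 : 0 ≤ E₀ := hE ▸ ENNReal.toReal_nonneg
  have hm : E₀ < mean f₀ := hsmall.trans_le (min_le_left _ _)
  have hn : E₀ < mean g₀ := hsmall.trans_le (min_le_right _ _)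
  have hEb : 0 ≤ E₀ * b := by positivity
  have hEbμ : 0 ≤ E₀ * bμ := by positivity
  have hEbρ : 0 ≤ E₀ * bρ := by positivity
  -- the margins in the hypotheses; those of the energy estimate are `2κ` in `Coeffs.Good`
  set σ := min (mean f₀ * bρ - mean g₀ * bμ - E₀ * (2 * bρ + 2 * b + 4 * bμ))
    (mean g₀ * bμ - mean f₀ * b - E₀ * (2 * bρ + 2 * b + 4 * bμ)) with hσ
  set κ := min (mean f₀ * bρ - 1 / 2 * (mean g₀ * bμ + mean f₀ * b)
      - (bρ + bμ + 5 * bμ / 2 + 5 * b / 2) * E₀)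
    (mean g₀ * bμ - 1 / 2 * (mean g₀ * bμ + mean f₀ * b)
      - (bρ + bμ + 5 * bμ / 2 + 5 * b / 2) * E₀) / 2 with hκ
  have hσ0 : 0 < σ := lt_min hσ₁ hσ₂
  have hκ0 : 0 < κ := half_pos (lt_min h₁ h₂)
  have s1 : σ ≤ mean f₀ * bρ - mean g₀ * bμ - E₀ * (2 * bρ + 2 * b + 4 * bμ) := min_le_left _ _
  have s2 : σ ≤ mean g₀ * bμ - mean f₀ * b - E₀ * (2 * bρ + 2 * b + 4 * bμ) := min_le_right _ _
  have k1 : 2 * κ ≤ mean f₀ * bρ - 1 / 2 * (mean g₀ * bμ + mean f₀ * b)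
      - (bρ + bμ + 5 * bμ / 2 + 5 * b / 2) * E₀ := by
    rw [hκ, mul_div_cancel₀ _ two_ne_zero]
    exact min_le_left _ _
  have k2 : 2 * κ ≤ mean g₀ * bμ - 1 / 2 * (mean g₀ * bμ + mean f₀ * b)
      - (bρ + bμ + 5 * bμ / 2 + 5 * b / 2) * E₀ := by
    rw [hκ, mul_div_cancel₀ _ two_ne_zero]
    exact min_le_right _ _
  have hp : Coeffs.Good ⟨mean f₀, mean g₀, bρ, b, bμ, bμ⟩ E₀ σ κ :=
    { m_nonneg := hE0.trans hm.le
      n_nonneg := hE0.trans hn.le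
      α_nonneg := hbρ0.le
      β_nonneg := hb0.le
      α'_nonneg := hbμ0.le
      β'_nonneg := hbμ0.le
      E_nonneg := hE0
      σ_pos := hσ0
      κ_pos := hκ0
      wiener_f := by simp only; linarith
      wiener_g := by simp only; linarith
      sobolev_f := by simp only; linarith
      sobolev_g := by simp only; linarith }
  have hfin0 : eWiener 0 (coeff (centered f₀)) + eWiener 0 (coeff (centered g₀)) ≠ ⊤ := by
    have key : ∀ {w : ℝ → ℝ}, hdotNorm 1 w < ⊤ → eWiener 0 (coeff w) ≠ ⊤ := fun hw => by
      simp only [eWiener, pow_zero, one_mul, ← ofReal_norm]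
      exact (summable_coeff hw).tsum_ofReal_ne_top
    exact ENNReal.add_ne_top.2 ⟨key hf₀, key hg₀⟩
  have hfin1 : eSobolev 1 (coeff (centered f₀)) + eSobolev 1 (coeff (centered g₀)) ≠ ⊤ :=
    ENNReal.add_ne_top.2 ⟨(eSobolev_coeff_lt_top hf₀).ne, (eSobolev_coeff_lt_top hg₀).ne⟩
  obtain ⟨f, g, C, h⟩ := exists_fourierSolution hp (coeff_zero_of_hdotNorm hf₀)
    (coeff_zero_of_hdotNorm hg₀) (coeff_neg _) (coeff_neg _)
    (fun K => (wsum_le_toReal hfin0 K).trans_eq hE.symm) (qsum_le_toReal hfin1)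
  set M := Coeffs.sobolevBound ⟨mean f₀, mean g₀, bρ, b, bμ, bμ⟩ E₀ σ κ
    (eSobolev 1 (coeff (centered f₀)) + eSobolev 1 (coeff (centered g₀))).toReal with hM
  have hM0 : 0 ≤ M := mul_nonneg (Real.exp_pos _).le ENNReal.toReal_nonneg
  -- `M = 0` if the data vanish, whence `M + 1`
  refine ⟨σ / 2, κ, M + 1, M + 1, fun _ => κ, by positivity, hκ0, by positivity, by positivity,
    fun _ _ _ => hκ0, fun t => synth (f t), fun t => synth (g t), fun T hT => ?_⟩
  have hM1 : M ≤ M + 1 := by linarith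
  exact ⟨h.isWeakSolution (ae_eq_synth_coeff hf₀) (ae_eq_synth_coeff hg₀) hT.le,
    h.f_profile.wienerRegularity hT.le, h.g_profile.wienerRegularity hT.le,
    h.eLpNorm_decay hT.le, h.f_profile.inCont T, h.g_profile.inCont T,
    h.f_profile.inBochner_hdotNorm_two hT.le, h.g_profile.inBochner_hdotNorm_two hT.le,
    (h.sobolevEnergy_dissipation hκ0.le hT.le).trans (ENNReal.ofReal_le_ofReal hM1),
    fun s _ hs => (h.sobolevEnergy_decay hκ0.le hs.le hT.le).trans
      (ENNReal.ofReal_le_ofReal (mul_le_mul_of_nonneg_right hM1 (Real.exp_pos _).le))⟩
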